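/- Let $\Gamma_0,\dots,\Gamma_{10}$ be the real $32\times 32$ Clifford generators of the Majorana representation $\mathbf{32}$ of $\mathrm{Pin}^+(1,10)$, $\Gamma_a\Gamma_b+\Gamma_b\Gamma_a=2\eta_{ab}$ with $\eta=\mathrm{diag}(-1,1,\dots,1)$ and $\Gamma_0\Gamma_1\cdots\Gamma_{10}=1$, equipped with a non-degenerate skew-symmetric bilinear form $(\overline{\phi}\,\psi)$ for which all $\Gamma_a$ are skew-self-adjoint. Put $\Gamma^B_a:=\Gamma_a$ for $a<9$, $\Gamma^B_9:=\Gamma_9\Gamma_{10}$, and let $\Gamma^B_{a_1\cdots a_p}$ be the product of $\Gamma^B_{a_1},\dots,\Gamma^B_{a_p}$ taken in increasing order of the indices, times the sign of the ordering permutation, if the indices are distinct, and $0$ otherwise. Vector indices are raised with $\eta$ and repeated ones are summed over $0,\dots,9$. A super-$L_\infty$ algebra $\mathfrak g$ (of finite type) is given by its Chevalley-Eilenberg algebra $\mathrm{CE}(\mathfrak g)$: the $\mathbb Z\times\mathbb Z_2$-graded-commutative polynomial algebra on generators of bidegrees $(n_i,\sigma_i)$ with sign rule $xy=(-1)^{n_xn_y+\sigma_x\sigma_y}yx$,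 with a differential of bidegree $(1,\mathrm{even})$; homomorphisms $\mathfrak g\to\mathfrak h$ are homomorphisms $\mathrm{CE}(\mathfrak h)\to\mathrm{CE}(\mathfrak g)$ of such differential algebras. The type IIB super-Minkowski algebra $\mathbb R^{1,9|\mathbf{16}\oplus\mathbf{16}}$ has generators $\psi^\alpha$ ($\alpha=1,\dots,32$) of bidegree $(1,\mathrm{odd})$ and $e^a$ ($a=0,\dots,9$) of bidegree $(1,\mathrm{even})$ with $\mathrm d\psi^\alpha=0$, $\mathrm de^a=(\overline\psi\,\Gamma_B^a\,\psi)$; the type IIA algebra $\mathbb R^{1,9|\mathbf{16}\oplus\overline{\mathbf{16}}}$ is the same with $\mathrm de^a=(\overline\psi\,\Gamma^a\,\psi)$, and the 9-dimensional algebra $\mathbb R^{1,8|\mathbf{16}\oplus\mathbf{16}}$ is obtained by omitting $e^9$. For $m\in\{0,1\}$, $\mathfrak l(\Sigma^m\mathrm{KU}/\!\!/B\mathrm U(1))$ has generators $h_3$ and $f_{2k+m}$ ($k\in\mathbb Z$), of even super-degree and of the indicated degrees, with $\mathrm dh_3=0$ and $\mathrm df_{2k+m}=h_3f_{2k+m-2}$;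 it is fibered over $\mathfrak lB^2\mathrm U(1)$ (one closed generator $\omega_3$ of degree 3) by $\omega_3\mapsto h_3$. In the CE-algebra of the type IIB algebra, set $$H_3^B=(\overline\psi\,\Gamma^B_a\Gamma_{10}\,\psi)e^a,\quad F_3=(\overline\psi\,\Gamma^B_a\Gamma_9\,\psi)e^a,\quad F_5=\tfrac1{3!}(\overline\psi\,\Gamma^B_{a_1a_2a_3}\Gamma_9\Gamma_{10}\,\psi)e^{a_1}e^{a_2}e^{a_3},$$ $$F_7=\tfrac1{5!}(\overline\psi\,\Gamma^B_{a_1\cdots a_5}\Gamma_9\,\psi)e^{a_1}\cdots e^{a_5},\quad F_9=\tfrac1{7!}(\overline\psi\,\Gamma^B_{a_1\cdots a_7}\Gamma_9\Gamma_{10}\,\psi)e^{a_1}\cdots e^{a_7},$$ $$F_{11}=\tfrac1{9!}(\overline\psi\,\Gamma^B_{a_1\cdots a_9}\Gamma_9\,\psi)e^{a_1}\cdots e^{a_9},\qquad F_{2k+1}=0\ \text{ for all other } k\in\mathbb Z .$$ Then: 1. $\deg H_3^B=(3,\mathrm{even})$, $\deg F_{2k+1}=(2k+1,\mathrm{even})$,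 $\mathrm dH_3^B=0$ and $\mathrm dF_{2k+1}=H_3^BF_{2k-1}$ for all $k\in\mathbb Z$. 2. Equivalently, $h_3\mapsto H_3^B$, $f_{2k+1}\mapsto F_{2k+1}$ is a super-$L_\infty$ homomorphism $\mathbb R^{1,9|\mathbf{16}\oplus\mathbf{16}}\to\mathfrak l(\Sigma^1\mathrm{KU}/\!\!/B\mathrm U(1))$ over $\mathfrak lB^2\mathrm U(1)$: systems $(H,(F_{2k+1})_{k\in\mathbb Z})$ of elements of these degrees with $\mathrm dH=0$, $\mathrm dF_{2k+1}=H F_{2k-1}$ are in bijection with such homomorphisms. 3. This homomorphism is the T-dual of the type IIA one. Let $H_3^A=(\overline\psi\,\Gamma_a\Gamma_{10}\,\psi)e^a$, $F_2=(\overline\psi\,\Gamma_{10}\,\psi)$, $F_{2j+2}=\frac1{(2j)!}(\overline\psi\,\Gamma_{10}^{\,j+1}\Gamma_{a_1\cdots a_{2j}}\,\psi)e^{a_1}\cdots e^{a_{2j}}$ for $1\le j\le5$ (with $\Gamma_{a_1\cdots a_p}$ the skew-symmetrized product of Clifford generators) and $F_{2k}=0$ for all other $k\in\mathbb Z$; these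 constitute a homomorphism $\mathbb R^{1,9|\mathbf{16}\oplus\overline{\mathbf{16}}}\to\mathfrak l(\Sigma^0\mathrm{KU}/\!\!/B\mathrm U(1))$. The IIA and IIB algebras are, with new generator $e^9$, the central extensions of the 9-dimensional algebra by the 2-cocycles $c_1^A=(\overline\psi\,\Gamma_9\,\psi)$ and $c_1^B=(\overline\psi\,\Gamma_9\Gamma_{10}\,\psi)$. For a super-$L_\infty$ algebra $\mathfrak h$ with generators $e^i$, the cyclification $\mathrm{cyc}\,\mathfrak h$ has generators $\omega_2$, $e^i$, $\mathrm se^i$ with $\mathrm d\omega_2=0$, $\mathrm de^i=\mathrm d_{\mathfrak h}e^i+\omega_2\,\mathrm se^i$, $\mathrm d\,\mathrm se^i=-\mathrm s(\mathrm d_{\mathfrak h}e^i)$, where $\mathrm s$ is the graded derivation of degree $-1$ with $e^i\mapsto\mathrm se^i$, $\mathrm se^i\mapsto0$, $\omega_2\mapsto0$. A map $\tilde f:\mathfrak g\to\mathrm{cyc}\,\mathfrak h$ is the reduction of $f:\hat{\mathfrak g}\to\mathfrak h$ (and $f$ the oxidation of $\tilde f$), for $\hat{\mathfrak g}$ the central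 extension of $\mathfrak g$ by $c$ with new generator $e'$, $\mathrm de'=c$, if $\tilde f^*\omega_2=c$ and $f^*e^i=\tilde f^*e^i-e'\,\tilde f^*(\mathrm se^i)$. Then the type IIA homomorphism has a reduction to 9 dimensions along $c_1^A$, and the oxidation along $c_1^B$ of its composite with the isomorphism $T:\mathrm{cyc}\,\mathfrak l(\Sigma^0\mathrm{KU}/\!\!/B\mathrm U(1))\to\mathrm{cyc}\,\mathfrak l(\Sigma^1\mathrm{KU}/\!\!/B\mathrm U(1))$, $$T^*:\ \omega_2\mapsto-\mathrm sh_3,\quad \mathrm sh_3\mapsto-\omega_2,\quad h_3\mapsto h_3,\quad f_{2k+1}\mapsto\mathrm sf_{2k+2},\quad \mathrm sf_{2k+1}\mapsto f_{2k},$$ is the homomorphism of part 2. -/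

import Mathlib

noncomputable section

namespace SuperL

/-! ### Bigraded-commutative algebras -/

/-- Bidegrees: homological degree in `ℤ`, super-degree in `ℤ/2` (`0` even, `1` odd). -/
abbrev BiDeg : Type := ℤ × ZMod 2

/-- The sign `(-1) ^ (n₁ n₂ + σ₁ σ₂)` of the bigraded sign rule. -/
def koszul (p q : BiDeg) : ℝ := (-1 : ℝ) ^ (p.1 * q.1) * (-1 : ℝ) ^ (p.2 * q.2).val

theorem negOne_pow_val_add (a b : ZMod 2) :
    (-1 : ℝ) ^ (a + b).val = (-1 : ℝ) ^ a.val * (-1 : ℝ) ^ b.val := by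
  have h : ∀ a b : ZMod 2, (a + b).val % 2 = (a.val + b.val) % 2 := by decide
  rw [← pow_add, neg_one_pow_eq_pow_mod_two (a + b).val, h a b, ← neg_one_pow_eq_pow_mod_two]

theorem koszul_add_left (p p' q : BiDeg) : koszul (p + p') q = koszul p q * koszul p' q := by
  simp only [koszul, Prod.fst_add, Prod.snd_add, add_mul, negOne_pow_val_add,
    zpow_add₀ (show (-1 : ℝ) ≠ 0 by norm_num)]
  ring

theorem koszul_comm (p q : BiDeg) : koszul p q = koszul q p := by
  simp only [koszul, mul_comm]

theorem koszul_add_right (p q q' : BiDeg) : koszul p (q + q') = koszul p q * koszul p q' := by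
  rw [koszul_comm, koszul_add_left, koszul_comm q, koszul_comm q']

theorem koszul_mul_self (p q : BiDeg) : koszul p q * koszul p q = 1 := by
  rw [koszul]
  have h1 : (-1 : ℝ) ^ (p.1 * q.1) * (-1 : ℝ) ^ (p.1 * q.1) = 1 := by
    rw [← mul_zpow]; norm_num
  have h2 : (-1 : ℝ) ^ (p.2 * q.2).val * (-1 : ℝ) ^ (p.2 * q.2).val = 1 := by
    rw [← mul_pow]; norm_num
  calc _ = ((-1 : ℝ) ^ (p.1 * q.1) * (-1 : ℝ) ^ (p.1 * q.1)) *
        ((-1 : ℝ) ^ (p.2 * q.2).val * (-1 : ℝ) ^ (p.2 * q.2).val) := by ring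
    _ = 1 := by rw [h1, h2, one_mul]

theorem koszul_zero_right (p : BiDeg) : koszul p 0 = 1 := by simp [koszul]

/-- The sign rule `vᵢ vⱼ = sgn(deg vᵢ, deg vⱼ) vⱼ vᵢ` on generators. -/
inductive SignRel {I : Type*} (deg : I → BiDeg) : FreeAlgebra ℝ I → FreeAlgebra ℝ I → Prop
  | swap (i j : I) : SignRel deg (FreeAlgebra.ι ℝ i * FreeAlgebra.ι ℝ j)
      (koszul (deg i) (deg j) • (FreeAlgebra.ι ℝ j * FreeAlgebra.ι ℝ i))

/-- The graded-commutative polynomial algebra `ℝ[(vᵢ)]`: the tensor algebra on the generators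
modulo the sign rule. -/
def GCAlg {I : Type*} (deg : I → BiDeg) : Type _ := RingQuot (SignRel deg)

instance {I : Type*} (deg : I → BiDeg) : Ring (GCAlg deg) :=
  inferInstanceAs (Ring (RingQuot (SignRel deg)))

instance {I : Type*} (deg : I → BiDeg) : Algebra ℝ (GCAlg deg) :=
  inferInstanceAs (Algebra ℝ (RingQuot (SignRel deg)))

namespace GCAlg

variable {I : Type*} {deg : I → BiDeg}

/-- The quotient map from the tensor algebra. -/
def mk (deg : I → BiDeg) : FreeAlgebra ℝ I →ₐ[ℝ] GCAlg deg := RingQuot.mkAlgHom ℝ (SignRel deg)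

/-- The generators. -/
def gen (deg : I → BiDeg) (i : I) : GCAlg deg := mk deg (FreeAlgebra.ι ℝ i)

theorem gen_mul_gen (i j : I) :
    gen deg i * gen deg j = koszul (deg i) (deg j) • (gen deg j * gen deg i) := by
  have h := RingQuot.mkAlgHom_rel ℝ (SignRel.swap (deg := deg) i j)
  rw [map_mul, map_smul, map_mul] at h
  exact h

/-- The universal property of the graded-commutative polynomial algebra. -/
def lift {A : Type*} [Ring A] [Algebra ℝ A] (φ : I → A)
    (h : ∀ i j, φ i * φ j = koszul (deg i) (deg j) • (φ j * φ i)) : GCAlg deg →ₐ[ℝ] A :=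
  RingQuot.liftAlgHom ℝ ⟨FreeAlgebra.lift ℝ φ, by
    rintro _ _ ⟨i, j⟩
    simpa using h i j⟩

@[simp]
theorem lift_gen {A : Type*} [Ring A] [Algebra ℝ A] (φ : I → A)
    (h : ∀ i j, φ i * φ j = koszul (deg i) (deg j) • (φ j * φ i)) (i : I) :
    lift φ h (gen deg i) = φ i := by
  have := RingQuot.liftAlgHom_mkAlgHom_apply ℝ (s := SignRel deg) (FreeAlgebra.lift ℝ φ) (by
    rintro _ _ ⟨i, j⟩
    simpa using h i j) (FreeAlgebra.ι ℝ i)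
  rw [FreeAlgebra.lift_ι_apply] at this
  exact this

/-- The elements of bidegree `n`: linear combinations of words of total bidegree `n`. -/
def homog (deg : I → BiDeg) (n : BiDeg) : Submodule ℝ (GCAlg deg) :=
  Submodule.span ℝ {x | ∃ l : List I, (l.map deg).sum = n ∧ x = (l.map (gen deg)).prod}

theorem word_mem (l : List I) : (l.map (gen deg)).prod ∈ homog deg (l.map deg).sum :=
  Submodule.subset_span ⟨l, rfl, rfl⟩

theorem gen_mem (i : I) : gen deg i ∈ homog deg (deg i) := by
  simpa using word_mem (deg := deg) [i]

theorem one_mem : (1 : GCAlg deg) ∈ homog deg 0 := by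
  simpa using word_mem (deg := deg) []

theorem mul_mem {m n : BiDeg} {x y : GCAlg deg} (hx : x ∈ homog deg m) (hy : y ∈ homog deg n) :
    x * y ∈ homog deg (m + n) := by
  induction hx using Submodule.span_induction with
  | mem x hx =>
    obtain ⟨l, rfl, rfl⟩ := hx
    induction hy using Submodule.span_induction with
    | mem y hy =>
      obtain ⟨l', rfl, rfl⟩ := hy
      have := word_mem (deg := deg) (l ++ l')
      simpa using this
    | zero => simp
    | add y z _ _ h1 h2 => rw [mul_add]; exact add_mem h1 h2
    | smul c y _ h => rw [mul_smul_comm]; exact Submodule.smul_mem _ _ h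
  | zero => simp
  | add y z _ _ h1 h2 => rw [add_mul]; exact add_mem h1 h2
  | smul c y _ h => rw [smul_mul_assoc]; exact Submodule.smul_mem _ _ h

/-- The words span. -/
theorem span_words :
    Submodule.span ℝ (Set.range fun l : List I => (l.map (gen deg)).prod) = ⊤ := by
  set W := Submodule.span ℝ (Set.range fun l : List I => (l.map (gen deg)).prod) with hW
  have hg : ∀ (i : I) (x : GCAlg deg), x ∈ W → gen deg i * x ∈ W := by
    intro i x hx
    induction hx using Submodule.span_induction with
    | mem x hx =>
      obtain ⟨l, rfl⟩ := hx
      exact Submodule.subset_span ⟨i :: l, by simp⟩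
    | zero => simp
    | add y z _ _ h1 h2 => rw [mul_add]; exact add_mem h1 h2
    | smul c y _ h => rw [mul_smul_comm]; exact Submodule.smul_mem _ _ h
  have key : ∀ (a : FreeAlgebra ℝ I) (x : GCAlg deg), x ∈ W →
      mk deg a * x ∈ W := by
    intro a
    induction a using FreeAlgebra.induction with
    | grade0 r =>
      intro x hx
      have : mk deg (algebraMap ℝ (FreeAlgebra ℝ I) r) * x = r • x := by
        rw [AlgHom.commutes, ← Algebra.smul_def]
      exact this ▸ Submodule.smul_mem _ _ hx
    | grade1 i => intro x hx; exact hg i x hx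
    | mul a b ha hb =>
      intro x hx
      have : mk deg (a * b) * x =
          mk deg a * (mk deg b * x) := by
        rw [map_mul, mul_assoc]
      exact this ▸ ha _ (hb _ hx)
    | add a b ha hb =>
      intro x hx
      have : mk deg (a + b) * x =
          mk deg a * x +
            mk deg b * x := by
        rw [map_add, add_mul]
      exact this ▸ add_mem (ha _ hx) (hb _ hx)
  rw [eq_top_iff]
  intro x _
  obtain ⟨a, rfl⟩ := RingQuot.mkAlgHom_surjective ℝ (SignRel deg) x
  have h1 : (1 : GCAlg deg) ∈ W := Submodule.subset_span ⟨[], by simp⟩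
  have := key a 1 h1
  rwa [mul_one] at this

/-- Two linear maps agree if they agree on words. -/
theorem linearMap_ext {M : Type*} [AddCommGroup M] [Module ℝ M] {f g : GCAlg deg →ₗ[ℝ] M}
    (h : ∀ l : List I, f (l.map (gen deg)).prod = g (l.map (gen deg)).prod) : f = g :=
  LinearMap.ext_on_range span_words h

theorem algHom_ext {A : Type*} [Ring A] [Algebra ℝ A] {f g : GCAlg deg →ₐ[ℝ] A}
    (h : ∀ i, f (gen deg i) = g (gen deg i)) : f = g := by
  apply AlgHom.toLinearMap_injective
  apply linearMap_ext
  intro l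
  simp only [AlgHom.toLinearMap_apply, map_list_prod, List.map_map]
  congr 1
  exact List.map_congr_left fun i _ => h i

theorem eq_zero_of_eq_neg {x : GCAlg deg} (h : x = -x) : x = 0 := by
  have h2 : (2 : ℝ) • x = 0 := by
    rw [two_smul]
    nth_rewrite 1 [h]
    exact neg_add_cancel x
  have := congrArg (fun y => (2 : ℝ)⁻¹ • y) h2
  simpa [smul_smul] using this

/-- Homogeneous elements commute with generators up to the sign rule. -/
theorem homog_mul_gen {n : BiDeg} {x : GCAlg deg} (hx : x ∈ homog deg n) (j : I) :
    x * gen deg j = koszul n (deg j) • (gen deg j * x) := by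
  induction hx using Submodule.span_induction with
  | mem x hx =>
    obtain ⟨l, rfl, rfl⟩ := hx
    induction l with
    | nil => simp [koszul]
    | cons i l ih =>
      simp only [List.map_cons, List.prod_cons, List.sum_cons, koszul_add_left]
      rw [mul_assoc, ih, mul_smul_comm, ← mul_assoc, gen_mul_gen i j, smul_mul_assoc, smul_smul,
        mul_assoc, mul_comm]
  | zero => simp
  | add y z _ _ h1 h2 => rw [add_mul, mul_add, smul_add, h1, h2]
  | smul c y _ h => rw [smul_mul_assoc, h, mul_smul_comm, smul_comm]

/-- Homogeneous elements commute up to the sign rule. -/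
theorem homog_mul_homog {m n : BiDeg} {x y : GCAlg deg} (hx : x ∈ homog deg m)
    (hy : y ∈ homog deg n) : x * y = koszul m n • (y * x) := by
  induction hy using Submodule.span_induction with
  | mem y hy =>
    obtain ⟨l, rfl, rfl⟩ := hy
    induction l with
    | nil => simp [koszul]
    | cons i l ih =>
      simp only [List.map_cons, List.prod_cons, List.sum_cons, koszul_add_right]
      rw [← mul_assoc, homog_mul_gen hx i, smul_mul_assoc, mul_assoc, ih, mul_smul_comm, smul_smul,
        mul_assoc]
  | zero => simp
  | add y z _ _ h1 h2 => rw [add_mul, mul_add, smul_add, h1, h2]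
  | smul c y _ h => rw [smul_mul_assoc, mul_smul_comm, h, smul_comm]

/-- An assignment of generators to homogeneous elements of the same degrees extends. -/
def homogLift {J : Type*} {deg' : J → BiDeg} (φ : I → GCAlg deg')
    (hφ : ∀ i, φ i ∈ homog deg' (deg i)) : GCAlg deg →ₐ[ℝ] GCAlg deg' :=
  lift φ fun i j => homog_mul_homog (hφ i) (hφ j)

@[simp]
theorem homogLift_gen {J : Type*} {deg' : J → BiDeg} (φ : I → GCAlg deg')
    (hφ : ∀ i, φ i ∈ homog deg' (deg i)) (i : I) : homogLift φ hφ (gen deg i) = φ i :=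
  lift_gen _ _ i

/-- An algebra map preserves bidegrees as soon as it does so on generators. -/
theorem map_mem {J : Type*} {deg' : J → BiDeg} (f : GCAlg deg →ₐ[ℝ] GCAlg deg')
    (hf : ∀ i, f (gen deg i) ∈ homog deg' (deg i)) {n : BiDeg} {x : GCAlg deg}
    (hx : x ∈ homog deg n) : f x ∈ homog deg' n := by
  induction hx using Submodule.span_induction with
  | mem x hx =>
    obtain ⟨l, rfl, rfl⟩ := hx
    induction l with
    | nil => simpa using one_mem (deg := deg')
    | cons i l ih =>
      simp only [List.map_cons, List.prod_cons, List.sum_cons, map_mul]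
      exact mul_mem (hf i) ih
  | zero => simp
  | add y z _ _ h1 h2 => rw [map_add]; exact add_mem h1 h2
  | smul c y _ h => rw [map_smul]; exact Submodule.smul_mem _ _ h

/-! ### Graded derivations -/

/-- The algebra map `x ↦ (± x, D x; 0, x)` whose off-diagonal entry is the graded derivation `D`
of bidegree `p` with values `P i` on the generators. -/
def derMatrix (p : BiDeg) (P : I → GCAlg deg) (hP : ∀ i, P i ∈ homog deg (deg i + p)) :
    GCAlg deg →ₐ[ℝ] Matrix (Fin 2) (Fin 2) (GCAlg deg) :=
  lift (fun i => !![koszul p (deg i) • gen deg i, P i; 0, gen deg i]) (by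
    intro i j
    have h1 := homog_mul_gen (hP i) j
    have h2 := homog_mul_gen (hP j) i
    have h3 := koszul_mul_self p (deg i)
    have h4 := koszul_mul_self (deg i) (deg j)
    have e : gen deg i * P j = (koszul (deg i) (deg j) * koszul p (deg i)) • (P j * gen deg i) := by
      rw [h2, smul_smul, koszul_add_left, koszul_comm (deg j) (deg i)]
      rw [show koszul (deg i) (deg j) * koszul p (deg i) *
        (koszul (deg i) (deg j) * koszul p (deg i)) =
        (koszul (deg i) (deg j) * koszul (deg i) (deg j)) *
          (koszul p (deg i) * koszul p (deg i)) by ring, h3, h4]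
      simp
    ext a b
    fin_cases a <;> fin_cases b
    · simp [Matrix.mul_apply, Fin.sum_univ_two, gen_mul_gen i j, smul_smul]
      congr 1; ring
    · simp [Matrix.mul_apply, Fin.sum_univ_two, e, h1, smul_smul, koszul_add_left]
      rw [show koszul p (deg i) * (koszul (deg i) (deg j) * koszul p (deg i)) =
        koszul (deg i) (deg j) * (koszul p (deg i) * koszul p (deg i)) by ring, h3, mul_one,
        add_comm]
    · simp [Matrix.mul_apply, Fin.sum_univ_two]
    · simp [Matrix.mul_apply, Fin.sum_univ_two, gen_mul_gen i j])

/-- The graded derivation of bidegree `p` with the given values on the generators. -/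
def gradedDer (p : BiDeg) (P : I → GCAlg deg) (hP : ∀ i, P i ∈ homog deg (deg i + p)) :
    GCAlg deg →ₗ[ℝ] GCAlg deg :=
  Matrix.entryLinearMap ℝ (GCAlg deg) (0 : Fin 2) (1 : Fin 2) ∘ₗ (derMatrix p P hP).toLinearMap

section

variable (p : BiDeg) (P : I → GCAlg deg) (hP : ∀ i, P i ∈ homog deg (deg i + p))

@[simp]
theorem gradedDer_gen (i : I) : gradedDer p P hP (gen deg i) = P i := by
  simp [gradedDer, derMatrix]

@[simp]
theorem gradedDer_one : gradedDer p P hP 1 = 0 := by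
  simp [gradedDer]

theorem gradedDer_gen_mul (i : I) (x : GCAlg deg) :
    gradedDer p P hP (gen deg i * x) =
      P i * x + koszul p (deg i) • (gen deg i * gradedDer p P hP x) := by
  have h11 : ∀ l : List I,
      derMatrix p P hP (l.map (gen deg)).prod 1 1 = (l.map (gen deg)).prod := by
    intro l
    induction l with
    | nil => simp
    | cons i l ih =>
      simp only [List.map_cons, List.prod_cons, map_mul, Matrix.mul_apply, Fin.sum_univ_two, ih]
      simp [derMatrix]
  have h11' : Matrix.entryLinearMap ℝ (GCAlg deg) (1 : Fin 2) (1 : Fin 2) ∘ₗ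
      (derMatrix p P hP).toLinearMap = LinearMap.id := linearMap_ext h11
  have hx : derMatrix p P hP x 1 1 = x := LinearMap.congr_fun h11' x
  have hm : gradedDer p P hP (gen deg i * x) = derMatrix p P hP (gen deg i * x) 0 1 := rfl
  rw [hm, map_mul, Matrix.mul_apply, Fin.sum_univ_two, hx, add_comm]
  have h0 : derMatrix p P hP (gen deg i) 0 1 = P i := by simp [derMatrix]
  have h1 : derMatrix p P hP (gen deg i) 0 0 = koszul p (deg i) • gen deg i := by simp [derMatrix]
  rw [h0, h1, smul_mul_assoc]
  rfl

/-- The graded Leibniz rule. -/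
theorem gradedDer_mul {n : BiDeg} {x : GCAlg deg} (hx : x ∈ homog deg n) (y : GCAlg deg) :
    gradedDer p P hP (x * y) =
      gradedDer p P hP x * y + koszul p n • (x * gradedDer p P hP y) := by
  induction hx using Submodule.span_induction with
  | mem x hx =>
    obtain ⟨l, rfl, rfl⟩ := hx
    induction l with
    | nil => simp [koszul_zero_right]
    | cons i l ih =>
      simp only [List.map_cons, List.prod_cons, List.sum_cons, mul_assoc, gradedDer_gen_mul, ih,
        koszul_add_right, mul_add, add_mul, smul_add, mul_smul_comm, smul_mul_assoc, smul_smul]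
      abel
  | zero => simp
  | add y z _ _ h1 h2 => simp only [add_mul, map_add, h1, h2, smul_add]; abel
  | smul c y _ h =>
    simp only [smul_mul_assoc, map_smul, h, smul_add]
    rw [smul_comm c]

theorem gradedDer_mem {n : BiDeg} {x : GCAlg deg} (hx : x ∈ homog deg n) :
    gradedDer p P hP x ∈ homog deg (n + p) := by
  induction hx using Submodule.span_induction with
  | mem x hx =>
    obtain ⟨l, rfl, rfl⟩ := hx
    induction l with
    | nil => simp
    | cons i l ih =>
      simp only [List.map_cons, List.prod_cons, List.sum_cons, gradedDer_gen_mul]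
      refine add_mem ?_ (Submodule.smul_mem _ _ ?_)
      · have := mul_mem (hP i) (word_mem (deg := deg) l)
        rwa [add_right_comm] at this
      · have := mul_mem (gen_mem (deg := deg) i) ih
        rwa [← add_assoc] at this
  | zero => simp
  | add y z _ _ h1 h2 => rw [map_add]; exact add_mem h1 h2
  | smul c y _ h => rw [map_smul]; exact Submodule.smul_mem _ _ h

/-- A linear map that obeys the graded Leibniz rule along an algebra map is determined by its
values on generators. -/
theorem leibniz_ext {A : Type*} [Ring A] [Algebra ℝ A] (φ : GCAlg deg →ₐ[ℝ] A)
    {L L' : GCAlg deg →ₗ[ℝ] A} (h1 : L 1 = L' 1)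
    (hL : ∀ i x, L (gen deg i * x) =
      L (gen deg i) * φ x + koszul p (deg i) • (φ (gen deg i) * L x))
    (hL' : ∀ i x, L' (gen deg i * x) =
      L' (gen deg i) * φ x + koszul p (deg i) • (φ (gen deg i) * L' x))
    (hg : ∀ i, L (gen deg i) = L' (gen deg i)) : L = L' := by
  apply linearMap_ext
  intro l
  induction l with
  | nil => simpa using h1
  | cons i l ih => simp only [List.map_cons, List.prod_cons, hL, hL', hg, ih]

end

end GCAlg

open GCAlg

/-! ### Super-`L∞` algebras of finite type -/

/-- A super-`L∞` algebra of finite type, presented dually by its Chevalley-Eilenberg algebra: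
generators with bidegrees (finitely many in each bidegree), and polynomials `dgen i` prescribing
the differential of the generators, whose extension to a graded derivation of bidegree `(1, even)`
squares to zero. -/
structure SuperLInf : Type 1 where
  Gen : Type
  deg : Gen → BiDeg
  finiteType : ∀ n, {i | deg i = n}.Finite
  dgen : Gen → GCAlg deg
  dgen_mem : ∀ i, dgen i ∈ homog deg (deg i + (1, 0))
  d_dgen : ∀ i, gradedDer (1, 0) dgen dgen_mem (dgen i) = 0

namespace SuperLInf

/-- The Chevalley-Eilenberg algebra. -/
abbrev CE (g : SuperLInf) : Type := GCAlg g.deg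

/-- The generators of the Chevalley-Eilenberg algebra. -/
abbrev gen (g : SuperLInf) (i : g.Gen) : g.CE := GCAlg.gen g.deg i

/-- The elements of given bidegree in the Chevalley-Eilenberg algebra. -/
abbrev homog (g : SuperLInf) (n : BiDeg) : Submodule ℝ g.CE := GCAlg.homog g.deg n

/-- The differential of the Chevalley-Eilenberg algebra. -/
def d (g : SuperLInf) : g.CE →ₗ[ℝ] g.CE := gradedDer (1, 0) g.dgen g.dgen_mem

theorem d_gen (g : SuperLInf) (i : g.Gen) : g.d (g.gen i) = g.dgen i := gradedDer_gen _ _ _ i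

theorem d_one (g : SuperLInf) : g.d 1 = 0 := gradedDer_one _ _ _

theorem d_mul (g : SuperLInf) {n : BiDeg} {x : g.CE} (hx : x ∈ g.homog n) (y : g.CE) :
    g.d (x * y) = g.d x * y + koszul (1, 0) n • (x * g.d y) := gradedDer_mul _ _ _ hx y

/-- A homomorphism `g ⟶ h` of super-`L∞` algebras: dually, a homomorphism
`CE h → CE g` of differential bigraded algebras. -/
@[ext]
structure Hom (g h : SuperLInf) where
  pull : h.CE →ₐ[ℝ] g.CE
  pull_mem : ∀ n x, x ∈ h.homog n → pull x ∈ g.homog n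
  pull_d : ∀ x, pull (h.d x) = g.d (pull x)

/-- Composition `g ⟶ h ⟶ k`. -/
def Hom.comp {g h k : SuperLInf} (f : Hom g h) (f' : Hom h k) : Hom g k where
  pull := f.pull.comp f'.pull
  pull_mem n x hx := f.pull_mem n _ (f'.pull_mem n x hx)
  pull_d x := by simp [f'.pull_d, f.pull_d]

/-- Isomorphisms of super-`L∞` algebras. -/
def Hom.IsIso {g h : SuperLInf} (f : Hom g h) : Prop := Function.Bijective f.pull

/-- A homomorphism is given by images of the generators that respect bidegree and differential. -/
def Hom.ofGens {g h : SuperLInf} (φ : h.Gen → g.CE) (hφ : ∀ i, φ i ∈ g.homog (h.deg i))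
    (hd : ∀ i, homogLift φ hφ (h.dgen i) = g.d (φ i)) : Hom g h where
  pull := homogLift φ hφ
  pull_mem n x hx := map_mem _ (by simpa using hφ) hx
  pull_d x := by
    have key : (homogLift φ hφ).toLinearMap ∘ₗ h.d = g.d ∘ₗ (homogLift φ hφ).toLinearMap := by
      apply leibniz_ext (1, 0) (homogLift φ hφ)
      · simp [d_one]
      · intro i x
        simp only [LinearMap.comp_apply, AlgHom.toLinearMap_apply]
        rw [h.d_mul (gen_mem i)]
        simp
      · intro i x
        simp only [LinearMap.comp_apply, AlgHom.toLinearMap_apply]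
        rw [map_mul, homogLift_gen, g.d_mul (hφ i)]
      · intro i
        simp only [LinearMap.comp_apply, AlgHom.toLinearMap_apply]
        rw [h.d_gen, homogLift_gen, hd]
    exact LinearMap.congr_fun key x

/-! ### Central extensions -/

section

variable (g : SuperLInf) (c : g.CE) (hc : c ∈ g.homog (2, 0)) (hdc : g.d c = 0)

/-- Bidegrees of the generators of a central extension; `none` is the new generator `e'`. -/
def extDeg : Option g.Gen → BiDeg
  | none => (1, 0)
  | some i => g.deg i

/-- The inclusion of basic forms (the underlying algebra map of the pullback `p^*`). -/
def basicIncl : g.CE →ₐ[ℝ] GCAlg g.extDeg :=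
  homogLift (fun i => GCAlg.gen g.extDeg (some i)) fun i => gen_mem (deg := g.extDeg) (some i)

@[simp]
theorem basicIncl_gen (i : g.Gen) :
    g.basicIncl (GCAlg.gen g.deg i) = GCAlg.gen g.extDeg (some i) :=
  homogLift_gen _ _ i

theorem basicIncl_mem {n : BiDeg} {x : g.CE} (hx : x ∈ g.homog n) :
    g.basicIncl x ∈ GCAlg.homog g.extDeg n :=
  map_mem _ (fun i => by
    rw [basicIncl_gen]; exact gen_mem (deg := g.extDeg) (some i)) hx

/-- The differentials of the generators of the central extension: `d e' = c`. -/
def extDgen : Option g.Gen → GCAlg g.extDeg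
  | none => g.basicIncl c
  | some i => g.basicIncl (g.dgen i)

theorem extDgen_mem (g : SuperLInf) (c : g.CE) (hc : c ∈ g.homog (2, 0)) (o : Option g.Gen) :
    g.extDgen c o ∈ GCAlg.homog g.extDeg (g.extDeg o + (1, 0)) := by
  cases o with
  | none => exact g.basicIncl_mem hc
  | some i => exact g.basicIncl_mem (g.dgen_mem i)

theorem ext_d_basicIncl (x : g.CE) :
    gradedDer (1, 0) (g.extDgen c) (g.extDgen_mem c hc) (g.basicIncl x) = g.basicIncl (g.d x) := by
  have key : gradedDer (1, 0) (g.extDgen c) (g.extDgen_mem c hc) ∘ₗ g.basicIncl.toLinearMap =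
      g.basicIncl.toLinearMap ∘ₗ g.d := by
    apply leibniz_ext (1, 0) g.basicIncl
    · simp [d_one]
    · intro i x
      simp only [LinearMap.comp_apply, AlgHom.toLinearMap_apply]
      rw [map_mul, gradedDer_mul _ _ _ (g.basicIncl_mem (gen_mem i))]
    · intro i x
      simp only [LinearMap.comp_apply, AlgHom.toLinearMap_apply]
      rw [g.d_mul (gen_mem i)]
      simp
    · intro i
      simp only [LinearMap.comp_apply, AlgHom.toLinearMap_apply, d_gen]
      rw [basicIncl_gen, gradedDer_gen]; rfl
  exact LinearMap.congr_fun key x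

/-- The central extension of `g` by the 2-cocycle `c`. -/
abbrev centralExt (g : SuperLInf) (c : g.CE) (hc : c ∈ g.homog (2, 0)) (hdc : g.d c = 0) :
    SuperLInf where
  Gen := Option g.Gen
  deg := g.extDeg
  finiteType n := by
    refine ((g.finiteType n).image some |>.insert none).subset ?_
    rintro (_ | i) hi
    · exact Set.mem_insert _ _
    · exact Set.mem_insert_of_mem _ ⟨i, hi, rfl⟩
  dgen := g.extDgen c
  dgen_mem := g.extDgen_mem c hc
  d_dgen o := by
    cases o with
    | none => simp only [extDgen]; rw [ext_d_basicIncl _ _ hc, hdc, map_zero]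
    | some i =>
      simp only [extDgen]
      rw [ext_d_basicIncl _ _ hc, show g.d (g.dgen i) = 0 from g.d_dgen i, map_zero]

end

/-! ### Cyclification -/

/-- Generators of the cyclification: `ω₂`, the original generators `eⁱ`, and the shifted
generators `s eⁱ`. -/
inductive CycGen (I : Type) : Type
  | omega : CycGen I
  | base : I → CycGen I
  | shift : I → CycGen I

section

variable (h : SuperLInf)

/-- Bidegrees of the generators of the cyclification. -/
def cycDeg : CycGen h.Gen → BiDeg
  | .omega => (2, 0)
  | .base i => h.deg i
  | .shift i => h.deg i + (-1, 0)

/-- The inclusion `CE h → CE (cyc h)` of underlying algebras, `eⁱ ↦ eⁱ`. -/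
def cycIncl : h.CE →ₐ[ℝ] GCAlg h.cycDeg :=
  homogLift (fun i => GCAlg.gen h.cycDeg (.base i)) fun i => gen_mem (deg := h.cycDeg) (.base i)

@[simp]
theorem cycIncl_gen (i : h.Gen) : h.cycIncl (GCAlg.gen h.deg i) = GCAlg.gen h.cycDeg (.base i) :=
  homogLift_gen _ _ i

theorem cycIncl_mem {n : BiDeg} {x : h.CE} (hx : x ∈ h.homog n) :
    h.cycIncl x ∈ GCAlg.homog h.cycDeg n :=
  map_mem _ (fun i => by
    rw [cycIncl_gen]; exact gen_mem (deg := h.cycDeg) (.base i)) hx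

/-- Values of the shift `s` on generators. -/
def shiftGen : CycGen h.Gen → GCAlg h.cycDeg
  | .omega => 0
  | .base i => GCAlg.gen h.cycDeg (.shift i)
  | .shift _ => 0

theorem shiftGen_mem (j : CycGen h.Gen) :
    h.shiftGen j ∈ GCAlg.homog h.cycDeg (h.cycDeg j + (-1, 0)) := by
  cases j with
  | omega => exact zero_mem _
  | base i => exact gen_mem (deg := h.cycDeg) (.shift i)
  | shift i => exact zero_mem _

/-- The shift `s`, a graded derivation of bidegree `(-1, even)`. -/
def shift : GCAlg h.cycDeg →ₗ[ℝ] GCAlg h.cycDeg :=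
  gradedDer (-1, 0) h.shiftGen h.shiftGen_mem

/-- Differentials of the generators of the cyclification. -/
def cycDgen : CycGen h.Gen → GCAlg h.cycDeg
  | .omega => 0
  | .base i => h.cycIncl (h.dgen i) +
      GCAlg.gen h.cycDeg .omega * GCAlg.gen h.cycDeg (.shift i)
  | .shift i => -h.shift (h.cycIncl (h.dgen i))

theorem cycDgen_mem (j : CycGen h.Gen) :
    h.cycDgen j ∈ GCAlg.homog h.cycDeg (h.cycDeg j + (1, 0)) := by
  cases j with
  | omega => exact zero_mem _
  | base i =>
    refine add_mem (h.cycIncl_mem (h.dgen_mem i)) ?_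
    have := GCAlg.mul_mem (gen_mem (deg := h.cycDeg) .omega) (gen_mem (deg := h.cycDeg) (.shift i))
    have e : h.cycDeg .omega + h.cycDeg (.shift i) = h.cycDeg (.base i) + (1, 0) := by
      simp only [cycDeg]
      ext <;> simp
      ring
    rwa [e] at this
  | shift i =>
    refine neg_mem ?_
    have := gradedDer_mem (-1, 0) h.shiftGen h.shiftGen_mem (h.cycIncl_mem (h.dgen_mem i))
    rwa [add_right_comm] at this

/-- The differential of the cyclification (as a linear map). -/
def cycD : GCAlg h.cycDeg →ₗ[ℝ] GCAlg h.cycDeg :=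
  gradedDer (1, 0) h.cycDgen h.cycDgen_mem

theorem koszul_two (p : BiDeg) : koszul p (2, 0) = 1 := by
  simp only [koszul]
  rw [mul_comm p.1 2, zpow_mul]
  simp

theorem cycD_cycIncl (x : h.CE) : h.cycD (h.cycIncl x) =
    h.cycIncl (h.d x) + GCAlg.gen h.cycDeg .omega * h.shift (h.cycIncl x) := by
  have hk : ∀ n : BiDeg, koszul (-1, 0) n = koszul (1, 0) n := by
    intro n
    have : koszul (1, 0) n * koszul (-1, 0) n = 1 := by
      rw [← koszul_add_left, koszul_comm]
      exact koszul_zero_right n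
    have h2 := koszul_mul_self (1, 0) n
    have h0 : koszul (1, 0) n ≠ 0 := by
      intro h0; rw [h0] at h2; simp at h2
    exact mul_left_cancel₀ h0 (this.trans h2.symm)
  have key : h.cycD ∘ₗ h.cycIncl.toLinearMap = h.cycIncl.toLinearMap ∘ₗ h.d +
      LinearMap.mulLeft ℝ (GCAlg.gen h.cycDeg .omega) ∘ₗ h.shift ∘ₗ h.cycIncl.toLinearMap := by
    apply leibniz_ext (1, 0) h.cycIncl
    · simp [d_one, shift, cycD]
    · intro i x
      simp only [LinearMap.comp_apply, AlgHom.toLinearMap_apply]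
      rw [map_mul, cycD, gradedDer_mul _ _ _ (h.cycIncl_mem (gen_mem i))]
    · intro i x
      simp only [LinearMap.comp_apply, AlgHom.toLinearMap_apply, LinearMap.add_apply,
        LinearMap.mulLeft_apply]
      rw [h.d_mul (gen_mem i), map_mul h.cycIncl, shift,
        gradedDer_mul _ _ _ (h.cycIncl_mem (gen_mem i)), hk]
      have hw := homog_mul_gen (h.cycIncl_mem (gen_mem (deg := h.deg) i)) CycGen.omega
      have hw' : koszul (h.deg i) (h.cycDeg .omega) = 1 := koszul_two _
      rw [hw', one_smul] at hw
      simp only [map_add, map_mul, map_smul, mul_add, add_mul, smul_add, mul_smul_comm,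
        ← mul_assoc]
      rw [hw]
      abel
    · intro i
      simp only [LinearMap.comp_apply, AlgHom.toLinearMap_apply, LinearMap.add_apply,
        LinearMap.mulLeft_apply, d_gen, cycIncl_gen]
      simp [cycD, cycDgen, shift, shiftGen]
  exact LinearMap.congr_fun key x

end

end SuperLInf

namespace GCAlg

/-- The graded commutator of two odd derivations is determined on generators. -/
theorem anticomm_eq_zero {I : Type*} {deg : I → BiDeg} (p q : BiDeg) (P Q : I → GCAlg deg)
    (hP : ∀ i, P i ∈ homog deg (deg i + p)) (hQ : ∀ i, Q i ∈ homog deg (deg i + q))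
    (hpq : koszul p q = -1)
    (hg : ∀ i, gradedDer p P hP (Q i) + gradedDer q Q hQ (P i) = 0) (x : GCAlg deg) :
    gradedDer p P hP (gradedDer q Q hQ x) + gradedDer q Q hQ (gradedDer p P hP x) = 0 := by
  have key : gradedDer p P hP ∘ₗ gradedDer q Q hQ + gradedDer q Q hQ ∘ₗ gradedDer p P hP = 0 := by
    apply leibniz_ext (p + q) (AlgHom.id ℝ _)
    · simp
    · intro i x
      simp only [LinearMap.comp_apply, LinearMap.add_apply, AlgHom.id_apply, gradedDer_gen_mul,
        gradedDer_gen, map_add, map_smul]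
      rw [gradedDer_mul p P hP (hQ i), gradedDer_mul q Q hQ (hP i)]
      simp only [koszul_add_right, koszul_add_left, hpq, koszul_comm q p, mul_add, add_mul,
        smul_add, smul_smul]
      rw [mul_comm (koszul q (deg i)) (koszul p (deg i))]
      simp only [mul_neg, mul_one, neg_smul]
      abel
    · intro i x; simp
    · intro i
      simpa using hg i
  exact LinearMap.congr_fun key x

end GCAlg

namespace SuperLInf

section

variable (h : SuperLInf)

theorem shift_shift (x : GCAlg h.cycDeg) : h.shift (h.shift x) = 0 := by
  have := anticomm_eq_zero (-1, 0) (-1, 0) h.shiftGen h.shiftGen h.shiftGen_mem h.shiftGen_mem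
    (by norm_num [koszul]) (by rintro (_ | i | i) <;> simp [shiftGen]) x
  exact eq_zero_of_eq_neg (eq_neg_of_add_eq_zero_left this)

theorem shift_cycD (x : GCAlg h.cycDeg) : h.shift (h.cycD x) + h.cycD (h.shift x) = 0 := by
  refine anticomm_eq_zero (-1, 0) (1, 0) h.shiftGen h.cycDgen h.shiftGen_mem h.cycDgen_mem
    (by norm_num [koszul]) ?_ x
  rintro (_ | i | i)
  · simp [shiftGen, cycDgen]
  · simp only [shiftGen, cycDgen, map_add, gradedDer_gen_mul, gradedDer_gen]
    simp [shift]
  · simp only [shiftGen, cycDgen, map_neg, map_zero, add_zero]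
    have := h.shift_shift (h.cycIncl (h.dgen i))
    simp only [shift] at this ⊢
    rw [this, neg_zero]

theorem cycD_base (i : h.Gen) : h.cycD (h.cycIncl (h.dgen i)) =
    GCAlg.gen h.cycDeg .omega * h.shift (h.cycIncl (h.dgen i)) := by
  rw [cycD_cycIncl, show h.d (h.dgen i) = 0 from h.d_dgen i, map_zero, zero_add]

/-- The cyclification of a super-`L∞` algebra:
`d ω₂ = 0`, `d eⁱ = d_h eⁱ + ω₂ s eⁱ`, `d s eⁱ = - s (d_h eⁱ)`. -/
abbrev cyc : SuperLInf where
  Gen := CycGen h.Gen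
  deg := h.cycDeg
  finiteType n := by
    refine ((((h.finiteType n).image CycGen.base).union
      ((h.finiteType (n + (1, 0))).image CycGen.shift)).insert CycGen.omega).subset ?_
    rintro (_ | i | i) hi
    · exact Set.mem_insert _ _
    · exact Set.mem_insert_of_mem _ (Or.inl ⟨i, hi, rfl⟩)
    · refine Set.mem_insert_of_mem _ (Or.inr ⟨i, ?_, rfl⟩)
      have hi' : h.deg i + (-1, 0) = n := hi
      change h.deg i = n + (1, 0)
      rw [← hi', add_assoc]
      simp
  dgen := h.cycDgen
  dgen_mem := h.cycDgen_mem
  d_dgen j := by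
    change h.cycD (h.cycDgen j) = 0
    rcases j with _ | i | i
    · simp [cycDgen]
    · simp only [cycDgen, map_add, cycD_base]
      simp only [cycD, gradedDer_gen_mul, gradedDer_gen]
      rw [show h.cycDeg .omega = (2, 0) from rfl, koszul_two]
      simp [cycDgen]
    · simp only [cycDgen, map_neg]
      have e := h.shift_cycD (h.cycIncl (h.dgen i))
      rw [cycD_base] at e
      have e' : h.shift (GCAlg.gen h.cycDeg .omega * h.shift (h.cycIncl (h.dgen i))) = 0 := by
        have := h.shift_shift (h.cycIncl (h.dgen i))
        simp only [shift] at this ⊢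
        rw [gradedDer_gen_mul, this]
        simp [shiftGen]
      rw [e', zero_add] at e
      rw [e, neg_zero]

end

/-- `f̃ : g ⟶ cyc h` is the reduction of `f : ĝ ⟶ h` along the central extension `ĝ` of `g`
classified by `c`, equivalently `f` is the oxidation of `f̃`: `f̃` pulls `ω₂` back to `c`, and if
`f` pulls `eⁱ` back to `α_bas + e' p_*α` then `f̃` pulls `eⁱ` back to `α_bas` and `s eⁱ`
to `- p_*α`. -/
def IsReduction {g h : SuperLInf} {c : g.CE} {hc : c ∈ g.homog (2, 0)} {hdc : g.d c = 0}
    (f : Hom (g.centralExt c hc hdc) h) (f' : Hom g h.cyc) : Prop :=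
  f'.pull (h.cyc.gen .omega) = c ∧
  ∀ i : h.Gen, f.pull (h.gen i) =
    g.basicIncl (f'.pull (h.cyc.gen (.base i))) -
      (g.centralExt c hc hdc).gen none * g.basicIncl (f'.pull (h.cyc.gen (.shift i)))

end SuperLInf

open SuperLInf

/-! ### Whitehead `L∞`-algebras of twisted K-theory -/

/-- The line Lie 2-algebra `𝔩 B²U(1)`: one closed generator `ω₃` of bidegree `(3, even)`. -/
abbrev lineB2U1 : SuperLInf where
  Gen := Unit
  deg _ := (3, 0)
  finiteType _ := Set.toFinite _
  dgen _ := 0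
  dgen_mem _ := zero_mem _
  d_dgen _ := map_zero _

/-- Generators of `CE (𝔩 (Σᵐ KU // BU(1)))`; `f k` stands for `f_{2k+m}`. -/
inductive KUGen : Type
  | h3 : KUGen
  | f : ℤ → KUGen

/-- Bidegrees: `h₃` in `(3, even)`, `f_{2k+m}` in `(2k+m, even)`. -/
def kuDeg (m : ℤ) : KUGen → BiDeg
  | .h3 => (3, 0)
  | .f k => (2 * k + m, 0)

/-- `d h₃ = 0` and `d f_{2k+m} = h₃ f_{2(k-1)+m}`. -/
def kuDgen (m : ℤ) : KUGen → GCAlg (kuDeg m)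
  | .h3 => 0
  | .f k => GCAlg.gen (kuDeg m) .h3 * GCAlg.gen (kuDeg m) (.f (k - 1))

theorem kuDgen_mem (m : ℤ) (j : KUGen) :
    kuDgen m j ∈ GCAlg.homog (kuDeg m) (kuDeg m j + (1, 0)) := by
  cases j with
  | h3 => exact zero_mem _
  | f k =>
    have := GCAlg.mul_mem (gen_mem (deg := kuDeg m) .h3) (gen_mem (deg := kuDeg m) (.f (k - 1)))
    have e : kuDeg m .h3 + kuDeg m (.f (k - 1)) = kuDeg m (.f k) + (1, 0) := by
      simp only [kuDeg]
      ext <;> simp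
      ring
    rwa [e] at this

/-- The real Whitehead `L∞`-algebra `𝔩 (Σᵐ KU // BU(1))` of 3-twisted complex K-theory. -/
abbrev twistedKU (m : ℤ) : SuperLInf where
  Gen := KUGen
  deg := kuDeg m
  finiteType n := by
    refine ((Set.finite_singleton (KUGen.f ((n.1 - m) / 2))).insert KUGen.h3).subset ?_
    rintro (_ | k) hk
    · exact Set.mem_insert _ _
    · have hk' : ((2 * k + m, 0) : BiDeg) = n := hk
      refine Set.mem_insert_of_mem _ ?_
      rw [← hk', Set.mem_singleton_iff]
      congr 1
      simp
  dgen := kuDgen m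
  dgen_mem := kuDgen_mem m
  d_dgen j := by
    cases j with
    | h3 => simp [kuDgen]
    | f k =>
      simp only [kuDgen, gradedDer_gen_mul, gradedDer_gen, zero_mul, zero_add]
      have h := gen_mul_gen (deg := kuDeg m) .h3 .h3
      have hk : koszul (kuDeg m .h3) (kuDeg m .h3) = -1 := by norm_num [koszul, kuDeg, zpow_ofNat]
      rw [hk, neg_one_smul] at h
      rw [← mul_assoc, eq_zero_of_eq_neg h, zero_mul, smul_zero]

/-- The fibration of `𝔩 (Σᵐ KU // BU(1))` over `𝔩 B²U(1)`, pulling `ω₃` back to `h₃`. -/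
def kuFib (m : ℤ) : Hom (twistedKU m) lineB2U1 :=
  Hom.ofGens (fun _ => (twistedKU m).gen .h3) (fun _ => gen_mem (deg := kuDeg m) .h3) (by
    intro i
    rw [d_gen, map_zero]
    rfl)

/-- `f : g ⟶ 𝔩 (Σᵐ KU // BU(1))` is the map with components `(H, (F_{2k+m})_k)`. -/
def HasComponents {g : SuperLInf} {m : ℤ} (f : Hom g (twistedKU m)) (H : g.CE) (F : ℤ → g.CE) :
    Prop :=
  f.pull ((twistedKU m).gen .h3) = H ∧ ∀ k, f.pull ((twistedKU m).gen (.f k)) = F k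

/-- Values on generators of the T-duality isomorphism. -/
def tGen : CycGen KUGen → (twistedKU 0).cyc.CE
  | .omega => -(twistedKU 0).cyc.gen (.shift .h3)
  | .base .h3 => (twistedKU 0).cyc.gen (.base .h3)
  | .shift .h3 => -(twistedKU 0).cyc.gen .omega
  | .base (.f k) => (twistedKU 0).cyc.gen (.shift (.f (k + 1)))
  | .shift (.f k) => (twistedKU 0).cyc.gen (.base (.f k))

theorem tGen_mem (j : CycGen KUGen) :
    tGen j ∈ (twistedKU 0).cyc.homog ((twistedKU 1).cyc.deg j) := by
  have hg := fun j => gen_mem (deg := (twistedKU 0).cyc.deg) j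
  rcases j with _ | (_ | k) | (_ | k)
  · exact neg_mem (hg (.shift .h3))
  · exact hg (.base .h3)
  · have := hg (.shift (.f (k + 1)))
    have e : (twistedKU 0).cyc.deg (.shift (.f (k + 1))) =
        (twistedKU 1).cyc.deg (.base (.f k)) := by
      change ((2 * (k + 1) + 0, 0) : BiDeg) + (-1, 0) = (2 * k + 1, 0)
      ext <;> simp
      ring
    rw [e] at this
    exact this
  · exact neg_mem (hg .omega)
  · have := hg (.base (.f k))
    have e : (twistedKU 0).cyc.deg (.base (.f k)) = (twistedKU 1).cyc.deg (.shift (.f k)) := by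
      change ((2 * k + 0, 0) : BiDeg) = (2 * k + 1, 0) + (-1, 0)
      ext <;> simp
    rw [e] at this
    exact this

/-- The T-duality isomorphism `T : cyc 𝔩 (Σ⁰ KU // BU(1)) ⟶ cyc 𝔩 (Σ¹ KU // BU(1))`, which swaps
`ω₂` with `- s h₃` and pulls `f_{2k+1}`, `s f_{2k+1}` back to `s f_{2k+2}`, `f_{2k}`. -/
def tDuality : Hom (twistedKU 0).cyc (twistedKU 1).cyc :=
  Hom.ofGens tGen tGen_mem (by
    have hs : ∀ m k, (twistedKU m).shift ((twistedKU m).cycIncl (kuDgen m (.f k))) =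
        (twistedKU m).cyc.gen (.shift .h3) * (twistedKU m).cyc.gen (.base (.f (k - 1))) -
        (twistedKU m).cyc.gen (.base .h3) * (twistedKU m).cyc.gen (.shift (.f (k - 1))) := by
      intro m k
      have hk : koszul (-1, 0) ((twistedKU m).cycDeg (.base .h3)) = -1 := by
        norm_num [koszul, cycDeg, kuDeg, zpow_neg, zpow_ofNat]
      change (twistedKU m).shift ((twistedKU m).cycIncl
        ((twistedKU m).gen .h3 * (twistedKU m).gen (.f (k - 1)))) = _
      rw [map_mul, cycIncl_gen, cycIncl_gen, shift, gradedDer_gen_mul, gradedDer_gen, hk,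
        neg_one_smul, ← sub_eq_add_neg]
      rfl
    have hs0 : ∀ m, (twistedKU m).shift ((twistedKU m).cycIncl (kuDgen m .h3)) = 0 := by
      intro m; simp [kuDgen]
    have hd := fun j => (twistedKU 0).cyc.d_gen j
    have hL : ∀ j, homogLift tGen tGen_mem (GCAlg.gen (twistedKU 1).cyc.deg j) = tGen j :=
      fun j => homogLift_gen _ _ j
    have comm : ∀ i j, koszul ((twistedKU 0).cycDeg i) ((twistedKU 0).cycDeg j) = 1 →
        (twistedKU 0).cyc.gen i * (twistedKU 0).cyc.gen j =
          (twistedKU 0).cyc.gen j * (twistedKU 0).cyc.gen i := by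
      intro i j hij
      have := gen_mul_gen (deg := (twistedKU 0).cycDeg) i j
      rwa [hij, one_smul] at this
    rintro (_ | (_ | k) | (_ | k))
    · change homogLift tGen tGen_mem 0 = (twistedKU 0).cyc.d (-(twistedKU 0).cyc.gen (.shift .h3))
      rw [map_zero, map_neg, hd]
      change 0 = - -(twistedKU 0).shift ((twistedKU 0).cycIncl (kuDgen 0 .h3))
      rw [hs0, neg_zero, neg_zero]
    · change homogLift tGen tGen_mem ((twistedKU 1).cycIncl 0 + (twistedKU 1).cyc.gen .omega *
          (twistedKU 1).cyc.gen (.shift .h3)) = (twistedKU 0).cyc.d ((twistedKU 0).cyc.gen (.base .h3))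
      rw [map_zero, zero_add, map_mul, hL, hL, hd]
      change -(twistedKU 0).cyc.gen (.shift .h3) * -(twistedKU 0).cyc.gen .omega =
        (twistedKU 0).cycIncl 0 + (twistedKU 0).cyc.gen .omega * (twistedKU 0).cyc.gen (.shift .h3)
      rw [map_zero, zero_add, neg_mul_neg]
      refine comm _ _ ?_
      exact koszul_two _
    · change homogLift tGen tGen_mem ((twistedKU 1).cycIncl
          ((twistedKU 1).gen .h3 * (twistedKU 1).gen (.f (k - 1))) + (twistedKU 1).cyc.gen .omega *
          (twistedKU 1).cyc.gen (.shift (.f k))) =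
          (twistedKU 0).cyc.d ((twistedKU 0).cyc.gen (.shift (.f (k + 1))))
      rw [map_add, map_mul, map_mul, map_mul, cycIncl_gen, cycIncl_gen, hL, hL, hL, hL, hd]
      change (twistedKU 0).cyc.gen (.base .h3) * (twistedKU 0).cyc.gen (.shift (.f (k - 1 + 1))) +
        -(twistedKU 0).cyc.gen (.shift .h3) * (twistedKU 0).cyc.gen (.base (.f k)) =
        -(twistedKU 0).shift ((twistedKU 0).cycIncl (kuDgen 0 (.f (k + 1))))
      rw [hs, sub_add_cancel, add_sub_cancel_right, neg_sub, neg_mul, sub_eq_add_neg]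
    · change homogLift tGen tGen_mem (-(twistedKU 1).shift ((twistedKU 1).cycIncl (kuDgen 1 .h3))) =
        (twistedKU 0).cyc.d (-(twistedKU 0).cyc.gen .omega)
      rw [hs0, neg_zero, map_zero, map_neg, hd]
      change 0 = -(0 : (twistedKU 0).cyc.CE)
      rw [neg_zero]
    · change homogLift tGen tGen_mem
        (-(twistedKU 1).shift ((twistedKU 1).cycIncl (kuDgen 1 (.f k)))) =
        (twistedKU 0).cyc.d ((twistedKU 0).cyc.gen (.base (.f k)))
      rw [hs, map_neg, map_sub, map_mul, map_mul, hL, hL, hL, hL, hd]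
      change -(-(twistedKU 0).cyc.gen .omega * (twistedKU 0).cyc.gen (.shift (.f (k - 1 + 1))) -
        (twistedKU 0).cyc.gen (.base .h3) * (twistedKU 0).cyc.gen (.base (.f (k - 1)))) =
        (twistedKU 0).cycIncl ((twistedKU 0).gen .h3 * (twistedKU 0).gen (.f (k - 1))) +
        (twistedKU 0).cyc.gen .omega * (twistedKU 0).cyc.gen (.shift (.f k))
      rw [map_mul, cycIncl_gen, cycIncl_gen, sub_add_cancel, neg_mul, neg_sub, sub_neg_eq_add])

/-! ### The 11-dimensional Majorana spinors -/

/-- The mostly-plus Minkowski metric. -/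
def eta {n : ℕ} (a b : Fin n) : ℝ := if a = b then (if a.val = 0 then -1 else 1) else 0

/-- The Majorana representation `32` of `Pin⁺(1,10)` in components: real `32 × 32` Clifford
generators for the mostly-plus metric with Clifford volume element `1`, and the matrix `C = (η_{αβ})`
of a non-degenerate skew-symmetric pairing for which the Clifford generators are
skew-self-adjoint. -/
structure Majorana11 (ι : Type) [Fintype ι] [DecidableEq ι] where
  Γ : Fin 11 → Matrix ι ι ℝ
  C : Matrix ι ι ℝ
  card_eq : Fintype.card ι = 32
  clifford : ∀ a b, Γ a * Γ b + Γ b * Γ a = (2 * eta a b) • (1 : Matrix ι ι ℝ)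
  volume : (List.ofFn Γ).prod = 1
  C_skew : C.transpose = -C
  C_nondeg : IsUnit C.det
  skewAdj : ∀ a, (Γ a).transpose * C = -(C * Γ a)

namespace Majorana11

/-! The representation exists: an explicit one by Pauli-type matrices. -/

/-- The signed permutation matrix `e_j ↦ (-1)^(z·j) e_(j+x)`. -/
def pauli (x z : Fin 5 → ZMod 2) : Matrix (Fin 5 → ZMod 2) (Fin 5 → ZMod 2) ℝ :=
  fun i j => if i = j + x then (-1 : ℝ) ^ (∑ k, z k * j k).val else 0

theorem pauli_mul (x z x' z' : Fin 5 → ZMod 2) :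
    pauli x z * pauli x' z' = (-1 : ℝ) ^ (∑ k, z k * x' k).val • pauli (x + x') (z + z') := by
  ext i j
  rw [Matrix.mul_apply, Finset.sum_eq_single (j + x')]
  · simp only [pauli, Matrix.smul_apply, smul_eq_mul, if_true]
    by_cases h : i = j + x' + x
    · rw [if_pos h, if_pos (by rw [h, add_assoc, add_comm x' x]), ← negOne_pow_val_add,
        ← negOne_pow_val_add]
      congr 2
      simp only [Pi.add_apply, ← Finset.sum_add_distrib]
      exact Finset.sum_congr rfl fun k _ => by ring
    · rw [if_neg h, if_neg (by rw [add_comm x x', ← add_assoc]; exact h)]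
      simp
  · intro k _ hk
    simp [pauli, hk]
  · simp

theorem pauli_zero : pauli 0 0 = 1 := by
  ext i j
  simp [pauli, Matrix.one_apply]

theorem pauli_transpose (x z : Fin 5 → ZMod 2) :
    (pauli x z).transpose = (-1 : ℝ) ^ (∑ k, z k * x k).val • pauli x z := by
  ext i j
  simp only [Matrix.transpose_apply, pauli, Matrix.smul_apply, smul_eq_mul]
  have hx : x + x = 0 := by
    funext k
    have : ∀ a : ZMod 2, a + a = 0 := by decide
    exact this (x k)
  by_cases h : i = j + x
  · have h' : j = i + x := by rw [h, add_assoc, hx, add_zero]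
    rw [if_pos h, if_pos h', ← negOne_pow_val_add]
    congr 2
    rw [h]
    simp only [Pi.add_apply, ← Finset.sum_add_distrib]
    exact Finset.sum_congr rfl fun k _ => by ring
  · have h' : ¬ j = i + x := fun h' => h (by rw [h', add_assoc, hx, add_zero])
    rw [if_neg h, if_neg h', mul_zero]

/-- Shift part of the explicit Clifford generators. -/
def exX : Fin 11 → Fin 5 → ZMod 2 :=
  ![![1, 0, 0, 0, 0],
    ![1, 0, 0, 0, 1],
    ![1, 0, 0, 0, 0],
    ![1, 0, 0, 1, 1],
    ![1, 0, 1, 1, 1],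
    ![1, 1, 1, 0, 1],
    ![1, 0, 1, 0, 1],
    ![1, 1, 0, 0, 1],
    ![1, 1, 1, 1, 1],
    ![1, 1, 0, 1, 1],
    ![0, 0, 0, 0, 0]]

/-- Sign part of the explicit Clifford generators. -/
def exZ : Fin 11 → Fin 5 → ZMod 2 :=
  ![![1, 0, 0, 0, 0],
    ![0, 0, 0, 0, 0],
    ![0, 0, 0, 0, 1],
    ![0, 0, 0, 1, 1],
    ![0, 0, 1, 0, 1],
    ![0, 0, 1, 1, 1],
    ![0, 1, 1, 1, 1],
    ![0, 1, 0, 1, 1],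
    ![0, 1, 0, 0, 1],
    ![0, 1, 1, 0, 1],
    ![1, 0, 0, 0, 0]]

/-- The explicit Majorana representation. -/
def explicit : Majorana11 (Fin 5 → ZMod 2) where
  Γ a := pauli (exX a) (exZ a)
  C := pauli (exX 0) (exZ 0)
  card_eq := by simp
  clifford a b := by
    by_cases h : a = b
    · subst h
      have hx : exX a + exX a = 0 := by revert a; decide
      have hz : exZ a + exZ a = 0 := by revert a; decide
      have hs : (∑ k, exZ a k * exX a k).val = if a.val = 0 then 1 else 0 := by revert a; decide
      rw [pauli_mul, hx, hz, pauli_zero, ← two_smul ℝ, smul_smul, hs]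
      congr 2
      rw [eta, if_pos rfl]
      split_ifs <;> norm_num
    · have hs : ∀ a b, a ≠ b →
          (∑ k, exZ b k * exX a k) = (∑ k, exZ a k * exX b k) + 1 := by decide
      rw [pauli_mul, pauli_mul, hs a b h, negOne_pow_val_add, add_comm (exX b), add_comm (exZ b),
        ← add_smul, eta, if_neg h, ZMod.val_one]
      simp
  volume := by
    simp only [List.ofFn_succ, List.ofFn_zero, List.prod_cons, List.prod_nil, mul_one, pauli_mul,
      mul_smul_comm, smul_smul, ← negOne_pow_val_add]
    rw [← pauli_zero]
    refine (congrArg₂ _ ?_ (congrArg₂ pauli ?_ ?_)).trans (one_smul ℝ _)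
    · rw [show ∀ a : ZMod 2, a = 0 → (-1 : ℝ) ^ a.val = 1 from fun a h => by rw [h]; simp]
      decide
    · decide
    · decide
  C_skew := by
    rw [pauli_transpose, show (∑ k, exZ 0 k * exX 0 k).val = 1 by decide]
    simp
  C_nondeg := by
    rw [← Matrix.isUnit_iff_isUnit_det]
    have h : pauli (exX 0) (exZ 0) * -pauli (exX 0) (exZ 0) = 1 := by
      rw [mul_neg, pauli_mul, show (∑ k, exZ 0 k * exX 0 k).val = 1 by decide,
        show exX 0 + exX 0 = 0 by decide, show exZ 0 + exZ 0 = 0 by decide, pauli_zero]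
      simp
    exact IsUnit.of_mul_eq_one _ h
  skewAdj a := by
    have hs : ∀ a, (∑ k, exZ a k * exX a k) + (∑ k, exZ a k * exX 0 k) =
        (∑ k, exZ 0 k * exX a k) + 1 := by decide
    rw [pauli_transpose, smul_mul_assoc, pauli_mul, pauli_mul, smul_smul, ← negOne_pow_val_add,
      hs a, negOne_pow_val_add, add_comm (exX a), add_comm (exZ a), ZMod.val_one]
    simp

end Majorana11

/-! ### Super-Minkowski algebras -/

/-- Bidegrees of the generators `ψ^α` (`(1, odd)`) and `e^a` (`(1, even)`). -/
def minkDeg (ι κ : Type) : ι ⊕ κ → BiDeg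
  | .inl _ => (1, 1)
  | .inr _ => (1, 0)

section

variable {ι κ : Type} [Fintype ι]

/-- The bilinear expression `∑ K_{αβ} ψ^α ψ^β`. -/
def quad (κ : Type) (K : Matrix ι ι ℝ) : GCAlg (minkDeg ι κ) :=
  ∑ α, ∑ β, K α β • (GCAlg.gen (minkDeg ι κ) (.inl α) * GCAlg.gen (minkDeg ι κ) (.inl β))

theorem quad_mem (K : Matrix ι ι ℝ) : quad κ K ∈ GCAlg.homog (minkDeg ι κ) (2, 0) := by
  refine sum_mem fun α _ => sum_mem fun β _ => Submodule.smul_mem _ _ ?_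
  have h := GCAlg.mul_mem (gen_mem (deg := minkDeg ι κ) (.inl α))
    (gen_mem (deg := minkDeg ι κ) (.inl β))
  have e : minkDeg ι κ (.inl α) + minkDeg ι κ (.inl β) = (2, 0) := by
    simp only [minkDeg]
    decide
  rwa [e] at h

/-- `d ψ^α = 0` and `d e^a = ∑ (K a)_{αβ} ψ^α ψ^β`. -/
def minkDgen (K : κ → Matrix ι ι ℝ) : ι ⊕ κ → GCAlg (minkDeg ι κ)
  | .inl _ => 0
  | .inr a => quad κ (K a)

theorem minkDgen_mem (K : κ → Matrix ι ι ℝ) (j : ι ⊕ κ) :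
    minkDgen K j ∈ GCAlg.homog (minkDeg ι κ) (minkDeg ι κ j + (1, 0)) := by
  cases j with
  | inl α => exact zero_mem _
  | inr a =>
    have e : minkDeg ι κ (.inr a) + (1, 0) = (2, 0) := by
      simp only [minkDeg]
      decide
    rw [e]
    exact quad_mem (K a)

theorem gradedDer_quad (K : κ → Matrix ι ι ℝ) (M : Matrix ι ι ℝ) :
    gradedDer (1, 0) (minkDgen K) (minkDgen_mem K) (quad κ M) = 0 := by
  simp [quad, gradedDer_gen_mul, minkDgen]

/-- The super-translation algebra with `d ψ^α = 0`, `d e^a = ∑ (K a)_{αβ} ψ^α ψ^β`. -/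
abbrev superMink [Finite κ] (K : κ → Matrix ι ι ℝ) : SuperLInf where
  Gen := ι ⊕ κ
  deg := minkDeg ι κ
  finiteType _ := Set.toFinite _
  dgen := minkDgen K
  dgen_mem := minkDgen_mem K
  d_dgen j := by
    cases j with
    | inl α => simp [minkDgen]
    | inr a => exact gradedDer_quad K (K a)

/-- The identification of the central extension of `(1+8)`-dimensional super-Minkowski algebra by
`c = ∑ K₉_{αβ} ψ^α ψ^β` with the `(1+9)`-dimensional one having `d e⁹ = c`: the generator `e⁹`
is pulled back to `e'`, the other generators to themselves. -/
def extIdent (K' : Fin 9 → Matrix ι ι ℝ) (K : Fin 10 → Matrix ι ι ℝ) (c : Matrix ι ι ℝ)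
    (hK : ∀ a : Fin 9, K a.castSucc = K' a) (hc : K (Fin.last 9) = c) :
    Hom ((superMink K').centralExt (quad (Fin 9) c) (quad_mem c) (gradedDer_quad K' c))
      (superMink K) :=
  Hom.ofGens
    (fun j => match j with
      | .inl α => ((superMink K').centralExt (quad (Fin 9) c) (quad_mem c)
          (gradedDer_quad K' c)).gen (some (.inl α))
      | .inr a => Fin.lastCases
          (((superMink K').centralExt (quad (Fin 9) c) (quad_mem c) (gradedDer_quad K' c)).gen none)
          (fun a => ((superMink K').centralExt (quad (Fin 9) c) (quad_mem c)
            (gradedDer_quad K' c)).gen (some (.inr a))) a)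
    (by
      rintro (α | a)
      · exact gen_mem (deg := extDeg (superMink K')) (some (.inl α))
      · refine Fin.lastCases ?_ (fun a => ?_) a
        · simp only [Fin.lastCases_last]
          exact gen_mem (deg := extDeg (superMink K')) none
        · simp only [Fin.lastCases_castSucc]
          exact gen_mem (deg := extDeg (superMink K')) (some (.inr a)))
    (by
      have hq : ∀ (φ : ι ⊕ Fin 10 → GCAlg (extDeg (superMink K'))) (hφ) (M : Matrix ι ι ℝ),
          (∀ α, φ (.inl α) = GCAlg.gen (extDeg (superMink K')) (some (.inl α))) →
          homogLift (deg := minkDeg ι (Fin 10)) φ hφ (quad (Fin 10) M) =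
            (superMink K').basicIncl (quad (Fin 9) M) := by
        intro φ hφ M h
        have hb : ∀ j, (superMink K').basicIncl (GCAlg.gen (minkDeg ι (Fin 9)) j) =
          GCAlg.gen (extDeg (superMink K')) (some j) :=
          fun j => basicIncl_gen (superMink K') j
        simp only [quad, map_sum, map_smul, map_mul, homogLift_gen, h, hb]
      rintro (α | a)
      · change homogLift _ _ 0 = _
        rw [map_zero, d_gen]
        exact (map_zero (superMink K').basicIncl).symm
      · change homogLift _ _ (quad (Fin 10) (K a)) = _
        rw [hq _ _ _ (fun α => rfl)]
        refine Fin.lastCases ?_ (fun a => ?_) a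
        · simp only [Fin.lastCases_last]
          rw [d_gen, hc]
          rfl
        · simp only [Fin.lastCases_castSucc]
          rw [d_gen, hK]
          rfl)

end

/-! ### Type II super-spacetimes and their super-flux densities -/

namespace Majorana11

/-- Raising a vector index with the Minkowski metric. -/
def raise {ι : Type} {n : ℕ} (G : Fin n → Matrix ι ι ℝ) (a : Fin n) : Matrix ι ι ℝ := ∑ b, eta a b • G b

theorem raise_eq {ι : Type} {n : ℕ} (G : Fin n → Matrix ι ι ℝ) (a : Fin n) :
    raise G a = (if a.val = 0 then (-1 : ℝ) else 1) • G a := by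
  simp [raise, eta]

variable {ι : Type} [Fintype ι] [DecidableEq ι] (S : Majorana11 ι)

/-- The spinor pairing `(ψ̄ M ψ) = ψ^α η_{αα'} M^{α'}_β ψ^β`. -/
def pair (κ : Type) (M : Matrix ι ι ℝ) : GCAlg (minkDeg ι κ) := quad κ (S.C * M)

/-- `Γ_a` for `a < 9`. -/
def gamma9 (a : Fin 9) : Matrix ι ι ℝ := S.Γ a.castSucc.castSucc

/-- `Γ_a` for `a ≤ 9`. -/
def gammaA (a : Fin 10) : Matrix ι ι ℝ := S.Γ a.castSucc

/-- The type IIB quasi-Clifford generators: `Γᴮ_a = Γ_a` for `a < 9` and `Γᴮ_9 = Γ_9 Γ_10`. -/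
def gammaB (a : Fin 10) : Matrix ι ι ℝ := if a = 9 then S.Γ 9 * S.Γ 10 else S.Γ a.castSucc

/-- The skew-symmetrized product `Γ_{a₁ ⋯ a_p}`. -/
def gammaAs {p : ℕ} (a : Fin p → Fin 10) : Matrix ι ι ℝ :=
  (p.factorial : ℝ)⁻¹ • ∑ σ : Equiv.Perm (Fin p),
    ((Equiv.Perm.sign σ : ℤ) : ℝ) • (List.ofFn fun i => S.gammaA (a (σ i))).prod

/-- `Γᴮ_{a₁ ⋯ a_p}`: the product of the `Γᴮ_{aᵢ}` in increasing order of the indices times the sign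
of the ordering permutation if the indices are distinct, and zero otherwise. -/
def gammaBs {p : ℕ} (a : Fin p → Fin 10) : Matrix ι ι ℝ :=
  open Classical in
  if Function.Injective a then
    ((Equiv.Perm.sign (Tuple.sort a) : ℤ) : ℝ) •
      (List.ofFn fun i => S.gammaB (a (Tuple.sort a i))).prod
  else 0

/-- 9-dimensional type II super-Minkowski algebra. -/
abbrev dim9 : SuperLInf := superMink fun a => S.C * raise S.gamma9 a

/-- 10-dimensional type IIA super-Minkowski algebra: `d e^a = (ψ̄ Γ^a ψ)`. -/
abbrev IIA : SuperLInf := superMink fun a => S.C * raise S.gammaA a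

/-- 10-dimensional type IIB super-Minkowski algebra: `d e^a = (ψ̄ Γ_B^a ψ)`. -/
abbrev IIB : SuperLInf := superMink fun a => S.C * raise S.gammaB a

/-- The form generators `e^a` in ten dimensions. -/
def e (a : Fin 10) : GCAlg (minkDeg ι (Fin 10)) := GCAlg.gen (minkDeg ι (Fin 10)) (.inr a)

/-- `(1/p!) ∑ (ψ̄ G_{a₁ ⋯ a_p} ψ) e^{a₁} ⋯ e^{a_p}`. -/
def form (p : ℕ) (G : (Fin p → Fin 10) → Matrix ι ι ℝ) : GCAlg (minkDeg ι (Fin 10)) :=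
  (p.factorial : ℝ)⁻¹ • ∑ a : Fin p → Fin 10,
    S.pair (Fin 10) (G a) * (List.ofFn fun i => e (a i)).prod

/-- `H₃ᴬ = (ψ̄ Γ_a Γ_10 ψ) e^a`. -/
def H3A : S.IIA.CE := ∑ a, S.pair (Fin 10) (S.gammaA a * S.Γ 10) * e a

/-- The type IIA super-flux densities; `FA k` is `F_{2k}`. -/
def FA (k : ℤ) : S.IIA.CE :=
  if k = 1 then S.pair (Fin 10) (S.Γ 10)
  else if k = 2 then S.form 2 fun a => S.gammaAs a
  else if k = 3 then S.form 4 fun a => S.Γ 10 * S.gammaAs a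
  else if k = 4 then S.form 6 fun a => S.gammaAs a
  else if k = 5 then S.form 8 fun a => S.Γ 10 * S.gammaAs a
  else if k = 6 then S.form 10 fun a => S.gammaAs a
  else 0

/-- `H₃ᴮ = (ψ̄ Γᴮ_a Γ_10 ψ) e^a`. -/
def H3B : S.IIB.CE := ∑ a, S.pair (Fin 10) (S.gammaB a * S.Γ 10) * e a

/-- The type IIB super-flux densities; `FB k` is `F_{2k+1}`. -/
def FB (k : ℤ) : S.IIB.CE :=
  if k = 1 then S.form 1 fun a => S.gammaBs a * S.Γ 9
  else if k = 2 then S.form 3 fun a => S.gammaBs a * (S.Γ 9 * S.Γ 10)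
  else if k = 3 then S.form 5 fun a => S.gammaBs a * S.Γ 9
  else if k = 4 then S.form 7 fun a => S.gammaBs a * (S.Γ 9 * S.Γ 10)
  else if k = 5 then S.form 9 fun a => S.gammaBs a * S.Γ 9
  else 0

/-- The 2-cocycle `c₁ᴬ = (ψ̄ Γ_9 ψ)` on the 9-dimensional algebra. -/
abbrev c1A : S.dim9.CE := S.pair (Fin 9) (S.Γ 9)

/-- The 2-cocycle `c₁ᴮ = (ψ̄ Γ_9 Γ_10 ψ)` on the 9-dimensional algebra. -/
abbrev c1B : S.dim9.CE := S.pair (Fin 9) (S.Γ 9 * S.Γ 10)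

/-- The type IIA algebra as the central extension of the 9-dimensional one by `c₁ᴬ`, with
`e⁹` the new generator. -/
def extA : Hom (S.dim9.centralExt S.c1A (quad_mem _) (gradedDer_quad _ _)) S.IIA := extIdent (fun a => S.C * raise S.gamma9 a) (fun a => S.C * raise S.gammaA a)
  (S.C * S.Γ 9)
  (fun a => by simp only [raise_eq]; rfl)
  (by simp only [raise_eq]; simp [gammaA, Fin.last])

/-- The type IIB algebra as the central extension of the 9-dimensional one by `c₁ᴮ`, with
`e⁹` the new generator. -/
def extB : Hom (S.dim9.centralExt S.c1B (quad_mem _) (gradedDer_quad _ _)) S.IIB := extIdent (fun a => S.C * raise S.gamma9 a) (fun a => S.C * raise S.gammaB a)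
  (S.C * (S.Γ 9 * S.Γ 10))
  (fun a => by
    have h : a.castSucc ≠ (9 : Fin 10) := (Fin.castSucc_lt_last a).ne
    simp only [raise_eq, gammaB, if_neg h]; rfl)
  (by
    have h : Fin.last 9 = (9 : Fin 10) := rfl
    simp [raise_eq, gammaB, h])

end Majorana11

end SuperL

end

open SuperL SuperL.SuperLInf

noncomputable section

set_option linter.unusedSectionVars false

namespace SuperL

open GCAlg

namespace Majorana11

variable {ι : Type} [Fintype ι] [DecidableEq ι] (S : Majorana11 ι)

/-! ### Clifford monomials -/

/-! Everything rests on one cubic spinor identity, `(ψ̄ Γ_a Γ_10 ψ) Γ^a ψ = (ψ̄ Γ_a ψ) Γ_10 Γ^a ψ`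
for commuting `ψ`. Polarized, it says that the linear map `fierzMap` vanishes on matrices `N * C`
with `N` symmetric, and these are skew-self-adjoint for the pairing (`fierzMap_eq_zero`). The
ordered Clifford monomials with at most five factors are orthogonal for the trace form and number
1024 = 32², so they span all matrices (`span_cliff`). Among them the skew-self-adjoint ones have 1,
2 or 5 factors. On monomials commuting with `Γ_10` the map vanishes term by term. On `Γ_c` and `Γ_c
Γ_10` the trace 32 of the identity balances the contraction constant 8. In degree five the
contraction constant 10 - 2·5 is zero.

For type IIA, put `E = ∑ e^a Γ_a`. Then `F_{2n+2}` is `(ψ̄ Γ_10^(n+1) E^(2n) ψ)/(2n)!`. With `V =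
dE` and `Z = ∑ (ψ̄ Γ^a Γ_10 ψ) Γ_a`, the Clifford relations give `d E^(2n+2) = (n+1)(V E^(2n+1) -
E^(2n+1) V)` and `E^(2n+1) Z + Z E^(2n+1) = 2(2n+1) H₃ E^(2n)`. The cubic identity replaces `Z` by
`Γ_10 V` wherever it stands next to a spinor, which identifies the two expressions
(`bil_flux_balance`, `d_fluxA_succ`).

For type IIB no Bianchi identity is computed directly. Since `s` is a graded derivation and `e' * e'
= 0`, the assignment `x ↦ ρ(x) - e' ρ(s x)` is multiplicative. It commutes with the differentials
exactly when `ρ` is a homomorphism to the cyclification sending `ω₂` to the cocycle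
(`exists_reduction`, `exists_oxidation`). Hence the IIA homomorphism reduces to nine dimensions,
`tDuality` is applied, and the result oxidizes along the other cocycle. In an increasing product the
index 9 comes last, so `Γᴮ` differs from `Γ` only by a trailing `Γ_10`. This allows the components
of the oxidation to be recognized as `H3B` and `FB` (`extB_pull_H3B`, `map_fluxB`). The IIB
identities then follow because `extB` is an isomorphism. -/

theorem gamma_sq (a : Fin 11) : S.Γ a * S.Γ a = eta a a • (1 : Matrix ι ι ℝ) := by
  have h := S.clifford a a
  rw [← two_smul ℝ, mul_smul] at h
  exact smul_right_injective _ (two_ne_zero (α := ℝ)) h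

theorem gamma_anticomm {a b : Fin 11} (h : a ≠ b) : S.Γ a * S.Γ b = -(S.Γ b * S.Γ a) := by
  have h' := S.clifford a b
  rw [eta, if_neg h, mul_zero, zero_smul] at h'
  exact eq_neg_of_add_eq_zero_left h'

theorem eta_self_mul_self {n : ℕ} (a : Fin n) : eta a a * eta a a = 1 := by
  simp only [eta, if_true]
  split_ifs <;> norm_num

theorem eta_self_ne_zero {n : ℕ} (a : Fin n) : eta a a ≠ 0 := by
  intro h
  have := eta_self_mul_self a
  simp [h] at this

theorem gamma_ten_sq : S.Γ 10 * S.Γ 10 = 1 := by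
  rw [gamma_sq]
  simp [eta]

theorem trace_one (S : Majorana11 ι) : (1 : Matrix ι ι ℝ).trace = 32 := by
  rw [Matrix.trace_one, S.card_eq]
  norm_num

/-- The product of Clifford generators along a list of indices. -/
def mono (l : List (Fin 11)) : Matrix ι ι ℝ := (l.map S.Γ).prod

@[simp]
theorem mono_nil : S.mono [] = 1 := rfl

@[simp]
theorem mono_cons (a : Fin 11) (l : List (Fin 11)) : S.mono (a :: l) = S.Γ a * S.mono l := by
  simp [mono]

theorem mono_append (l l' : List (Fin 11)) : S.mono (l ++ l') = S.mono l * S.mono l' := by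
  simp [mono]

/-- Each factor different from `Γ_a` contributes one sign, while factors equal to it commute and
contribute none. -/
theorem gamma_mul_mono (a : Fin 11) (l : List (Fin 11)) :
    S.Γ a * S.mono l = (-1 : ℝ) ^ (l.countP (· ≠ a)) • (S.mono l * S.Γ a) := by
  induction l with
  | nil => simp
  | cons b l ih =>
    rw [mono_cons, List.countP_cons]
    by_cases h : b = a
    · subst h
      conv_lhs => rw [ih]
      rw [mul_smul_comm, mul_assoc]
      simp
    · rw [← mul_assoc, S.gamma_anticomm (Ne.symm h), neg_mul, mul_assoc, ih, mul_smul_comm,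
        ← mul_assoc]
      simp [h, pow_succ]

/-- Reversal exchanges every pair of factors once, and distinct indices make every exchange cost a
sign. The exponent is thus the number of pairs, and the induction is Pascal's rule. -/
theorem mono_reverse {l : List (Fin 11)} (hl : l.Nodup) :
    S.mono l.reverse = (-1 : ℝ) ^ (l.length.choose 2) • S.mono l := by
  induction l with
  | nil => simp
  | cons b l ih =>
    rw [List.nodup_cons] at hl
    have hc : l.countP (· ≠ b) = l.length := by
      rw [List.countP_eq_length]
      intro a ha
      simp only [decide_eq_true_eq]
      rintro rfl
      exact hl.1 ha
    have h := S.gamma_mul_mono b l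
    rw [hc] at h
    rw [List.reverse_cons, mono_append, ih hl.2, mono_cons, mono_cons, mono_nil, mul_one, h,
      smul_mul_assoc, smul_smul, List.length_cons, Nat.choose_succ_succ' l.length 1,
      Nat.choose_one_right, pow_add, mul_right_comm, ← mul_pow]
    norm_num

theorem mono_mul_reverse (l : List (Fin 11)) :
    ∃ c : ℝ, c ≠ 0 ∧ S.mono l * S.mono l.reverse = c • 1 := by
  induction l with
  | nil => exact ⟨1, one_ne_zero, by simp⟩
  | cons b l ih =>
    obtain ⟨c, hc, h⟩ := ih
    refine ⟨c * eta b b, mul_ne_zero hc (eta_self_ne_zero b), ?_⟩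
    rw [List.reverse_cons, mono_append, mono_cons, mul_assoc, ← mul_assoc (S.mono l), h]
    simp [S.gamma_sq, smul_smul]

theorem mono_transpose_mul (l : List (Fin 11)) :
    (S.mono l).transpose * S.C = (-1 : ℝ) ^ l.length • (S.C * S.mono l.reverse) := by
  induction l with
  | nil => simp
  | cons b l ih =>
    rw [mono_cons, Matrix.transpose_mul, mul_assoc, S.skewAdj, mul_neg, ← mul_assoc, ih,
      List.reverse_cons, mono_append, List.length_cons, pow_succ]
    simp [mul_assoc]

/-- A matrix that anticommutes with a Clifford generator is traceless. -/
theorem trace_eq_zero {X : Matrix ι ι ℝ} (b : Fin 11) (h : S.Γ b * X = -(X * S.Γ b)) :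
    X.trace = 0 := by
  -- Cyclicity of the trace and anticommutation evaluate the same trace with opposite signs.
  have h1 : (S.Γ b * X * S.Γ b).trace = eta b b * X.trace := by
    rw [Matrix.trace_mul_comm, ← mul_assoc, S.gamma_sq]
    simp
  have h2 : (S.Γ b * X * S.Γ b).trace = -(eta b b * X.trace) := by
    rw [h, neg_mul, mul_assoc, S.gamma_sq]
    simp
  have h3 : eta b b * X.trace = 0 := by linarith
  exact (mul_eq_zero.mp h3).resolve_left (eta_self_ne_zero b)

/-- The ordered product of the Clifford generators with indices in `J`. -/
def cliff (J : Finset (Fin 11)) : Matrix ι ι ℝ := S.mono (J.sort (· ≤ ·))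

/-- The sign by which `Γ_a` commutes past the monomial with index set `J`. -/
def cliffSign (a : Fin 11) (J : Finset (Fin 11)) : ℝ := (-1) ^ (J.erase a).card

theorem gamma_mul_cliff (a : Fin 11) (J : Finset (Fin 11)) :
    S.Γ a * S.cliff J = cliffSign a J • (S.cliff J * S.Γ a) := by
  rw [cliff, gamma_mul_mono, cliffSign]
  congr 2
  have h1 : (J.erase a) = ((J.sort (· ≤ ·)).filter (· ≠ a)).toFinset := by
    ext x
    simp [and_comm]
  rw [h1, List.toFinset_card_of_nodup ((J.sort_nodup _).filter _), List.countP_eq_length_filter]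

theorem cliffSign_of_mem {a : Fin 11} {J : Finset (Fin 11)} (h : a ∈ J) :
    cliffSign a J = -(-1) ^ J.card := by
  rw [cliffSign, ← Finset.card_erase_add_one h, pow_succ]
  ring

theorem cliffSign_of_notMem {a : Fin 11} {J : Finset (Fin 11)} (h : a ∉ J) :
    cliffSign a J = (-1) ^ J.card := by
  rw [cliffSign, Finset.erase_eq_of_notMem h]

/-- Only the invertibility of the square matters: it makes the diagonal entries of the trace form
nonzero. -/
theorem cliff_sq (J : Finset (Fin 11)) :
    ∃ c : ℝ, c ≠ 0 ∧ S.cliff J * S.cliff J = c • 1 := by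
  obtain ⟨c, hc, h⟩ := S.mono_mul_reverse (J.sort (· ≤ ·))
  rw [S.mono_reverse (J.sort_nodup _), mul_smul_comm] at h
  refine ⟨(-1) ^ ((J.sort (· ≤ ·)).length.choose 2) * c,
    mul_ne_zero (pow_ne_zero _ (by norm_num)) hc, ?_⟩
  rw [mul_smul, ← h, smul_smul, ← mul_pow]
  simp [cliff]

/-- Passing `C` costs one sign per factor, and restoring the order costs one per pair, whence `card
+ card.choose 2`. For at most five factors the sign is negative exactly in degrees 1, 2 and 5. -/
theorem cliff_transpose_mul (J : Finset (Fin 11)) :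
    (S.cliff J).transpose * S.C = (-1 : ℝ) ^ ((J.card + 1).choose 2) • (S.C * S.cliff J) := by
  rw [cliff, mono_transpose_mul, S.mono_reverse (J.sort_nodup _), mul_smul_comm, smul_smul,
    Finset.length_sort, Nat.choose_succ_succ' J.card 1, Nat.choose_one_right, pow_add]

/-- It suffices that some generator anticommutes with the product. An index in exactly one of `J`,
`K` and an index in neither produce opposite signs, so one of the two works. The second kind exists
because the union has at most ten of the eleven indices. -/
theorem trace_cliff_mul_cliff {J K : Finset (Fin 11)} (hJ : J.card ≤ 5) (hK : K.card ≤ 5)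
    (h : J ≠ K) : (S.cliff J * S.cliff K).trace = 0 := by
  have key : ∀ b, cliffSign b J * cliffSign b K = -1 → (S.cliff J * S.cliff K).trace = 0 := by
    intro b hb
    apply S.trace_eq_zero b
    rw [← mul_assoc, gamma_mul_cliff, smul_mul_assoc, mul_assoc, gamma_mul_cliff, mul_smul_comm,
      smul_smul, hb, neg_one_smul, mul_assoc]
  have hcard : (J ∪ K).card < (Finset.univ : Finset (Fin 11)).card :=
    lt_of_le_of_lt (Finset.card_union_le J K) (by simp; omega)
  obtain ⟨d, -, hd⟩ := Finset.exists_mem_notMem_of_card_lt_card hcard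
  rw [Finset.mem_union, not_or] at hd
  have hd' : cliffSign d J * cliffSign d K = (-1) ^ J.card * (-1) ^ K.card := by
    rw [cliffSign_of_notMem hd.1, cliffSign_of_notMem hd.2]
  obtain ⟨c, hc⟩ : ∃ c, ¬ (c ∈ J ↔ c ∈ K) := by
    by_contra! hne
    exact h (Finset.ext hne)
  have hc' : cliffSign c J * cliffSign c K = -((-1) ^ J.card * (-1) ^ K.card) := by
    by_cases h1 : c ∈ J <;> by_cases h2 : c ∈ K
    · exact absurd (by simp [h1, h2]) hc
    · rw [cliffSign_of_mem h1, cliffSign_of_notMem h2, neg_mul]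
    · rw [cliffSign_of_notMem h1, cliffSign_of_mem h2, mul_neg]
    · exact absurd (by simp [h1, h2]) hc
  rcases neg_one_pow_eq_or ℝ (J.card + K.card) with h1 | h1 <;> rw [pow_add] at h1
  · exact key c (by rw [hc', h1])
  · exact key d (by rw [hd', h1])

/-- Complementation pairs the subsets of at most five elements with the remaining ones, so they are
half of all 2¹¹. The value 1024 = 32² is the dimension of the matrix algebra. -/
theorem card_finset_le_five : Fintype.card {J : Finset (Fin 11) // J.card ≤ 5} = 1024 := by
  have h : (Finset.univ.filter fun J : Finset (Fin 11) => J.card ≤ 5) =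
      (Finset.range 6).biUnion fun k => Finset.powersetCard k Finset.univ := by
    ext J
    simp [Nat.lt_succ_iff]
  rw [Fintype.card_subtype, h, Finset.card_biUnion]
  · simp only [Finset.card_powersetCard, Finset.card_univ, Fintype.card_fin]
    exact Nat.sum_range_choose_halfway 5
  · intro i _ j _ hij
    exact Finset.pairwise_disjoint_powersetCard _ hij

/-- The Clifford monomials with at most five factors span all matrices. -/
theorem span_cliff :
    Submodule.span ℝ (Set.range fun J : {J : Finset (Fin 11) // J.card ≤ 5} => S.cliff J) = ⊤ := by
  have hli : LinearIndependent ℝ fun J : {J : Finset (Fin 11) // J.card ≤ 5} => S.cliff J := by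
    rw [Fintype.linearIndependent_iff]
    intro g hg K
    -- Pairing a linear relation with `S.cliff K` under the trace form isolates the coefficient of
    -- `K`.
    have h0 : (S.cliff K * ∑ J, g J • S.cliff J).trace = 0 := by rw [hg]; simp
    rw [Finset.mul_sum, Matrix.trace_sum, Finset.sum_eq_single K] at h0
    · obtain ⟨c, hc, hcc⟩ := S.cliff_sq K
      rw [mul_smul_comm, hcc, Matrix.trace_smul, Matrix.trace_smul, S.trace_one] at h0
      simpa [hc] using h0
    · intro J _ hJ
      rw [mul_smul_comm, Matrix.trace_smul, S.trace_cliff_mul_cliff K.2 J.2, smul_zero]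
      exact fun h => hJ (Subtype.ext h.symm)
    · simp
  have : Nonempty {J : Finset (Fin 11) // J.card ≤ 5} := ⟨⟨∅, by simp⟩⟩
  apply hli.span_eq_top_of_card_eq_finrank
  rw [card_finset_le_five, Module.finrank_matrix, S.card_eq]
  simp

/-! ### The Fierz identity -/

/-- The matrix by which the polarized cubic spinor identity acts on a spinor. -/
def fierzMap : Matrix ι ι ℝ →ₗ[ℝ] Matrix ι ι ℝ :=
  ∑ a : Fin 10, eta a a •
    ((2⁻¹ : ℝ) • (Matrix.traceLinearMap ι ℝ ℝ ∘ₗ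
        LinearMap.mulLeft ℝ (S.gammaA a * S.Γ 10)).smulRight (S.gammaA a) +
      LinearMap.mulRight ℝ (S.gammaA a * S.Γ 10) ∘ₗ LinearMap.mulLeft ℝ (S.gammaA a) -
      (2⁻¹ : ℝ) • (Matrix.traceLinearMap ι ℝ ℝ ∘ₗ
        LinearMap.mulLeft ℝ (S.gammaA a)).smulRight (S.Γ 10 * S.gammaA a) -
      LinearMap.mulRight ℝ (S.gammaA a) ∘ₗ LinearMap.mulLeft ℝ (S.Γ 10 * S.gammaA a))

/-- For `M = N * C` with `N` symmetric, the trace terms are the contributions with both polarized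
spinors in the bilinear. The sandwich terms have one of them in the bilinear and the other in the
vector slot. The factor 1/2 compensates the double count of a symmetric pair by the trace. -/
theorem fierzMap_apply (M : Matrix ι ι ℝ) : S.fierzMap M = ∑ a : Fin 10, eta a a •
    ((2⁻¹ * (S.gammaA a * S.Γ 10 * M).trace) • S.gammaA a +
      S.gammaA a * M * (S.gammaA a * S.Γ 10) -
      (2⁻¹ * (S.gammaA a * M).trace) • (S.Γ 10 * S.gammaA a) -
      S.Γ 10 * S.gammaA a * M * S.gammaA a) := by
  simp [fierzMap, LinearMap.sum_apply, smul_smul, mul_assoc]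

theorem gamma_ten_mul_gammaA (a : Fin 10) : S.Γ 10 * S.gammaA a = -(S.gammaA a * S.Γ 10) :=
  S.gamma_anticomm (Fin.castSucc_lt_last a).ne'

theorem gammaA_sq (a : Fin 10) : S.gammaA a * S.gammaA a = eta a a • (1 : Matrix ι ι ℝ) := by
  rw [gammaA, gamma_sq]
  simp [eta]

theorem gammaA_mul_gamma_ten (a : Fin 10) : S.gammaA a * S.Γ 10 = -(S.Γ 10 * S.gammaA a) := by
  rw [gamma_ten_mul_gammaA, neg_neg]

/-- Both matrices under the traces anticommute with `Γ_10`, so the traces vanish. Moving `Γ_10`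
through `M` makes the two sandwich terms equal, and they cancel. -/
theorem fierzMap_of_comm {M : Matrix ι ι ℝ} (h : S.Γ 10 * M = M * S.Γ 10) :
    S.fierzMap M = 0 := by
  rw [fierzMap_apply]
  refine Finset.sum_eq_zero fun a _ => ?_
  have h1 : (S.gammaA a * M).trace = 0 := by
    apply S.trace_eq_zero 10
    rw [← mul_assoc, gamma_ten_mul_gammaA, neg_mul, mul_assoc, h, mul_assoc]
  have h2 : (S.gammaA a * S.Γ 10 * M).trace = 0 := by
    apply S.trace_eq_zero 10
    rw [← mul_assoc, ← mul_assoc, gamma_ten_mul_gammaA, neg_mul, neg_mul,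
      mul_assoc _ M, ← h, ← mul_assoc]
  have h3 : S.gammaA a * M * (S.gammaA a * S.Γ 10) = S.Γ 10 * S.gammaA a * M * S.gammaA a := by
    rw [gammaA_mul_gamma_ten, mul_neg, ← mul_assoc, mul_assoc (S.gammaA a) M, ← h, ← mul_assoc,
      gammaA_mul_gamma_ten]
    simp only [neg_mul, neg_neg]
  rw [h1, h2, h3]
  simp

theorem sum_conj_cliff (J : Finset (Fin 11)) :
    ∑ a : Fin 10, eta a a • (S.gammaA a * S.cliff J * S.gammaA a) =
      (∑ a : Fin 10, cliffSign a.castSucc J) • S.cliff J := by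
  rw [Finset.sum_smul]
  refine Finset.sum_congr rfl fun a _ => ?_
  have h := S.gamma_mul_cliff a.castSucc J
  change S.gammaA a * _ = _ • (_ * S.gammaA a) at h
  rw [h, smul_mul_assoc, mul_assoc, gammaA_sq, mul_smul_comm, mul_one, smul_smul, smul_smul,
    mul_comm (eta a a), mul_assoc, eta_self_mul_self, mul_one]

/-- Over all eleven indices, the members of `J` and the others contribute opposite signs, giving `11
- 2 * card`. The index 10 lies outside `J` and accounts for one unit. The result vanishes in degree
five. -/
theorem sum_cliffSign {J : Finset (Fin 11)} (h : (10 : Fin 11) ∉ J) :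
    ∑ a : Fin 10, cliffSign a.castSucc J = (-1) ^ J.card * (10 - 2 * J.card) := by
  have h1 : ∀ a, cliffSign a J = (-1) ^ J.card * (1 - 2 * if a ∈ J then 1 else 0) := by
    intro a
    by_cases ha : a ∈ J
    · rw [cliffSign_of_mem ha, if_pos ha]; ring
    · rw [cliffSign_of_notMem ha, if_neg ha]; ring
  have h2 : ∑ a : Fin 11, cliffSign a J = (-1) ^ J.card * (11 - 2 * J.card) := by
    simp only [h1]
    rw [← Finset.mul_sum, Finset.sum_sub_distrib, ← Finset.mul_sum]
    simp
  rw [Fin.sum_univ_castSucc, show cliffSign (Fin.last 10) J = (-1) ^ J.card from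
    cliffSign_of_notMem h] at h2
  linarith

/-- Here moving `Γ_10` through `M` costs a sign, so the two sandwich terms add up instead of
cancelling. -/
theorem fierzMap_of_anticomm {M : Matrix ι ι ℝ} (h : S.Γ 10 * M = -(M * S.Γ 10)) :
    S.fierzMap M = (∑ a : Fin 10, eta a a •
      ((2⁻¹ * (S.gammaA a * S.Γ 10 * M).trace) • S.gammaA a -
        (2⁻¹ * (S.gammaA a * M).trace) • (S.Γ 10 * S.gammaA a))) +
      (2 : ℝ) • ((∑ a : Fin 10, eta a a • (S.gammaA a * M * S.gammaA a)) * S.Γ 10) := by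
  rw [fierzMap_apply, Finset.sum_mul, Finset.smul_sum, ← Finset.sum_add_distrib]
  refine Finset.sum_congr rfl fun a _ => ?_
  have h3 : S.Γ 10 * S.gammaA a * M * S.gammaA a = -(S.gammaA a * M * S.gammaA a * S.Γ 10) := by
    rw [gamma_ten_mul_gammaA, neg_mul, neg_mul, mul_assoc (S.gammaA a) (S.Γ 10) M, h, mul_neg,
      neg_mul, neg_neg, ← mul_assoc, mul_assoc _ (S.Γ 10), gamma_ten_mul_gammaA, mul_neg,
      ← mul_assoc]
  rw [h3, smul_mul_assoc, smul_comm (2 : ℝ), ← smul_add, two_smul]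
  congr 1
  simp only [mul_assoc]
  abel

theorem cliff_singleton (c : Fin 11) : S.cliff {c} = S.Γ c := by
  simp [cliff]

theorem cliff_pair_ten (c : Fin 10) : S.cliff {c.castSucc, 10} = S.gammaA c * S.Γ 10 := by
  have h : (({c.castSucc, 10} : Finset (Fin 11)).sort (· ≤ ·)) = [c.castSucc, 10] := by
    have hlt : c.castSucc < (10 : Fin 11) := Fin.castSucc_lt_last c
    apply List.Perm.eq_of_pairwise' (r := (· ≤ ·)) (Finset.pairwise_sort _ _)
    · simp [hlt.le]
    · rw [List.perm_ext_iff_of_nodup (Finset.sort_nodup _ _) (by simp [hlt.ne])]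
      simp
  rw [cliff, h]
  simp [gammaA]

theorem trace_gammaA_mul_gammaA (a c : Fin 10) :
    (S.gammaA a * S.gammaA c).trace = if a = c then 32 * eta a a else 0 := by
  split_ifs with h
  · subst h
    rw [gammaA_sq, Matrix.trace_smul, S.trace_one, smul_eq_mul, mul_comm]
  · have h1 : S.gammaA a * S.gammaA c = -(S.gammaA c * S.gammaA a) :=
      S.gamma_anticomm fun h' => h (Fin.castSucc_injective _ h')
    apply S.trace_eq_zero a.castSucc
    change S.gammaA a * (S.gammaA a * S.gammaA c) = -(S.gammaA a * S.gammaA c * S.gammaA a)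
    conv_lhs => rw [h1]
    simp [mul_assoc]

/-- Any `Γ_b` with `b < 10` and `b ∉ {a, c}` anticommutes with each of the three factors, hence with
their product. -/
theorem trace_gammaA_gammaA_gamma_ten (a c : Fin 10) :
    (S.gammaA a * S.gammaA c * S.Γ 10).trace = 0 := by
  obtain ⟨b, hb⟩ : ∃ b : Fin 10, b ∉ ({a, c} : Finset (Fin 10)) := by
    by_contra! h
    have h1 := Finset.card_le_card (fun b _ => h b : Finset.univ ⊆ ({a, c} : Finset (Fin 10)))
    have h2 := Finset.card_le_two (a := a) (b := c)
    simp only [Finset.card_univ, Fintype.card_fin] at h1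
    omega
  simp only [Finset.mem_insert, Finset.mem_singleton, not_or] at hb
  have h : ∀ d : Fin 10, b ≠ d → S.gammaA b * S.gammaA d = -(S.gammaA d * S.gammaA b) :=
    fun d hd => S.gamma_anticomm fun h' => hd (Fin.castSucc_injective _ h')
  apply S.trace_eq_zero b.castSucc
  change S.gammaA b * (S.gammaA a * S.gammaA c * S.Γ 10) =
    -(S.gammaA a * S.gammaA c * S.Γ 10 * S.gammaA b)
  rw [← mul_assoc, ← mul_assoc, h a hb.1, neg_mul, mul_assoc (S.gammaA a), h c hb.2, mul_neg,
    neg_neg, mul_assoc, mul_assoc (S.gammaA c), S.gammaA_mul_gamma_ten]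
  simp only [mul_neg, mul_assoc]

theorem trace_gammaA_gamma_ten_gammaA (a c : Fin 10) :
    (S.gammaA a * S.Γ 10 * S.gammaA c).trace = 0 := by
  rw [mul_assoc, gamma_ten_mul_gammaA, mul_neg, ← mul_assoc, Matrix.trace_neg,
    trace_gammaA_gammaA_gamma_ten, neg_zero]

theorem sum_conj_gammaA (c : Fin 10) :
    ∑ a : Fin 10, eta a a • (S.gammaA a * S.gammaA c * S.gammaA a) = (-8 : ℝ) • S.gammaA c := by
  have h := S.sum_conj_cliff {c.castSucc}
  rw [sum_cliffSign, cliff_singleton] at h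
  · refine h.trans ?_
    rw [Finset.card_singleton]
    norm_num [gammaA]
  · rw [Finset.mem_singleton]
    exact (Fin.castSucc_lt_last c).ne'

/-- Only `a = c` survives in the traces and contributes 32/2 = 16 times `Γ_c Γ_10`. The sandwich
terms contribute 2·(-8) times the same matrix, so the spinor dimension and the spacetime dimension
match. -/
theorem fierzMap_gammaA (c : Fin 10) : S.fierzMap (S.gammaA c) = 0 := by
  rw [S.fierzMap_of_anticomm (S.gamma_ten_mul_gammaA c), sum_conj_gammaA]
  simp only [trace_gammaA_gamma_ten_gammaA, trace_gammaA_mul_gammaA]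
  rw [Finset.sum_eq_single c]
  · rw [if_pos rfl, gamma_ten_mul_gammaA, smul_mul_assoc, smul_smul, mul_zero, zero_smul, zero_sub,
      smul_neg, smul_neg, smul_neg, neg_neg, smul_smul, ← add_smul,
      show eta c c * (2⁻¹ * (32 * eta c c)) = 16 * (eta c c * eta c c) by ring, eta_self_mul_self]
    norm_num
  · intro a _ ha
    simp [ha]
  · simp

theorem gammaA_gamma_ten_anticomm (c : Fin 10) :
    S.Γ 10 * (S.gammaA c * S.Γ 10) = -(S.gammaA c * S.Γ 10 * S.Γ 10) := by
  rw [← mul_assoc, gamma_ten_mul_gammaA, neg_mul]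

theorem fierzMap_gammaA_gamma_ten (c : Fin 10) : S.fierzMap (S.gammaA c * S.Γ 10) = 0 := by
  -- Moving `Γ_10` past the outer `Γ_a` turns the contraction constant -8 of `Γ_c` into +8.
  have h1 : ∑ a : Fin 10, eta a a • (S.gammaA a * (S.gammaA c * S.Γ 10) * S.gammaA a) =
      (8 : ℝ) • (S.gammaA c * S.Γ 10) := by
    have h := congrArg (· * S.Γ 10) (S.sum_conj_gammaA c)
    simp only [Finset.sum_mul, smul_mul_assoc] at h
    rw [neg_smul, ← neg_eq_iff_eq_neg, ← Finset.sum_neg_distrib] at h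
    rw [← h]
    refine Finset.sum_congr rfl fun a _ => ?_
    rw [← smul_neg]
    congr 1
    rw [← mul_assoc, mul_assoc _ (S.Γ 10), gamma_ten_mul_gammaA, mul_neg, ← mul_assoc]
  have h2 : ∀ a, (S.gammaA a * S.Γ 10 * (S.gammaA c * S.Γ 10)).trace =
      -(S.gammaA a * S.gammaA c).trace := by
    intro a
    rw [mul_assoc, gammaA_gamma_ten_anticomm, mul_assoc _ (S.Γ 10), gamma_ten_sq, mul_one, mul_neg,
      Matrix.trace_neg]
  rw [S.fierzMap_of_anticomm (S.gammaA_gamma_ten_anticomm c), h1]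
  simp only [h2, trace_gammaA_mul_gammaA]
  simp only [← mul_assoc, trace_gammaA_gammaA_gamma_ten]
  rw [Finset.sum_eq_single c]
  · rw [if_pos rfl, smul_mul_assoc, mul_assoc (S.gammaA c), gamma_ten_sq, mul_one, smul_smul,
      mul_zero, zero_smul, sub_zero, smul_smul, ← add_smul,
      show eta c c * (2⁻¹ * -(32 * eta c c)) = -16 * (eta c c * eta c c) by ring, eta_self_mul_self]
    norm_num
  · intro a _ ha
    simp [ha]
  · simp

theorem trace_gammaA_mul_cliff_five {J : Finset (Fin 11)} (hJ : J.card = 5) (a : Fin 10) :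
    (S.gammaA a * S.cliff J).trace = 0 := by
  have h := S.trace_cliff_mul_cliff (J := {a.castSucc}) (K := J) (by simp) hJ.le (by
    rintro rfl
    simp at hJ)
  rwa [cliff_singleton] at h

theorem trace_gammaA_gamma_ten_mul_cliff_five {J : Finset (Fin 11)} (hJ : J.card = 5)
    (a : Fin 10) : (S.gammaA a * S.Γ 10 * S.cliff J).trace = 0 := by
  have hlt : a.castSucc ≠ (10 : Fin 11) := (Fin.castSucc_lt_last a).ne
  have h2 : ({a.castSucc, 10} : Finset (Fin 11)).card = 2 := Finset.card_pair hlt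
  have h := S.trace_cliff_mul_cliff (J := {a.castSucc, 10}) (K := J) (by omega) hJ.le (by
    rintro rfl
    omega)
  rwa [cliff_pair_ten] at h

/-- If `10 ∈ J`, the monomial commutes with `Γ_10`. Otherwise it anticommutes, its traces against
degrees one and two vanish by orthogonality, and the contraction constant is 10 - 2·5 = 0. -/
theorem fierzMap_cliff_five {J : Finset (Fin 11)} (hJ : J.card = 5) :
    S.fierzMap (S.cliff J) = 0 := by
  have hc := S.gamma_mul_cliff 10 J
  by_cases h10 : (10 : Fin 11) ∈ J
  · apply S.fierzMap_of_comm
    rw [cliffSign_of_mem h10, hJ] at hc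
    rw [hc]
    norm_num
  · rw [cliffSign_of_notMem h10, hJ] at hc
    rw [S.fierzMap_of_anticomm (by rw [hc]; norm_num), sum_conj_cliff, sum_cliffSign h10, hJ]
    simp only [S.trace_gammaA_mul_cliff_five hJ, S.trace_gammaA_gamma_ten_mul_cliff_five hJ]
    norm_num

theorem fierzMap_cliff_two {J : Finset (Fin 11)} (hJ : J.card = 2) :
    S.fierzMap (S.cliff J) = 0 := by
  by_cases h10 : (10 : Fin 11) ∈ J
  · obtain ⟨c, hc⟩ := Finset.card_eq_one.mp
      (show (J.erase 10).card = 1 by rw [Finset.card_erase_of_mem h10, hJ])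
    have hcJ : c ∈ J.erase 10 := by rw [hc]; exact Finset.mem_singleton_self c
    have hc10 : c ≠ Fin.last 10 := (Finset.mem_erase.mp hcJ).1
    obtain ⟨c', rfl⟩ := Fin.exists_castSucc_eq.mpr hc10
    have hJ' : J = {c'.castSucc, 10} := by
      rw [← Finset.insert_erase h10, hc, Finset.pair_comm]
    rw [hJ', cliff_pair_ten, fierzMap_gammaA_gamma_ten]
  · apply S.fierzMap_of_comm
    have hc := S.gamma_mul_cliff 10 J
    rw [cliffSign_of_notMem h10, hJ] at hc
    rw [hc]
    norm_num

theorem fierzMap_cliff_one {J : Finset (Fin 11)} (hJ : J.card = 1) :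
    S.fierzMap (S.cliff J) = 0 := by
  obtain ⟨c, rfl⟩ := Finset.card_eq_one.mp hJ
  rw [cliff_singleton]
  by_cases hc : c = Fin.last 10
  · subst hc
    exact S.fierzMap_of_comm rfl
  · obtain ⟨c', rfl⟩ := Fin.exists_castSucc_eq.mpr hc
    exact S.fierzMap_gammaA c'

theorem C_inv_mul : S.C⁻¹ * S.C = 1 := Matrix.nonsing_inv_mul _ S.C_nondeg

/-- The Fierz identity holds on all matrices that are skew-self-adjoint for the pairing. -/
theorem fierzMap_eq_zero {M : Matrix ι ι ℝ} (hM : M.transpose * S.C = -(S.C * M)) :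
    S.fierzMap M = 0 := by
  -- Twice the skew-self-adjoint part of `X` is linear in `X`, so it can be checked on the spanning
  -- monomials.
  have key : ∀ X : Matrix ι ι ℝ, S.fierzMap (X - S.C⁻¹ * (X.transpose * S.C)) = 0 := by
    intro X
    have hX : X ∈ Submodule.span ℝ
        (Set.range fun J : {J : Finset (Fin 11) // J.card ≤ 5} => S.cliff J) := by
      rw [S.span_cliff]; trivial
    induction hX using Submodule.span_induction with
    | mem X hX =>
      obtain ⟨⟨J, hJ⟩, rfl⟩ := hX
      simp only
      rw [cliff_transpose_mul, mul_smul_comm, ← mul_assoc, C_inv_mul, one_mul]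
      -- In degrees 0, 3 and 4 the monomial is self-adjoint and the argument is already zero. In
      -- degrees 1, 2 and 5 the Fierz computations apply.
      interval_cases h : J.card
      · norm_num
      · rw [map_sub, map_smul, S.fierzMap_cliff_one h]; simp
      · rw [map_sub, map_smul, S.fierzMap_cliff_two h]; simp
      · norm_num [Nat.choose]
      · norm_num [Nat.choose]
      · rw [map_sub, map_smul, S.fierzMap_cliff_five h]; simp
    | zero => simp
    | add X Y _ _ h1 h2 =>
      have h := congrArg₂ (· + ·) h1 h2
      simp only [← map_add, add_zero] at h
      rw [← h]
      congr 1
      simp only [Matrix.transpose_add, add_mul, mul_add]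
      abel
    | smul c X _ h =>
      rw [Matrix.transpose_smul, smul_mul_assoc, mul_smul_comm, ← smul_sub, map_smul, h, smul_zero]
  have h := key M
  rw [hM, mul_neg, ← mul_assoc, C_inv_mul, one_mul, sub_neg_eq_add, ← two_smul ℝ, map_smul] at h
  exact (smul_eq_zero.mp h).resolve_left two_ne_zero

/-! ### Polarization of the cubic spinor identity -/

theorem C_mul_gamma_transpose (a : Fin 11) : (S.C * S.Γ a).transpose = S.C * S.Γ a := by
  rw [Matrix.transpose_mul, S.C_skew, mul_neg, S.skewAdj, neg_neg]

theorem C_mul_gamma_gamma_transpose {a b : Fin 11} (h : a ≠ b) :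
    (S.C * (S.Γ a * S.Γ b)).transpose = S.C * (S.Γ a * S.Γ b) := by
  rw [Matrix.transpose_mul, Matrix.transpose_mul, S.C_skew, mul_neg, mul_assoc, S.skewAdj, mul_neg,
    neg_neg, ← mul_assoc, S.skewAdj, neg_mul, mul_assoc, S.gamma_anticomm h, mul_neg]

/-- The coefficients of the cubic spinor expression
`(ψ̄ Γ_a Γ_10 ψ) Γ^a ψ - (ψ̄ Γ_a ψ) Γ_10 Γ^a ψ`. -/
def cubicCoeff (α β γ δ : ι) : ℝ := ∑ a : Fin 10, eta a a *
  ((S.C * (S.gammaA a * S.Γ 10)) β γ * S.gammaA a α δ -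
    (S.C * S.gammaA a) β γ * (S.Γ 10 * S.gammaA a) α δ)

theorem mul_single_mul_apply (A B : Matrix ι ι ℝ) (β γ α δ : ι) :
    (A * Matrix.single β γ (1 : ℝ) * B : Matrix ι ι ℝ) α δ = A α β * B γ δ := by
  rw [mul_assoc, Matrix.mul_apply, Finset.sum_eq_single β]
  · simp [Matrix.single_mul_apply_same]
  · intro x _ hx
    simp [Matrix.single_mul_apply_of_ne _ _ _ _ _ hx]
  · simp

theorem trace_mul_single_mul (A B : Matrix ι ι ℝ) (β γ : ι) :
    (A * Matrix.single β γ (1 : ℝ) * B : Matrix ι ι ℝ).trace = (B * A) γ β := by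
  rw [Matrix.trace, Matrix.mul_apply]
  exact Finset.sum_congr rfl fun x _ => by
    rw [Matrix.diag_apply, mul_single_mul_apply, mul_comm]

/-- This is the `(α, δ)` entry of the Fierz identity for `N * C`, where `N` is the elementary
symmetric matrix on `β, γ`. The trace terms yield the first summand and the sandwich terms the other
two. -/
theorem cubicCoeff_cyclic (α β γ δ : ι) :
    S.cubicCoeff α β γ δ + S.cubicCoeff α γ δ β + S.cubicCoeff α β δ γ = 0 := by
  set N : Matrix ι ι ℝ := Matrix.single β γ 1 + Matrix.single γ β 1 with hN
  have hNt : N.transpose = N := by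
    rw [hN, Matrix.transpose_add, Matrix.transpose_single, Matrix.transpose_single, add_comm]
  have h := S.fierzMap_eq_zero (M := N * S.C) (by
    rw [Matrix.transpose_mul, S.C_skew, hNt]
    simp [mul_assoc])
  rw [fierzMap_apply] at h
  have h' := congrFun (congrFun h α) δ
  rw [Matrix.sum_apply] at h'
  rw [cubicCoeff, cubicCoeff, cubicCoeff, ← Finset.sum_add_distrib, ← Finset.sum_add_distrib]
  refine Eq.trans (Finset.sum_congr rfl fun a _ => ?_) h'
  have ht : ∀ X : Matrix ι ι ℝ, (S.C * X).transpose = S.C * X →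
      (X * (N * S.C)).trace = 2 * (S.C * X) β γ := by
    intro X hX
    have e : (S.C * X) γ β = (S.C * X) β γ := by
      conv_lhs => rw [← hX]
      rfl
    rw [← mul_assoc, hN, mul_add, add_mul, Matrix.trace_add, trace_mul_single_mul,
      trace_mul_single_mul, e]
    ring
  have hm : ∀ X Y : Matrix ι ι ℝ, (X * (N * S.C) * Y) α δ =
      X α β * (S.C * Y) γ δ + X α γ * (S.C * Y) β δ := by
    intro X Y
    rw [show X * (N * S.C) * Y = X * N * (S.C * Y) by simp only [mul_assoc], hN, mul_add, add_mul,
      Matrix.add_apply, mul_single_mul_apply, mul_single_mul_apply]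
  simp only [Matrix.smul_apply, Matrix.sub_apply, Matrix.add_apply, smul_eq_mul]
  rw [hm, hm, ht (S.gammaA a) (S.C_mul_gamma_transpose _),
    ht (S.gammaA a * S.Γ 10) (S.C_mul_gamma_gamma_transpose (Fin.castSucc_lt_last a).ne)]
  ring

/-- The cubic spinor identity `(ψ̄ Γ_a Γ_10 ψ) Γ^a ψ = (ψ̄ Γ_a ψ) Γ_10 Γ^a ψ` for commuting `ψ`. -/
theorem sum_cubicCoeff {A : Type*} [Ring A] [Algebra ℝ A] (ψ : ι → A)
    (hψ : ∀ α β, ψ α * ψ β = ψ β * ψ α) (α : ι) :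
    ∑ β, ∑ γ, ∑ δ, S.cubicCoeff α β γ δ • (ψ β * ψ γ * ψ δ) = 0 := by
  set s := ∑ β, ∑ γ, ∑ δ, S.cubicCoeff α β γ δ • (ψ β * ψ γ * ψ δ) with hs
  have h2 : ∑ β, ∑ γ, ∑ δ, S.cubicCoeff α γ δ β • (ψ β * ψ γ * ψ δ) = s := by
    rw [hs, Finset.sum_comm]
    refine Finset.sum_congr rfl fun γ _ => ?_
    rw [Finset.sum_comm]
    refine Finset.sum_congr rfl fun δ _ => Finset.sum_congr rfl fun β _ => ?_
    rw [mul_assoc (ψ β), ← (show Commute (ψ γ * ψ δ) (ψ β) from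
      (show Commute (ψ γ) (ψ β) from hψ _ _).mul_left (hψ _ _)).eq]
  have h3 : ∑ β, ∑ γ, ∑ δ, S.cubicCoeff α β δ γ • (ψ β * ψ γ * ψ δ) = s := by
    rw [hs]
    refine Finset.sum_congr rfl fun β _ => ?_
    rw [Finset.sum_comm]
    refine Finset.sum_congr rfl fun γ _ => Finset.sum_congr rfl fun δ _ => ?_
    rw [mul_assoc, hψ δ γ, ← mul_assoc]
  -- Since the `ψ` commute, the three relabelled sums agree, so the cyclic identity reads `3 s = 0`.
  have h : s + s + s = 0 := by
    calc s + s + s = _ := congrArg₂ (· + ·) (congrArg₂ (· + ·) hs h2.symm) h3.symm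
      _ = 0 := by
        simp only [← Finset.sum_add_distrib, ← add_smul, S.cubicCoeff_cyclic, zero_smul,
          Finset.sum_const_zero]
  have h' : (3 : ℝ) • s = 0 := by
    rw [← h, show (3 : ℝ) = 1 + 1 + 1 by norm_num, add_smul, add_smul, one_smul]
  exact (smul_eq_zero.mp h').resolve_left (by norm_num)

end Majorana11

/-! ### Products of anticommuting families -/

/-- Only the two exchanged neighbours have to be distinct. Heads that are not involved are peeled
off until the exchange happens at the front. -/
theorem prod_ofFn_swap {κ R : Type*} [Ring R] (g : κ → R)
    (hg : ∀ a b, a ≠ b → g a * g b = -(g b * g a)) {p : ℕ} (i : Fin p) (a : Fin (p + 1) → κ)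
    (ha : a i.castSucc ≠ a i.succ) :
    (List.ofFn fun j => g (a (Equiv.swap i.castSucc i.succ j))).prod =
      -(List.ofFn fun j => g (a j)).prod := by
  induction p with
  | zero => exact i.elim0
  | succ p ih =>
    refine Fin.cases (fun ha => ?_) (fun i ha => ?_) i ha
    · have hj : ∀ j : Fin p, Equiv.swap (Fin.castSucc 0 : Fin (p + 1 + 1)) (Fin.succ 0) j.succ.succ =
          j.succ.succ := fun j =>
        Equiv.swap_apply_of_ne_of_ne (Fin.succ_ne_zero _)
          (fun h => Fin.succ_ne_zero j (Fin.succ_injective _ h))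
      have h0 : Equiv.swap (Fin.castSucc 0 : Fin (p + 1 + 1)) (Fin.succ 0) 0 = Fin.succ 0 :=
        Equiv.swap_apply_left _ _
      have h1 : Equiv.swap (Fin.castSucc 0 : Fin (p + 1 + 1)) (Fin.succ 0) (Fin.succ 0) = 0 :=
        Equiv.swap_apply_right _ _
      simp only [List.ofFn_succ, List.prod_cons, hj, h0, h1, ← mul_assoc]
      have hne : a (Fin.succ 0) ≠ a 0 := Ne.symm ha
      rw [hg _ _ hne, neg_mul]
    · have h0 : Equiv.swap i.succ.castSucc i.succ.succ 0 = 0 :=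
        Equiv.swap_apply_of_ne_of_ne (fun h => by simpa using h.symm) (Fin.succ_ne_zero _).symm
      have hj : ∀ j : Fin (p + 1), Equiv.swap i.succ.castSucc i.succ.succ j.succ =
          (Equiv.swap i.castSucc i.succ j).succ := fun j => by
        rw [← Fin.succ_castSucc, (Fin.succ_injective (p + 1)).swap_apply]
      rw [List.ofFn_succ, List.ofFn_succ (f := fun j => g (a j)), List.prod_cons, List.prod_cons, h0]
      simp only [hj]
      rw [ih i (fun j => a j.succ) ha, mul_neg]

/-- Permuting the factors of a product of distinct anticommuting elements. -/
theorem sign_smul_prod_ofFn {κ R : Type*} [Ring R] [Algebra ℝ R] (g : κ → R)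
    (hg : ∀ a b, a ≠ b → g a * g b = -(g b * g a)) {p : ℕ} (σ : Equiv.Perm (Fin p))
    (a : Fin p → κ) (ha : Function.Injective a) :
    ((Equiv.Perm.sign σ : ℤ) : ℝ) • (List.ofFn fun j => g (a (σ j))).prod =
      (List.ofFn fun j => g (a j)).prod := by
  cases p with
  | zero => simp [Subsingleton.elim σ 1]
  | succ p =>
    have hσ : σ ∈ Submonoid.closure
        (Set.range fun i : Fin p => Equiv.swap i.castSucc i.succ) := by
      rw [Equiv.Perm.mclosure_swap_castSucc_succ]; trivial
    -- In the product step one hypothesis is applied to the tuple already permuted by the other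
    -- factor, so `a` has to vary.
    induction hσ using Submonoid.closure_induction generalizing a with
    | mem σ hσ =>
      obtain ⟨i, rfl⟩ := hσ
      have hne : i.castSucc ≠ i.succ := (Fin.castSucc_lt_succ (i := i)).ne
      rw [Equiv.Perm.sign_swap hne, prod_ofFn_swap g hg i a fun h => hne (ha h)]
      simp
    | one => simp
    | mul σ τ _ _ h1 h2 =>
      have e := h2 (fun j => a (σ j)) (ha.comp σ.injective)
      simp only [Equiv.Perm.mul_apply, Equiv.Perm.sign_mul, Units.val_mul, Int.cast_mul, mul_smul]
      rw [e, h1 a ha]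

theorem mul_prod_eq_zero_of_mem {κ R : Type*} [Ring R] (e : κ → R)
    (he : ∀ a b, e a * e b = -(e b * e a)) (h0 : ∀ a, e a * e a = 0) {b : κ} {l : List κ}
    (hb : b ∈ l) : e b * (l.map e).prod = 0 := by
  induction l with
  | nil => simp at hb
  | cons c l ih =>
    rw [List.map_cons, List.prod_cons, ← mul_assoc]
    rcases List.mem_cons.mp hb with rfl | hb
    · rw [h0, zero_mul]
    · rw [he, neg_mul, mul_assoc, ih hb, mul_zero, neg_zero]

theorem prod_map_eq_zero_of_not_nodup {κ R : Type*} [Ring R] (e : κ → R)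
    (he : ∀ a b, e a * e b = -(e b * e a)) (h0 : ∀ a, e a * e a = 0) {l : List κ}
    (hl : ¬ l.Nodup) : (l.map e).prod = 0 := by
  induction l with
  | nil => simp at hl
  | cons c l ih =>
    rw [List.map_cons, List.prod_cons]
    by_cases hc : c ∈ l
    · exact mul_prod_eq_zero_of_mem e he h0 hc
    · rw [ih fun h => hl (List.nodup_cons.mpr ⟨hc, h⟩), mul_zero]

theorem prod_ofFn_eq_zero {κ R : Type*} [Ring R] (e : κ → R)
    (he : ∀ a b, e a * e b = -(e b * e a)) (h0 : ∀ a, e a * e a = 0) {p : ℕ} {a : Fin p → κ}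
    (ha : ¬ Function.Injective a) : (List.ofFn fun j => e (a j)).prod = 0 := by
  have h := prod_map_eq_zero_of_not_nodup e he h0 (l := List.ofFn a)
    (fun h => ha (List.nodup_ofFn.mp h))
  rwa [List.map_ofFn] at h

/-- The binomial expansion stops after its linear term. It is applied with `w` the part of the
vielbein matrix along the new generator. -/
theorem add_pow_of_mul_self_eq_zero {R : Type*} [Ring R] {u w : R} (h : u * w = w * u)
    (hw : w * w = 0) (n : ℕ) : (u + w) ^ (n + 1) = u ^ (n + 1) + (n + 1) • (w * u ^ n) := by
  induction n with
  | zero => simp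
  | succ n ih =>
    have h1 : w * u ^ n * u = w * u ^ (n + 1) := by rw [mul_assoc, ← pow_succ]
    have h2 : w * u ^ n * w = 0 := by
      rw [mul_assoc, ((show Commute u w from h).pow_left n).eq, ← mul_assoc, hw, zero_mul]
    have h3 : u ^ (n + 1) * w = w * u ^ (n + 1) := ((show Commute u w from h).pow_left (n + 1)).eq
    rw [pow_succ, ih, add_mul, mul_add, mul_add, ← pow_succ, smul_mul_assoc, smul_mul_assoc, h1, h2,
      h3, smul_zero, add_zero, add_assoc, succ_nsmul' _ (n + 1)]

/-! ### Matrices of forms -/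

section

variable {ι κ : Type} [Fintype ι] [DecidableEq ι] [Fintype κ] {A B : Type*} [Ring A] [Algebra ℝ A]
  [Ring B] [Algebra ℝ B]

/-- Real matrices as matrices over an `ℝ`-algebra. -/
def realMat (A : Type*) [Ring A] [Algebra ℝ A] : Matrix ι ι ℝ →ₐ[ℝ] Matrix ι ι A :=
  (Algebra.ofId ℝ A).mapMatrix

theorem realMat_apply (M : Matrix ι ι ℝ) (i j : ι) :
    realMat A M i j = algebraMap ℝ A (M i j) := rfl

theorem scalar_mul_apply (a : A) (M : Matrix ι ι A) (i j : ι) :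
    (Matrix.scalar ι a * M) i j = a * M i j := by
  simp [Matrix.scalar_apply]

theorem mul_scalar_apply (a : A) (M : Matrix ι ι A) (i j : ι) :
    (M * Matrix.scalar ι a) i j = M i j * a := by
  simp [Matrix.scalar_apply]

theorem scalar_mul_realMat (a : A) (M : Matrix ι ι ℝ) :
    Matrix.scalar ι a * realMat A M = realMat A M * Matrix.scalar ι a := by
  ext i j
  rw [scalar_mul_apply, mul_scalar_apply, realMat_apply, Algebra.commutes]

/-- The matrix-valued form `∑ e^a G_a`. -/
def slash (G : κ → Matrix ι ι ℝ) (e : κ → A) : Matrix ι ι A :=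
  ∑ a, Matrix.scalar ι (e a) * realMat A (G a)

/-- The bilinear expression `∑ ψ^α ψ^β M_{αβ}`. -/
def bil (ψ : ι → A) : Matrix ι ι A →ₗ[ℝ] A where
  toFun M := ∑ α, ∑ β, ψ α * ψ β * M α β
  map_add' M N := by simp [mul_add, Finset.sum_add_distrib]
  map_smul' c M := by simp [Finset.smul_sum]

theorem bil_apply (ψ : ι → A) (M : Matrix ι ι A) :
    bil ψ M = ∑ α, ∑ β, ψ α * ψ β * M α β := rfl

theorem bil_mul_scalar (ψ : ι → A) (M : Matrix ι ι A) (a : A) :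
    bil ψ (M * Matrix.scalar ι a) = bil ψ M * a := by
  simp only [bil_apply, mul_scalar_apply, Finset.sum_mul, mul_assoc]

theorem bil_scalar_mul (ψ : ι → A) (M : Matrix ι ι A) (a : A)
    (ha : ∀ α β, a * (ψ α * ψ β) = ψ α * ψ β * a) :
    bil ψ (Matrix.scalar ι a * M) = a * bil ψ M := by
  simp only [bil_apply, scalar_mul_apply, Finset.mul_sum, ← mul_assoc]
  refine Finset.sum_congr rfl fun α _ => Finset.sum_congr rfl fun β _ => ?_
  rw [← ha, ← mul_assoc]

theorem map_bil (f : A →ₐ[ℝ] B) (ψ : ι → A) (M : Matrix ι ι A) :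
    f (bil ψ M) = bil (fun α => f (ψ α)) (f.mapMatrix M) := by
  simp [bil_apply]

theorem mapMatrix_realMat (f : A →ₐ[ℝ] B) (M : Matrix ι ι ℝ) :
    f.mapMatrix (realMat A M) = realMat B M := by
  ext i j
  simp [realMat_apply]

theorem mapMatrix_scalar (f : A →ₐ[ℝ] B) (a : A) :
    f.mapMatrix (Matrix.scalar ι a) = Matrix.scalar ι (f a) := by
  ext i j
  simp [Matrix.scalar_apply, Matrix.diagonal_apply, apply_ite f]

theorem mapMatrix_slash (f : A →ₐ[ℝ] B) (G : κ → Matrix ι ι ℝ) (e : κ → A) :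
    f.mapMatrix (slash G e) = slash G fun a => f (e a) := by
  simp only [slash, map_sum, map_mul, mapMatrix_realMat, mapMatrix_scalar]

theorem slash_mul_slash (G G' : κ → Matrix ι ι ℝ) (e w : κ → A) :
    slash G e * slash G' w =
      ∑ a, ∑ b, Matrix.scalar ι (e a * w b) * realMat A (G a * G' b) := by
  simp only [slash, Finset.sum_mul_sum]
  refine Finset.sum_congr rfl fun a _ => Finset.sum_congr rfl fun b _ => ?_
  rw [mul_assoc, ← mul_assoc (realMat A (G a)), ← scalar_mul_realMat, map_mul, map_mul]
  simp only [mul_assoc]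

theorem prod_map_scalar_mul_realMat (G : κ → Matrix ι ι ℝ) (e : κ → A) (l : List κ) :
    (l.map fun a => Matrix.scalar ι (e a) * realMat A (G a)).prod =
      Matrix.scalar ι (l.map e).prod * realMat A (l.map G).prod := by
  induction l with
  | nil => simp
  | cons b l ih =>
    simp only [List.map_cons, List.prod_cons, ih, map_mul]
    rw [mul_assoc, ← mul_assoc (realMat A (G b)), ← scalar_mul_realMat]
    simp only [mul_assoc]

theorem slash_pow (G : κ → Matrix ι ι ℝ) (e : κ → A) (p : ℕ) :
    slash G e ^ p = ∑ a : Fin p → κ,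
      Matrix.scalar ι (List.ofFn fun i => e (a i)).prod *
        realMat A (List.ofFn fun i => G (a i)).prod := by
  classical
  rw [← MultilinearMap.mkPiAlgebraFin_apply_const (R := ℝ), slash, MultilinearMap.map_sum]
  refine Finset.sum_congr rfl fun a _ => ?_
  have h := prod_map_scalar_mul_realMat G e (List.ofFn a)
  simp only [List.map_ofFn] at h
  rw [MultilinearMap.mkPiAlgebraFin_apply]
  exact h

/-- The last matrix acts on the right spinor once its central entries are moved next to it, so only
its action on `ψ` matters. -/
theorem bil_mul_congr (ψ : ι → A) {Z Z' : Matrix ι ι A} (hZ : ∀ i j a, Z i j * a = a * Z i j)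
    (hZ' : ∀ i j a, Z' i j * a = a * Z' i j)
    (h : ∀ γ, ∑ β, Z γ β * ψ β = ∑ β, Z' γ β * ψ β) (N : Matrix ι ι A) :
    bil ψ (N * Z) = bil ψ (N * Z') := by
  have key : ∀ Y : Matrix ι ι A, (∀ i j a, Y i j * a = a * Y i j) →
      bil ψ (N * Y) = ∑ α, ∑ γ, ψ α * (∑ β, Y γ β * ψ β) * N α γ := by
    intro Y hY
    rw [bil_apply]
    refine Finset.sum_congr rfl fun α _ => ?_
    simp only [Matrix.mul_apply, Finset.mul_sum, Finset.sum_mul]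
    rw [Finset.sum_comm]
    refine Finset.sum_congr rfl fun γ _ => Finset.sum_congr rfl fun β _ => ?_
    rw [hY γ β (ψ β), ← mul_assoc (ψ α), mul_assoc _ (Y γ β), hY γ β (N α γ)]
  rw [key Z hZ, key Z' hZ']
  simp only [h]

/-- In the mirror situation the first matrix already follows the spinors, and exchanging the two
commuting spinors brings the right one next to it. Its entries need not be central. -/
theorem bil_congr_mul (ψ : ι → A) (hψ : ∀ α β, ψ α * ψ β = ψ β * ψ α) {Z Z' : Matrix ι ι A}
    (h : ∀ γ, ∑ α, ψ α * Z α γ = ∑ α, ψ α * Z' α γ) (N : Matrix ι ι A) :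
    bil ψ (Z * N) = bil ψ (Z' * N) := by
  have key : ∀ Y : Matrix ι ι A,
      bil ψ (Y * N) = ∑ β, ∑ γ, ψ β * (∑ α, ψ α * Y α γ) * N γ β := by
    intro Y
    rw [bil_apply, Finset.sum_comm]
    refine Finset.sum_congr rfl fun β _ => ?_
    simp only [Matrix.mul_apply, Finset.mul_sum, Finset.sum_mul]
    rw [Finset.sum_comm]
    refine Finset.sum_congr rfl fun γ _ => Finset.sum_congr rfl fun α _ => ?_
    rw [hψ α β]
    simp only [mul_assoc]
  rw [key Z, key Z']
  simp only [h]

end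

/-! ### Powers of an odd element -/

section

variable {R : Type*} [Ring R] {x y θ : R}

theorem even_pow_comm {g : R} (h : x * g = -(g * x)) (n : ℕ) :
    x ^ (2 * n) * g = g * x ^ (2 * n) := by
  have h2 : Commute (x * x) g := by
    change x * x * g = g * (x * x)
    rw [mul_assoc, h, mul_neg, ← mul_assoc, h, neg_mul, neg_neg, mul_assoc]
  have h3 := (h2.pow_left n).eq
  rwa [← pow_two, ← pow_mul] at h3

theorem odd_pow_anticomm {g : R} (h : x * g = -(g * x)) (n : ℕ) :
    x ^ (2 * n + 1) * g = -(g * x ^ (2 * n + 1)) := by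
  rw [pow_succ, mul_assoc, h, mul_neg, ← mul_assoc, even_pow_comm h, mul_assoc]

/-- In the application `x` is the vielbein matrix, `y` is the Clifford contraction of a vector of
even elements, and `θ` is the corresponding scalar one-form, which anticommutes with `x`. -/
theorem sq_mul_of_anticomm (hxy : x * y + y * x = 2 * θ) (hθ : θ * x = -(x * θ)) :
    x * x * y = y * (x * x) - 4 * (θ * x) := by
  have h1 : x * y = 2 * θ - y * x := eq_sub_of_add_eq hxy
  rw [mul_assoc, h1, mul_sub, ← mul_assoc x y, h1, sub_mul]
  have h2 : x * θ = -(θ * x) := by rw [hθ, neg_neg]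
  have h3 : x * (2 * θ) = -(2 * (θ * x)) := by rw [two_mul, mul_add, h2]; noncomm_ring
  rw [h3]
  noncomm_ring

theorem sq_mul_comm (hθ : θ * x = -(x * θ)) : x * x * θ = θ * (x * x) := by
  rw [← mul_assoc, hθ, neg_mul, mul_assoc x θ, hθ, mul_neg, neg_neg, mul_assoc]

/-- Every further factor `x * x` contributes 4 through its commutator with `y`, starting from 2.
This is the origin of the constant `2 * (2 * n + 1)`. -/
theorem odd_pow_mul_add (hxy : x * y + y * x = 2 * θ) (hθ : θ * x = -(x * θ)) (n : ℕ) :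
    x ^ (2 * n + 1) * y + y * x ^ (2 * n + 1) = (2 * (2 * n + 1) : ℕ) • (θ * x ^ (2 * n)) := by
  induction n with
  | zero => simp [hxy, two_mul]
  | succ n ih =>
    have hs := sq_mul_of_anticomm hxy hθ
    have e1 : x ^ (2 * (n + 1) + 1) = x ^ (2 * n + 1) * (x * x) := by
      rw [← pow_two, ← pow_add]; congr 1
    have e2 : x ^ (2 * (n + 1)) = x ^ (2 * n) * (x * x) := by
      rw [← pow_two, ← pow_add]; congr 1
    have e3 : x ^ (2 * n + 1) * (θ * x) = -(θ * x ^ (2 * n) * (x * x)) := by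
      have h := ((show Commute (x * x) θ from sq_mul_comm hθ).pow_left n).eq
      rw [← pow_two, ← pow_mul] at h
      rw [hθ, mul_neg, ← mul_assoc, ← pow_succ, show 2 * n + 1 + 1 = 2 * (n + 1) by ring]
      have h' := ((show Commute (x * x) θ from sq_mul_comm hθ).pow_left (n + 1)).eq
      rw [← pow_two, ← pow_mul] at h'
      rw [h', e2, mul_assoc]
    have h4 : ((4 : ℕ) : R) = 4 := by norm_num
    rw [e1, e2, mul_assoc, hs, mul_sub, ← mul_assoc _ y, ← mul_assoc y, show
      x ^ (2 * n + 1) * (4 * (θ * x)) = 4 * (x ^ (2 * n + 1) * (θ * x)) by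
        rw [← h4, ← nsmul_eq_mul, ← nsmul_eq_mul, mul_smul_comm], e3]
    have := congrArg (· * (x * x)) ih
    simp only [add_mul, smul_mul_assoc] at this
    rw [sub_add_eq_add_sub, this, show 2 * (2 * (n + 1) + 1) = 2 * (2 * n + 1) + 4 by ring,
      add_smul, ← h4, ← nsmul_eq_mul, smul_neg, sub_neg_eq_add]
    simp only [mul_assoc]

/-- The derivative of an even power of an odd element `x` with `D x = y`. -/
theorem derivation_even_pow (hxy : x * y + y * x = 2 * θ) (hθ : θ * x = -(x * θ))
    (D : R → R) (h1 : D 1 = 0) (hD : ∀ m, D (x * m) = y * m - x * D m) (n : ℕ) :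
    D (x ^ (2 * (n + 1))) = (n + 1) • (y * x ^ (2 * n + 1) - x ^ (2 * n + 1) * y) := by
  -- The two signs of the odd derivation cancel on `x * x`, leaving an ordinary Leibniz rule.
  have hD2 : ∀ m, D (x * x * m) = (y * x - x * y) * m + x * x * D m := by
    intro m
    rw [mul_assoc, hD, hD]
    noncomm_ring
  induction n with
  | zero =>
    have := hD2 1
    rw [mul_one, mul_one, h1, mul_zero, add_zero] at this
    simpa [pow_two] using this
  | succ n ih =>
    have e : x ^ (2 * (n + 1 + 1)) = x * x * x ^ (2 * (n + 1)) := by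
      rw [← pow_two, ← pow_add]; congr 1; ring
    have e' : x ^ (2 * (n + 1) + 1) = x * x * x ^ (2 * n + 1) := by
      rw [← pow_two, ← pow_add]; congr 1; ring
    have e'' : x ^ (2 * (n + 1)) = x * x ^ (2 * n + 1) := by
      rw [← pow_succ']; congr 1
    have ho := odd_pow_mul_add hxy hθ (n + 1)
    have hs := sq_mul_of_anticomm hxy hθ
    have h1 : x * y = 2 * θ - y * x := eq_sub_of_add_eq hxy
    have hs' : x * x * (y * x ^ (2 * n + 1)) =
        y * x ^ (2 * (n + 1) + 1) - 4 * (θ * x ^ (2 * (n + 1))) := by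
      rw [← mul_assoc, hs, sub_mul, e', e'']
      simp only [mul_assoc]
    have hx' : x * x ^ (2 * (n + 1)) = x ^ (2 * (n + 1) + 1) := (pow_succ' _ _).symm
    rw [e, hD2, ih, mul_smul_comm, mul_sub, hs', ← mul_assoc (x * x), ← e', h1]
    have h2 : (y * x - (2 * θ - y * x)) * x ^ (2 * (n + 1)) =
        (2 : ℕ) • (y * x ^ (2 * (n + 1) + 1)) - (2 : ℕ) • (θ * x ^ (2 * (n + 1))) := by
      rw [← hx']
      noncomm_ring
    have h4 : (4 : R) * (θ * x ^ (2 * (n + 1))) = (4 : ℕ) • (θ * x ^ (2 * (n + 1))) := by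
      rw [nsmul_eq_mul]; norm_num
    rw [h2, h4]
    generalize θ * x ^ (2 * (n + 1)) = t at *
    generalize y * x ^ (2 * (n + 1) + 1) = u at *
    generalize x ^ (2 * (n + 1) + 1) * y = w at *
    -- The anticommutator formula eliminates `w`, and the claim becomes linear in the two
    -- independent terms `t` and `u`.
    have hw : w = (2 * (2 * (n + 1) + 1)) • t - u := eq_sub_of_add_eq ho
    rw [hw]
    module

end

/-! ### Generators of super-Minkowski algebras -/

theorem GCAlg.mul_comm_of_mem_two {I : Type*} {deg : I → BiDeg} {x : GCAlg deg}
    (hx : x ∈ GCAlg.homog deg (2, 0)) (y : GCAlg deg) : x * y = y * x := by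
  have key : LinearMap.mulLeft ℝ x = LinearMap.mulRight ℝ x := by
    apply linearMap_ext
    intro l
    rw [LinearMap.mulLeft_apply, LinearMap.mulRight_apply, homog_mul_homog hx (word_mem l),
      koszul_comm, koszul_two, one_smul]
  exact LinearMap.congr_fun key y

section

variable {ι κ : Type}

/-- The odd generators `ψ^α`. -/
def psi (κ : Type) (α : ι) : GCAlg (minkDeg ι κ) := GCAlg.gen (minkDeg ι κ) (.inl α)

theorem psi_mul_psi_mem (α β : ι) :
    psi κ α * psi κ β ∈ GCAlg.homog (minkDeg ι κ) (2, 0) := by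
  have h := GCAlg.mul_mem (gen_mem (deg := minkDeg ι κ) (.inl α))
    (gen_mem (deg := minkDeg ι κ) (.inl β))
  have e : minkDeg ι κ (.inl α) + minkDeg ι κ (.inl β) = (2, 0) := by
    simp only [minkDeg]
    decide
  rwa [e] at h

/-- The signs from the odd cohomological degree and from the odd super-degree cancel. -/
theorem psi_comm (α β : ι) : psi κ α * psi κ β = psi κ β * psi κ α := by
  rw [psi, psi, gen_mul_gen]
  simp [koszul, minkDeg, ZMod.val_one]

theorem psi_mul_psi_comm (α β : ι) (x : GCAlg (minkDeg ι κ)) :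
    x * (psi κ α * psi κ β) = psi κ α * psi κ β * x :=
  (GCAlg.mul_comm_of_mem_two (psi_mul_psi_mem α β) x).symm

theorem vec_anticomm (a b : κ) :
    GCAlg.gen (minkDeg ι κ) (.inr a) * GCAlg.gen (minkDeg ι κ) (.inr b) =
    -(GCAlg.gen (minkDeg ι κ) (.inr b) * GCAlg.gen (minkDeg ι κ) (.inr a)) := by
  rw [gen_mul_gen]
  simp [koszul, minkDeg]

theorem vec_sq (a : κ) :
    GCAlg.gen (minkDeg ι κ) (.inr a) * GCAlg.gen (minkDeg ι κ) (.inr a) = 0 :=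
  eq_zero_of_eq_neg (vec_anticomm a a)

variable [Fintype ι] [DecidableEq ι]

theorem quad_eq_bil (K : Matrix ι ι ℝ) :
    quad κ K = bil (psi κ) (realMat (GCAlg (minkDeg ι κ)) K) := by
  rw [quad, bil_apply]
  refine Finset.sum_congr rfl fun α _ => Finset.sum_congr rfl fun β _ => ?_
  rw [realMat_apply, ← Algebra.commutes, Algebra.smul_def]
  rfl

theorem quad_comm (K : Matrix ι ι ℝ) (x : GCAlg (minkDeg ι κ)) : quad κ K * x = x * quad κ K :=
  GCAlg.mul_comm_of_mem_two (quad_mem K) x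

/-- The differential of a super-Minkowski algebra commutes with the spinor bilinears. -/
theorem d_bil [Finite κ] (K : κ → Matrix ι ι ℝ) (M : Matrix ι ι (GCAlg (minkDeg ι κ))) :
    (superMink K).d (bil (psi κ) M) = bil (psi κ) (M.map (superMink K).d) := by
  simp only [bil_apply, map_sum, Matrix.map_apply]
  refine Finset.sum_congr rfl fun α _ => Finset.sum_congr rfl fun β _ => ?_
  have h0 : (superMink K).d (psi κ α * psi κ β) = 0 := by
    rw [SuperLInf.d]
    simp only [psi, gradedDer_gen_mul, gradedDer_gen, minkDgen]
    simp
  rw [(superMink K).d_mul (psi_mul_psi_mem α β), h0, zero_mul, zero_add, koszul_two, one_smul]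

theorem bil_mem (n : ℤ) {M : Matrix ι ι (GCAlg (minkDeg ι κ))}
    (hM : ∀ i j, M i j ∈ GCAlg.homog (minkDeg ι κ) (n, 0)) :
    bil (psi κ) M ∈ GCAlg.homog (minkDeg ι κ) (n + 2, 0) := by
  rw [bil_apply]
  refine sum_mem fun α _ => sum_mem fun β _ => ?_
  have h := GCAlg.mul_mem (psi_mul_psi_mem (κ := κ) α β) (hM α β)
  rwa [Prod.mk_add_mk, add_comm, add_zero] at h

theorem realMat_mul_mem {I : Type*} {deg : I → BiDeg} {n : BiDeg} (X : Matrix ι ι ℝ)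
    {M : Matrix ι ι (GCAlg deg)} (hM : ∀ i j, M i j ∈ GCAlg.homog deg n) (i j : ι) :
    (realMat (GCAlg deg) X * M) i j ∈ GCAlg.homog deg n := by
  rw [Matrix.mul_apply]
  refine sum_mem fun k _ => ?_
  rw [realMat_apply, ← Algebra.smul_def]
  exact Submodule.smul_mem _ _ (hM k j)

theorem slash_pow_mem {I : Type*} {deg : I → BiDeg} {lam : Type} [Fintype lam]
    (G : lam → Matrix ι ι ℝ) {e : lam → GCAlg deg} (he : ∀ a, e a ∈ GCAlg.homog deg (1, 0)) (p : ℕ)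
    (i j : ι) : (slash G e ^ p) i j ∈ GCAlg.homog deg (p, 0) := by
  induction p generalizing i j with
  | zero =>
    rw [pow_zero, Matrix.one_apply]
    split_ifs
    · exact GCAlg.one_mem
    · exact zero_mem _
  | succ p ih =>
    rw [pow_succ', slash, Finset.sum_mul, Matrix.sum_apply]
    refine sum_mem fun a _ => ?_
    rw [mul_assoc, scalar_mul_apply]
    have h := GCAlg.mul_mem (he a) (realMat_mul_mem (G a) ih i j)
    rwa [Prod.mk_add_mk, add_zero, add_comm, ← Nat.cast_succ] at h

end

namespace Majorana11

variable {ι : Type} [Fintype ι] [DecidableEq ι] (S : Majorana11 ι)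

local notation "𝒜" => GCAlg (minkDeg ι (Fin 10))

theorem e_anticomm (a b : Fin 10) : (e a * e b : 𝒜) = -(e b * e a) := vec_anticomm a b

theorem e_sq (a : Fin 10) : (e a * e a : 𝒜) = 0 := vec_sq a

theorem pair_eq_bil (κ : Type) (M : Matrix ι ι ℝ) :
    S.pair κ M = bil (psi κ) (realMat (GCAlg (minkDeg ι κ)) (S.C * M)) := quad_eq_bil _

/-! ### Flux densities as powers of the vielbein matrix -/

theorem gammaA_anticomm {a b : Fin 10} (h : a ≠ b) :
    S.gammaA a * S.gammaA b = -(S.gammaA b * S.gammaA a) :=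
  S.gamma_anticomm fun h' => h (Fin.castSucc_injective _ h')

/-- For distinct indices all `p!` signed summands coincide, which cancels the normalization. -/
theorem gammaAs_eq {p : ℕ} {a : Fin p → Fin 10} (ha : Function.Injective a) :
    S.gammaAs a = (List.ofFn fun i => S.gammaA (a i)).prod := by
  have h := fun σ => sign_smul_prod_ofFn S.gammaA (fun _ _ h => S.gammaA_anticomm h) σ a ha
  rw [gammaAs, Finset.sum_congr rfl fun σ _ => h σ, Finset.sum_const, Finset.card_univ,
    Fintype.card_perm, Fintype.card_fin, ← Nat.cast_smul_eq_nsmul ℝ, smul_smul,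
    inv_mul_cancel₀ (Nat.cast_ne_zero.mpr p.factorial_ne_zero), one_smul]

theorem form_eq_sum (p : ℕ) (G : (Fin p → Fin 10) → Matrix ι ι ℝ) :
    S.form p G = (p.factorial : ℝ)⁻¹ • bil (psi (Fin 10)) (∑ a : Fin p → Fin 10,
      realMat 𝒜 (S.C * G a) * Matrix.scalar ι (List.ofFn fun i => e (a i)).prod) := by
  simp only [form, map_sum, bil_mul_scalar, pair_eq_bil]

/-- A repeated index kills the product of the `e^a`, so the value of `G` on non-injective tuples is
irrelevant. In particular, only injective tuples matter when antisymmetrized products are replaced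
by plain ones. -/
theorem form_congr (p : ℕ) {G G' : (Fin p → Fin 10) → Matrix ι ι ℝ}
    (h : ∀ a, Function.Injective a → G a = G' a) : S.form p G = S.form p G' := by
  rw [form, form]
  congr 1
  refine Finset.sum_congr rfl fun a _ => ?_
  by_cases ha : Function.Injective a
  · rw [h a ha]
  · rw [prod_ofFn_eq_zero e e_anticomm e_sq ha, mul_zero, mul_zero]

theorem form_gammaAs (p : ℕ) (X : Matrix ι ι ℝ) :
    S.form p (fun a => X * S.gammaAs a) =
      (p.factorial : ℝ)⁻¹ • bil (psi (Fin 10)) (realMat 𝒜 (S.C * X) * slash S.gammaA e ^ p) := by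
  rw [S.form_congr p fun a ha => congrArg (X * ·) (S.gammaAs_eq ha), form_eq_sum, slash_pow,
    Finset.mul_sum]
  congr 2
  refine Finset.sum_congr rfl fun a _ => ?_
  rw [scalar_mul_realMat, ← mul_assoc, ← mul_assoc, map_mul (realMat 𝒜) (S.C * X)]

theorem slash_pow_eq_zero {p : ℕ} (hp : 10 < p) (G : Fin 10 → Matrix ι ι ℝ) :
    slash G (e : Fin 10 → 𝒜) ^ p = 0 := by
  rw [slash_pow]
  refine Finset.sum_eq_zero fun a _ => ?_
  rw [prod_ofFn_eq_zero e e_anticomm e_sq, map_zero, zero_mul]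
  intro ha
  have := Fintype.card_le_of_injective a ha
  simp only [Fintype.card_fin] at this
  omega

theorem gamma_ten_pow_two_add (n : ℕ) : S.Γ 10 ^ (n + 2) = S.Γ 10 ^ n := by
  rw [pow_add, pow_two, gamma_ten_sq, mul_one]

/-- The expression `(1/(2n)!) (ψ̄ Γ_10^(n+1) Γ_{a₁ ⋯ a_{2n}} ψ) e^{a₁} ⋯ e^{a_{2n}}`. -/
def fluxA (n : ℕ) : 𝒜 := ((2 * n).factorial : ℝ)⁻¹ •
    bil (psi (Fin 10)) (realMat 𝒜 (S.C * S.Γ 10 ^ (n + 1)) * slash S.gammaA e ^ (2 * n))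

theorem form_eq_fluxA {n p : ℕ} {X : Matrix ι ι ℝ} (hp : p = 2 * n) (hX : X = S.Γ 10 ^ (n + 1)) :
    S.form p (fun a => X * S.gammaAs a) = S.fluxA n := by
  subst hp hX
  exact S.form_gammaAs _ _

theorem fluxA_of_lt {n : ℕ} (hn : 5 < n) : S.fluxA n = 0 := by
  rw [fluxA, slash_pow_eq_zero (by omega), mul_zero, map_zero, smul_zero]

/-- Since `Γ_10` squares to one, its alternating presence in the fluxes is the power `Γ_10^(n+1)`.
The cutoff after `F_12` is automatic, as more than ten one-forms multiply to zero. One formula thus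
covers all positive indices, including the top Bianchi identity. -/
theorem FA_succ (n : ℕ) : S.FA (n + 1) = S.fluxA n := by
  have h1 := S.gamma_ten_pow_two_add
  have h2 : ∀ n p : ℕ, p = 2 * n → 1 = S.Γ 10 ^ (n + 1) →
      S.form p (fun a => S.gammaAs a) = S.fluxA n := fun n p hp hX => by
    simpa only [one_mul] using S.form_eq_fluxA hp hX
  rcases Nat.lt_or_ge n 6 with hn | hn
  · interval_cases n
    · simp [FA, fluxA, pair_eq_bil]
    · exact (by simp [FA] : S.FA (((1 : ℕ) : ℤ) + 1) = _).trans (h2 1 2 (by norm_num) (by simp [h1]))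
    · exact (by simp [FA] : S.FA (((2 : ℕ) : ℤ) + 1) = _).trans
        (S.form_eq_fluxA (X := S.Γ 10) (n := 2) (p := 4) (by norm_num) (by simp [h1]))
    · exact (by simp [FA] : S.FA (((3 : ℕ) : ℤ) + 1) = _).trans (h2 3 6 (by norm_num) (by simp [h1]))
    · exact (by simp [FA] : S.FA (((4 : ℕ) : ℤ) + 1) = _).trans
        (S.form_eq_fluxA (X := S.Γ 10) (n := 4) (p := 8) (by norm_num) (by simp [h1]))
    · exact (by simp [FA] : S.FA (((5 : ℕ) : ℤ) + 1) = _).trans (h2 5 10 (by norm_num) (by simp [h1]))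
  · have h : ∀ k : ℤ, k ≤ 6 → (n : ℤ) + 1 ≠ k := fun k hk => by omega
    rw [S.fluxA_of_lt (by omega), FA]
    simp only [if_neg (h 1 (by norm_num)), if_neg (h 2 (by norm_num)), if_neg (h 3 (by norm_num)),
      if_neg (h 4 (by norm_num)), if_neg (h 5 (by norm_num)), if_neg (h 6 (by norm_num))]

theorem FA_of_nonpos {k : ℤ} (hk : k ≤ 0) : S.FA k = 0 := by
  have h : ∀ j : ℤ, 1 ≤ j → k ≠ j := fun j hj => by omega
  simp only [FA, if_neg (h 1 (by norm_num)), if_neg (h 2 (by norm_num)), if_neg (h 3 (by norm_num)),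
    if_neg (h 4 (by norm_num)), if_neg (h 5 (by norm_num)), if_neg (h 6 (by norm_num))]

theorem e_mem (a : Fin 10) : (e a : 𝒜) ∈ GCAlg.homog (minkDeg ι (Fin 10)) (1, 0) :=
  gen_mem (deg := minkDeg ι (Fin 10)) (.inr a)

theorem FA_mem (k : ℤ) : S.FA k ∈ S.IIA.homog (2 * k, 0) := by
  rcases le_or_gt k 0 with hk | hk
  · rw [S.FA_of_nonpos hk]; exact zero_mem _
  · obtain ⟨n, rfl⟩ : ∃ n : ℕ, k = n + 1 := ⟨(k - 1).toNat, by omega⟩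
    rw [FA_succ, fluxA]
    have h := bil_mem _ (realMat_mul_mem (S.C * S.Γ 10 ^ (n + 1))
      (slash_pow_mem S.gammaA (e_mem (ι := ι)) (2 * n)))
    rw [show (((2 * n : ℕ) : ℤ) + 2) = 2 * ((n : ℤ) + 1) by push_cast; ring] at h
    exact Submodule.smul_mem _ _ h

theorem pair_mul_e_mem (M : Matrix ι ι ℝ) (a : Fin 10) :
    S.pair (Fin 10) M * e a ∈ GCAlg.homog (minkDeg ι (Fin 10)) (3, 0) := by
  have h := GCAlg.mul_mem (quad_mem (κ := Fin 10) (S.C * M)) (e_mem a)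
  rwa [show ((2, 0) : BiDeg) + (1, 0) = (3, 0) by decide] at h

theorem H3A_mem : S.H3A ∈ S.IIA.homog (3, 0) := sum_mem fun a _ => S.pair_mul_e_mem _ a

/-! ### The type IIA Bianchi identities -/

/-- The vector `(ψ̄ Γ^a ψ)`, the differential of `e^a` in the type IIA algebra. -/
def vecA (a : Fin 10) : 𝒜 := quad (Fin 10) (S.C * raise S.gammaA a)

/-- The vector `(ψ̄ Γ^a Γ_10 ψ)`. -/
def vecH (a : Fin 10) : 𝒜 := eta a a • S.pair (Fin 10) (S.gammaA a * S.Γ 10)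

theorem raise_eq_eta_smul (G : Fin 10 → Matrix ι ι ℝ) (a : Fin 10) : raise G a = eta a a • G a := by
  rw [raise_eq, eta, if_pos rfl]

theorem quad_smul {κ : Type} (c : ℝ) (K : Matrix ι ι ℝ) : quad κ (c • K) = c • quad κ K := by
  rw [quad_eq_bil, quad_eq_bil, map_smul, map_smul]

theorem vecA_eq (a : Fin 10) : S.vecA a = eta a a • S.pair (Fin 10) (S.gammaA a) := by
  rw [vecA, raise_eq_eta_smul, mul_smul_comm, quad_smul]
  rfl

theorem vecA_comm (a : Fin 10) (x : 𝒜) : S.vecA a * x = x * S.vecA a := quad_comm _ x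

theorem vecH_comm (a : Fin 10) (x : 𝒜) : S.vecH a * x = x * S.vecH a := by
  rw [vecH, smul_mul_assoc, mul_smul_comm]
  exact congrArg _ (quad_comm _ x)

theorem slash_apply (G : Fin 10 → Matrix ι ι ℝ) (w : Fin 10 → 𝒜) (i j : ι) :
    slash G w i j = ∑ a, G a i j • w a := by
  rw [slash, Matrix.sum_apply]
  refine Finset.sum_congr rfl fun a _ => ?_
  rw [scalar_mul_apply, realMat_apply, ← Algebra.commutes, Algebra.smul_def]

theorem slash_comm (G : Fin 10 → Matrix ι ι ℝ) {w : Fin 10 → 𝒜}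
    (hw : ∀ a x, w a * x = x * w a) (i j : ι) (x : 𝒜) :
    slash G w i j * x = x * slash G w i j := by
  simp only [slash_apply, Finset.sum_mul, Finset.mul_sum, smul_mul_assoc, mul_smul_comm, hw]

theorem realMat_mul_slash (X : Matrix ι ι ℝ) (G : Fin 10 → Matrix ι ι ℝ) (w : Fin 10 → 𝒜) :
    realMat 𝒜 X * slash G w = slash (fun a => X * G a) w := by
  rw [slash, slash, Finset.mul_sum]
  refine Finset.sum_congr rfl fun a _ => ?_
  rw [← mul_assoc, ← scalar_mul_realMat, mul_assoc, ← map_mul]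

theorem slash_mul_psi (a b : Fin 10 → Matrix ι ι ℝ) (α : ι) :
    ∑ δ, slash a (fun c => eta c c • quad (Fin 10) (b c)) α δ * psi (Fin 10) δ =
      ∑ β, ∑ γ, ∑ δ, (∑ c : Fin 10, eta c c * (b c β γ * a c α δ)) •
        (psi (Fin 10) β * psi (Fin 10) γ * psi (Fin 10) δ) := by
  simp only [slash_apply, quad, Finset.smul_sum, Finset.sum_mul, smul_smul, Finset.sum_smul]
  have h : ∀ δ : ι, ∑ c : Fin 10, ∑ β, ∑ γ, (a c α δ * (eta c c * b c β γ)) •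
      (GCAlg.gen (minkDeg ι (Fin 10)) (.inl β) * GCAlg.gen (minkDeg ι (Fin 10)) (.inl γ)) *
        psi (Fin 10) δ = ∑ β, ∑ γ, ∑ c : Fin 10, (eta c c * (b c β γ * a c α δ)) •
        (psi (Fin 10) β * psi (Fin 10) γ * psi (Fin 10) δ) := by
    intro δ
    rw [Finset.sum_comm]
    refine Finset.sum_congr rfl fun β _ => ?_
    rw [Finset.sum_comm]
    refine Finset.sum_congr rfl fun γ _ => Finset.sum_congr rfl fun c _ => ?_
    rw [smul_mul_assoc, mul_comm (a c α δ), mul_assoc]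
    rfl
  simp only [smul_mul_assoc] at h ⊢
  rw [Finset.sum_congr rfl fun δ _ => h δ, Finset.sum_comm]
  refine Finset.sum_congr rfl fun β _ => ?_
  rw [Finset.sum_comm]

/-- The cubic spinor identity in matrix form. -/
theorem slash_vecH_mul_psi (α : ι) :
    ∑ δ, slash S.gammaA S.vecH α δ * psi (Fin 10) δ =
      ∑ δ, (realMat 𝒜 (S.Γ 10) * slash S.gammaA S.vecA) α δ * psi (Fin 10) δ := by
  have h := S.sum_cubicCoeff (psi (Fin 10)) psi_comm α
  have hH : S.vecH = fun c => eta c c • quad (Fin 10) (S.C * (S.gammaA c * S.Γ 10)) := rfl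
  have hA : S.vecA = fun c => eta c c • quad (Fin 10) (S.C * S.gammaA c) := funext S.vecA_eq
  rw [realMat_mul_slash, hH, hA, slash_mul_psi, slash_mul_psi, ← sub_eq_zero]
  simp only [← Finset.sum_sub_distrib, ← sub_smul, ← mul_sub]
  exact h

theorem psi_mul_of_symm {Z : Matrix ι ι 𝒜} (hZ : ∀ i j x, Z i j * x = x * Z i j)
    (hs : ∀ i j, Z i j = Z j i) (γ : ι) :
    ∑ α, psi (Fin 10) α * Z α γ = ∑ α, Z γ α * psi (Fin 10) α :=
  Finset.sum_congr rfl fun α _ => by rw [← hZ, hs]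

/-- The matrices `C Γ_a` and `C Γ_10 Γ_a` are symmetric, so this row-vector version is the transpose
of the cubic identity acting on a column. -/
theorem psi_mul_slash_vecH (γ : ι) :
    ∑ α, psi (Fin 10) α * (realMat 𝒜 S.C * slash S.gammaA S.vecH) α γ =
      ∑ α, psi (Fin 10) α * (realMat 𝒜 (S.C * S.Γ 10) * slash S.gammaA S.vecA) α γ := by
  have key : ∀ (X : Matrix ι ι ℝ) (w : Fin 10 → 𝒜), (∀ a x, w a * x = x * w a) →
      (∀ a, (X * S.gammaA a).transpose = X * S.gammaA a) →
      ∑ α, psi (Fin 10) α * (realMat 𝒜 X * slash S.gammaA w) α γ =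
        ∑ α, (realMat 𝒜 X * slash S.gammaA w) γ α * psi (Fin 10) α := by
    intro X w hw hX
    rw [realMat_mul_slash]
    apply psi_mul_of_symm (slash_comm _ hw)
    intro i j
    rw [slash_apply, slash_apply]
    refine Finset.sum_congr rfl fun a _ => ?_
    conv_lhs => rw [← hX]
    rfl
  rw [key _ _ S.vecH_comm fun a => S.C_mul_gamma_transpose _, key _ _ S.vecA_comm fun a => by
    rw [mul_assoc]; exact S.C_mul_gamma_gamma_transpose (Fin.castSucc_lt_last a).ne']
  have h1 : ∀ (Y : Matrix ι ι 𝒜), ∑ α, (realMat 𝒜 S.C * Y) γ α * psi (Fin 10) α =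
      ∑ β, realMat 𝒜 S.C γ β * ∑ α, Y β α * psi (Fin 10) α := by
    intro Y
    simp only [Matrix.mul_apply, Finset.sum_mul, Finset.mul_sum, mul_assoc]
    rw [Finset.sum_comm]
  rw [map_mul, mul_assoc, h1, h1]
  simp only [slash_vecH_mul_psi]

/-- The cubic identity becomes a replacement rule at the right end of a bilinear;
`bil_C_mul_slash_vecH` is the rule at the left end. -/
theorem bil_mul_slash_vecH (N : Matrix ι ι 𝒜) :
    bil (psi (Fin 10)) (N * slash S.gammaA S.vecH) =
      bil (psi (Fin 10)) (N * (realMat 𝒜 (S.Γ 10) * slash S.gammaA S.vecA)) := by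
  refine bil_mul_congr _ (slash_comm _ S.vecH_comm) ?_ S.slash_vecH_mul_psi N
  rw [realMat_mul_slash]
  exact slash_comm _ S.vecA_comm

theorem bil_C_mul_slash_vecH (N : Matrix ι ι 𝒜) :
    bil (psi (Fin 10)) (realMat 𝒜 S.C * slash S.gammaA S.vecH * N) =
      bil (psi (Fin 10)) (realMat 𝒜 (S.C * S.Γ 10) * slash S.gammaA S.vecA * N) :=
  bil_congr_mul _ psi_comm S.psi_mul_slash_vecH N

theorem gammaA_clifford (a b : Fin 10) :
    S.gammaA a * S.gammaA b + S.gammaA b * S.gammaA a = (2 * eta a b) • (1 : Matrix ι ι ℝ) := by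
  rw [gammaA, gammaA, S.clifford]
  congr 2
  simp [eta]

/-- The one-form `w_a e^a`. -/
def contr (w : Fin 10 → 𝒜) : 𝒜 := ∑ a, eta a a • (w a * e a)

/-- Centrality of `w` lets the two orders be combined, and the Clifford relation leaves only the
terms with equal indices. -/
theorem slash_anticomm {w : Fin 10 → 𝒜} (hw : ∀ a x, w a * x = x * w a) :
    slash S.gammaA e * slash S.gammaA w + slash S.gammaA w * slash S.gammaA e =
      2 * Matrix.scalar ι (contr w) := by
  rw [slash_mul_slash, slash_mul_slash, Finset.sum_comm, ← Finset.sum_add_distrib]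
  have h : ∀ b : Fin 10,
      (∑ a, Matrix.scalar ι (e a * w b) * realMat 𝒜 (S.gammaA a * S.gammaA b)) +
        ∑ a, Matrix.scalar ι (w b * e a) * realMat 𝒜 (S.gammaA b * S.gammaA a) =
      2 * Matrix.scalar ι (eta b b • (w b * e b)) := by
    intro b
    rw [← Finset.sum_add_distrib, Finset.sum_eq_single b]
    · rw [hw, ← mul_add, ← map_add, gammaA_clifford, map_smul, map_one, mul_smul_comm, mul_one,
        mul_smul, two_smul, two_mul]
      have : Matrix.scalar ι (eta b b • (e b * w b)) = eta b b • Matrix.scalar ι (e b * w b) := by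
        ext i j
        simp [Matrix.scalar_apply, Matrix.diagonal_apply]
      rw [this]
    · intro a _ hab
      rw [hw, ← mul_add, ← map_add, gammaA_clifford, eta, if_neg hab]
      simp
    · simp
  rw [Finset.sum_congr rfl fun b _ => h b, ← Finset.mul_sum, contr, map_sum]

theorem contr_anticomm {w : Fin 10 → 𝒜} (hw : ∀ a x, w a * x = x * w a) :
    Matrix.scalar ι (contr w) * slash S.gammaA e =
      -(slash S.gammaA e * Matrix.scalar ι (contr w)) := by
  rw [slash, Finset.mul_sum, Finset.sum_mul, ← Finset.sum_neg_distrib]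
  refine Finset.sum_congr rfl fun a _ => ?_
  rw [← mul_assoc, ← map_mul, mul_assoc, ← scalar_mul_realMat, ← mul_assoc, ← map_mul, ← neg_mul,
    ← map_neg]
  congr 2
  rw [contr, Finset.sum_mul, Finset.mul_sum, ← Finset.sum_neg_distrib]
  refine Finset.sum_congr rfl fun b _ => ?_
  rw [smul_mul_assoc, mul_smul_comm, ← smul_neg, mul_assoc, e_anticomm, mul_neg, ← mul_assoc, hw,
    mul_assoc, hw, ← mul_assoc]

theorem contr_vecH : contr S.vecH = S.H3A := by
  rw [contr, H3A]
  refine Finset.sum_congr rfl fun a _ => ?_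
  rw [vecH, smul_mul_assoc, smul_smul, eta_self_mul_self, one_smul]

theorem realMat_gamma_ten_mul_slash (w : Fin 10 → 𝒜) :
    realMat 𝒜 (S.Γ 10) * slash S.gammaA w = -(slash S.gammaA w * realMat 𝒜 (S.Γ 10)) := by
  rw [realMat_mul_slash, slash, slash, Finset.sum_mul, ← Finset.sum_neg_distrib]
  refine Finset.sum_congr rfl fun a _ => ?_
  rw [gamma_ten_mul_gammaA, map_neg, mul_neg, mul_assoc, ← map_mul]

/-- The differential applied to the entries of a matrix. -/
abbrev dMat (M : Matrix ι ι 𝒜) : Matrix ι ι 𝒜 := M.map S.IIA.d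

theorem dMat_realMat_mul (X : Matrix ι ι ℝ) (M : Matrix ι ι 𝒜) :
    S.dMat (realMat 𝒜 X * M) = realMat 𝒜 X * S.dMat M := by
  ext i j
  simp only [dMat, Matrix.map_apply, Matrix.mul_apply, map_sum, realMat_apply, ← Algebra.smul_def,
    map_smul]

theorem dMat_slash_mul (M : Matrix ι ι 𝒜) :
    S.dMat (slash S.gammaA e * M) = slash S.gammaA S.vecA * M - slash S.gammaA e * S.dMat M := by
  have h : ∀ a (M : Matrix ι ι 𝒜), S.dMat (Matrix.scalar ι (e a) * M) =
      Matrix.scalar ι (S.vecA a) * M - Matrix.scalar ι (e a) * S.dMat M := by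
    intro a M
    ext i j
    simp only [dMat, Matrix.map_apply, scalar_mul_apply, Matrix.sub_apply]
    rw [S.IIA.d_mul (e_mem a)]
    have h1 : S.IIA.d (e a) = S.vecA a := S.IIA.d_gen (.inr a)
    have h2 : koszul (1, 0) (1, 0) = -1 := by norm_num [koszul]
    rw [h1, h2, neg_one_smul, sub_eq_add_neg]
  have hs : ∀ N : Fin 10 → Matrix ι ι 𝒜, S.dMat (∑ a, N a) = ∑ a, S.dMat (N a) := by
    intro N
    ext i j
    simp only [dMat, Matrix.map_apply, Matrix.sum_apply, map_sum]
  simp only [slash, Finset.sum_mul, hs, ← Finset.sum_sub_distrib]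
  refine Finset.sum_congr rfl fun a _ => ?_
  rw [mul_assoc, h, dMat_realMat_mul]
  simp only [mul_assoc]

theorem dMat_one : S.dMat 1 = 0 := by
  ext i j
  rw [dMat, Matrix.map_apply, Matrix.one_apply, Matrix.zero_apply]
  split_ifs
  · exact S.IIA.d_one
  · exact map_zero _

theorem dMat_slash_pow (n : ℕ) : S.dMat (slash S.gammaA e ^ (2 * (n + 1))) =
    (n + 1) • (slash S.gammaA S.vecA * slash S.gammaA e ^ (2 * n + 1) -
      slash S.gammaA e ^ (2 * n + 1) * slash S.gammaA S.vecA) :=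
  derivation_even_pow (S.slash_anticomm S.vecA_comm) (S.contr_anticomm S.vecA_comm) S.dMat
    S.dMat_one S.dMat_slash_mul n

theorem gamma_ten_mul_slash_odd_pow (w : Fin 10 → 𝒜) (n : ℕ) :
    realMat 𝒜 (S.Γ 10) * slash S.gammaA w ^ (2 * n + 1) =
      -(slash S.gammaA w ^ (2 * n + 1) * realMat 𝒜 (S.Γ 10)) := by
  rw [odd_pow_anticomm, neg_neg]
  rw [realMat_gamma_ten_mul_slash, neg_neg]

/-- In each summand `Z` stands next to a spinor, possibly after passing a `Γ_10`, and is replaced by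
`Γ_10 V`. The relative sign on the right arises because `Γ_10` anticommutes with the odd power of
the vielbein matrix. -/
theorem bil_flux_balance (n : ℕ) :
    bil (psi (Fin 10)) (realMat 𝒜 (S.C * S.Γ 10 ^ (n + 1)) *
      (slash S.gammaA e ^ (2 * n + 1) * slash S.gammaA S.vecH +
        slash S.gammaA S.vecH * slash S.gammaA e ^ (2 * n + 1))) =
    bil (psi (Fin 10)) (realMat 𝒜 (S.C * S.Γ 10 ^ (n + 2)) *
      (slash S.gammaA S.vecA * slash S.gammaA e ^ (2 * n + 1) -
        slash S.gammaA e ^ (2 * n + 1) * slash S.gammaA S.vecA)) := by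
  have hR := S.bil_mul_slash_vecH
  have hL := S.bil_C_mul_slash_vecH
  have hgx := S.gamma_ten_mul_slash_odd_pow e n
  have hgy := S.realMat_gamma_ten_mul_slash S.vecA
  have hgz := S.realMat_gamma_ten_mul_slash S.vecH
  have hgg : realMat 𝒜 (S.Γ 10) * realMat 𝒜 (S.Γ 10) = 1 := by
    rw [← map_mul, gamma_ten_sq, map_one]
  simp only [map_mul (realMat 𝒜), map_pow]
  rw [map_mul (realMat 𝒜)] at hL
  generalize realMat 𝒜 (S.Γ 10) = g at *
  generalize realMat 𝒜 S.C = c at *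
  generalize slash S.gammaA e ^ (2 * n + 1) = x at *
  generalize slash S.gammaA S.vecA = y at *
  generalize slash S.gammaA S.vecH = z at *
  have hx : x * g = -(g * x) := by rw [hgx, neg_neg]
  rw [pow_add g n 2, pow_two g, hgg, mul_one]
  -- The parity of `n` decides whether `Γ_10^(n+1)` is `Γ_10` or 1, hence which factors have to be
  -- commuted.
  rcases Nat.even_or_odd' n with ⟨j, rfl | rfl⟩
  · have hj : g ^ (2 * j) = 1 := by rw [pow_mul, pow_two, hgg, one_pow]
    rw [pow_succ, hj, one_mul, mul_one, mul_add, mul_sub, map_add, map_sub, ← mul_assoc (c * g) x z,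
      hR, mul_assoc c g (z * x), ← mul_assoc g z x, hgz, neg_mul, mul_neg, map_neg,
      mul_assoc z g x, ← mul_assoc c z, hL, add_comm, sub_eq_add_neg, ← map_neg, ← map_neg]
    congr 2
    · rw [mul_assoc (c * g) y, ← mul_assoc y g, ← neg_neg (y * g), ← hgy, neg_mul, mul_neg, neg_neg,
        mul_assoc g y, mul_assoc c g, ← mul_assoc g g, hgg, one_mul]
    · rw [← mul_assoc, mul_assoc (c * g) x g, hx, mul_neg, neg_mul, mul_assoc c g, ← mul_assoc g g,
        hgg, one_mul, mul_assoc]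
  · have hj : g ^ (2 * j + 1) = g := by rw [pow_succ, pow_mul, pow_two, hgg, one_pow, one_mul]
    rw [pow_succ, hj, hgg, mul_one, mul_add, mul_sub, map_add, map_sub, ← mul_assoc c x z, hR,
      ← mul_assoc c z x, hL, add_comm, sub_eq_add_neg, ← map_neg]
    congr 2
    · simp only [mul_assoc]
    · rw [← mul_assoc, mul_assoc c x g, hx, mul_neg, neg_mul]
      simp only [mul_assoc]

/-- The type IIA Bianchi identities in terms of powers of the vielbein matrix. -/
theorem d_fluxA_succ (n : ℕ) : S.IIA.d (S.fluxA (n + 1)) = S.H3A * S.fluxA n := by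
  have h1 : S.IIA.d (S.fluxA (n + 1)) = ((2 * (n + 1)).factorial : ℝ)⁻¹ • (n + 1) •
      bil (psi (Fin 10)) (realMat 𝒜 (S.C * S.Γ 10 ^ (n + 2)) *
      (slash S.gammaA S.vecA * slash S.gammaA e ^ (2 * n + 1) -
        slash S.gammaA e ^ (2 * n + 1) * slash S.gammaA S.vecA)) := by
    have h := S.dMat_realMat_mul (S.C * S.Γ 10 ^ (n + 2)) (slash S.gammaA e ^ (2 * (n + 1)))
    rw [fluxA, map_smul, d_bil]
    change _ • bil (psi (Fin 10)) (S.dMat _) = _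
    rw [h, dMat_slash_pow, mul_smul_comm, map_nsmul]
  -- The anticommutator formula with the contraction equal to `H₃` extracts `H₃` from the bilinear,
  -- up to this integer factor.
  have h2 : (2 * (2 * n + 1)) • (S.H3A * S.fluxA n) = ((2 * n).factorial : ℝ)⁻¹ •
      bil (psi (Fin 10)) (realMat 𝒜 (S.C * S.Γ 10 ^ (n + 1)) *
      (slash S.gammaA e ^ (2 * n + 1) * slash S.gammaA S.vecH +
        slash S.gammaA S.vecH * slash S.gammaA e ^ (2 * n + 1))) := by
    rw [odd_pow_mul_add (S.slash_anticomm S.vecH_comm) (S.contr_anticomm S.vecH_comm), fluxA,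
      contr_vecH, mul_smul_comm _ S.H3A, smul_comm]
    congr 1
    rw [mul_smul_comm, map_nsmul, ← mul_assoc, ← scalar_mul_realMat, mul_assoc, bil_scalar_mul]
    exact fun α β => psi_mul_psi_comm α β _
  rw [bil_flux_balance] at h2
  rw [h1]
  generalize bil (psi (Fin 10)) (realMat 𝒜 (S.C * S.Γ 10 ^ (n + 2)) * _) = B at h2 ⊢
  rw [← Nat.cast_smul_eq_nsmul ℝ] at h2 ⊢
  have h3 : S.H3A * S.fluxA n =
      ((2 * (2 * n + 1) : ℕ) : ℝ)⁻¹ • ((2 * n).factorial : ℝ)⁻¹ • B := by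
    rw [← h2, smul_smul, inv_mul_cancel₀, one_smul]
    positivity
  rw [h3, smul_smul, smul_smul]
  congr 1
  -- The coefficients agree because `(n+1)/(2n+2)! = 1/(2(2n+1)(2n)!)`.
  rw [show 2 * (n + 1) = 2 * n + 1 + 1 by ring, Nat.factorial_succ, Nat.factorial_succ]
  have := (2 * n).factorial_ne_zero
  push_cast
  field_simp
  ring

theorem d_fluxA_zero : S.IIA.d (S.fluxA 0) = 0 := by
  rw [← FA_succ]
  have h : S.FA ((0 : ℕ) + 1) = S.pair (Fin 10) (S.Γ 10) := by simp [FA]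
  rw [h]
  exact gradedDer_quad _ _

theorem d_FA (k : ℤ) : S.IIA.d (S.FA k) = S.H3A * S.FA (k - 1) := by
  rcases le_or_gt k 0 with hk | hk
  · rw [S.FA_of_nonpos hk, S.FA_of_nonpos (by omega), map_zero, mul_zero]
  · obtain ⟨n, rfl⟩ : ∃ n : ℕ, k = n + 1 := ⟨(k - 1).toNat, by omega⟩
    rw [add_sub_cancel_right, FA_succ]
    cases n with
    | zero => rw [d_fluxA_zero, S.FA_of_nonpos (by simp), mul_zero]
    | succ n => rw [d_fluxA_succ, Nat.cast_succ, FA_succ]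

/-- Contracting the cubic identity with another spinor turns `∑ (ψ̄ Γ_a Γ_10 ψ)(ψ̄ Γ^a ψ)` into the
same sum with `Γ_10 Γ_a`. This is its negative, so it vanishes. -/
theorem d_H3A : S.IIA.d S.H3A = 0 := by
  have hd : S.IIA.d S.H3A = ∑ a, S.pair (Fin 10) (S.gammaA a * S.Γ 10) * S.vecA a := by
    rw [H3A, map_sum]
    refine Finset.sum_congr rfl fun a _ => ?_
    have h1 : S.IIA.d (e a) = S.vecA a := S.IIA.d_gen (.inr a)
    have h2 : S.IIA.d (S.pair (Fin 10) (S.gammaA a * S.Γ 10)) = 0 := gradedDer_quad _ _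
    have h3 : S.pair (Fin 10) (S.gammaA a * S.Γ 10) ∈ S.IIA.homog (2, 0) := quad_mem _
    rw [S.IIA.d_mul h3, h1, h2, koszul_two, one_smul, zero_mul, zero_add]
  have hs : ∀ (X : Matrix ι ι ℝ) (w : Fin 10 → 𝒜),
      bil (psi (Fin 10)) (realMat 𝒜 (S.C * X) * slash S.gammaA w) =
        ∑ a, S.pair (Fin 10) (X * S.gammaA a) * w a := by
    intro X w
    rw [slash, Finset.mul_sum, map_sum]
    refine Finset.sum_congr rfl fun a _ => ?_
    rw [scalar_mul_realMat, ← mul_assoc, ← map_mul, bil_mul_scalar, pair_eq_bil, mul_assoc]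
  have h := S.bil_C_mul_slash_vecH 1
  have h1 := hs 1 S.vecH
  rw [mul_one] at h1
  rw [mul_one, mul_one, hs, h1] at h
  apply eq_zero_of_eq_neg
  rw [hd]
  calc _ = ∑ a, S.pair (Fin 10) (1 * S.gammaA a) * S.vecH a := by
        refine Finset.sum_congr rfl fun a _ => ?_
        rw [vecH, vecA_eq, mul_smul_comm, mul_smul_comm, one_mul]
        exact congrArg _ (quad_comm _ _)
    _ = _ := by
        rw [h, ← Finset.sum_neg_distrib]
        refine Finset.sum_congr rfl fun a _ => ?_
        rw [gamma_ten_mul_gammaA, pair_eq_bil, pair_eq_bil, mul_neg, map_neg, map_neg, neg_mul]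

end Majorana11

namespace SuperLInf

/-! ### Maps to twisted K-theory -/

/-- The images of the generators under the homomorphism with components `H`, `F`. -/
def componentGen {A : Type*} (H : A) (F : ℤ → A) : KUGen → A
  | .h3 => H
  | .f k => F k

theorem Hom.ofGens_pull_gen {g h : SuperLInf} (φ : h.Gen → g.CE)
    (hφ : ∀ i, φ i ∈ g.homog (h.deg i)) (hd : ∀ i, homogLift φ hφ (h.dgen i) = g.d (φ i))
    (i : h.Gen) : (Hom.ofGens φ hφ hd).pull (h.gen i) = φ i := homogLift_gen φ hφ i

theorem Hom.ext_gens {g h : SuperLInf} {f f' : Hom g h}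
    (hf : ∀ i, f.pull (h.gen i) = f'.pull (h.gen i)) : f = f' :=
  Hom.ext (algHom_ext hf)

theorem exists_hasComponents {g : SuperLInf} {m : ℤ} {H : g.CE} {F : ℤ → g.CE}
    (hH : H ∈ g.homog (3, 0)) (hF : ∀ k, F k ∈ g.homog (2 * k + m, 0)) (dH : g.d H = 0)
    (dF : ∀ k, g.d (F k) = H * F (k - 1)) : ∃ f : Hom g (twistedKU m), HasComponents f H F := by
  have hmem : ∀ i, componentGen H F i ∈ g.homog ((twistedKU m).deg i) := by
    rintro (_ | k)
    · exact hH
    · exact hF k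
  refine ⟨Hom.ofGens (componentGen H F) hmem ?_, Hom.ofGens_pull_gen _ _ _ _,
    fun k => Hom.ofGens_pull_gen _ _ _ _⟩
  rintro (_ | k)
  · exact (map_zero _).trans dH.symm
  · change homogLift _ _ (GCAlg.gen (kuDeg m) .h3 * GCAlg.gen (kuDeg m) (.f (k - 1))) = _
    have hgen : ∀ i, homogLift (componentGen H F) hmem (GCAlg.gen (kuDeg m) i) =
      componentGen H F i := fun i => homogLift_gen _ hmem i
    rw [map_mul, hgen, hgen]
    exact (dF k).symm

theorem _root_.SuperL.HasComponents.unique {g : SuperLInf} {m : ℤ} {H : g.CE} {F : ℤ → g.CE}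
    {f f' : Hom g (twistedKU m)} (hf : HasComponents f H F) (hf' : HasComponents f' H F) :
    f = f' := by
  apply Hom.ext_gens
  rintro (_ | k)
  · exact hf.1.trans hf'.1.symm
  · exact (hf.2 k).trans (hf'.2 k).symm

theorem _root_.SuperL.HasComponents.bianchi {g : SuperLInf} {m : ℤ} {H : g.CE} {F : ℤ → g.CE}
    {f : Hom g (twistedKU m)} (hf : HasComponents f H F) :
    H ∈ g.homog (3, 0) ∧ (∀ k, F k ∈ g.homog (2 * k + m, 0)) ∧ g.d H = 0 ∧
      ∀ k, g.d (F k) = H * F (k - 1) := by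
  refine ⟨?_, fun k => ?_, ?_, fun k => ?_⟩
  · rw [← hf.1]
    exact f.pull_mem _ _ (gen_mem (deg := kuDeg m) .h3)
  · rw [← hf.2]
    exact f.pull_mem _ _ (gen_mem (deg := kuDeg m) (.f k))
  · rw [← hf.1, ← f.pull_d, d_gen]
    exact map_zero _
  · rw [← hf.1, ← hf.2, ← hf.2, ← f.pull_d, d_gen, ← map_mul]
    rfl

/-! ### Reduction and oxidation -/

theorem koszul_neg_one (n : BiDeg) : koszul (-1, 0) n = koszul (1, 0) n := by
  have : koszul (1, 0) n * koszul (-1, 0) n = 1 := by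
    rw [← koszul_add_left, koszul_comm]
    exact koszul_zero_right n
  have h2 := koszul_mul_self (1, 0) n
  exact mul_left_cancel₀ (left_ne_zero_of_mul_eq_one h2) (this.trans h2.symm)

theorem koszul_one_one : koszul (1, 0) (1, 0) = -1 := by norm_num [koszul]

section

variable {g : SuperLInf}

theorem new_gen_sq : GCAlg.gen g.extDeg none * GCAlg.gen g.extDeg none = 0 := by
  apply eq_zero_of_eq_neg
  have h := gen_mul_gen (deg := g.extDeg) none none
  rwa [show koszul (g.extDeg none) (g.extDeg none) = -1 from koszul_one_one, neg_one_smul] at h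

theorem new_gen_mul_mul_new_gen {n : BiDeg} {x : GCAlg g.extDeg}
    (hx : x ∈ GCAlg.homog g.extDeg n) :
    GCAlg.gen g.extDeg none * x * GCAlg.gen g.extDeg none = 0 := by
  rw [mul_assoc, homog_mul_gen hx, mul_smul_comm, ← mul_assoc, new_gen_sq, zero_mul, smul_zero]

/-- The part of a form on a central extension that does not contain the new generator. -/
def basicPart (g : SuperLInf) : GCAlg g.extDeg →ₐ[ℝ] g.CE :=
  homogLift (fun o : Option g.Gen => o.elim 0 g.gen) (by
    rintro (_ | i)
    · exact zero_mem _
    · exact gen_mem (deg := g.deg) i)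

theorem basicPart_basicIncl (x : g.CE) : g.basicPart (g.basicIncl x) = x := by
  have h : g.basicPart.comp g.basicIncl = AlgHom.id ℝ _ := by
    apply algHom_ext
    intro i
    rw [AlgHom.comp_apply, basicIncl_gen, basicPart, homogLift_gen]
    rfl
  exact DFunLike.congr_fun h x

theorem basicPart_new_gen : g.basicPart (GCAlg.gen g.extDeg none) = 0 := homogLift_gen _ _ _

theorem fiberGen_mem (o : Option g.Gen) :
    o.elim (1 : GCAlg g.extDeg) (fun _ => 0) ∈ GCAlg.homog g.extDeg (g.extDeg o + (-1, 0)) := by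
  cases o with
  | none =>
    have h : g.extDeg none + (-1, 0) = 0 := by
      change ((1, 0) : BiDeg) + (-1, 0) = 0
      simp
    rw [h]
    exact GCAlg.one_mem
  | some i => exact zero_mem _

/-- Contraction with the vector dual to the new generator of a central extension. -/
def fiberContr (g : SuperLInf) : GCAlg g.extDeg →ₗ[ℝ] GCAlg g.extDeg :=
  gradedDer (-1, 0) (fun o => o.elim 1 fun _ => 0) fiberGen_mem

theorem fiberContr_basicIncl (x : g.CE) : g.fiberContr (g.basicIncl x) = 0 := by
  have h : g.fiberContr ∘ₗ g.basicIncl.toLinearMap = 0 := by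
    apply leibniz_ext (-1, 0) g.basicIncl
    · simp [fiberContr]
    · intro i x
      simp only [LinearMap.comp_apply, AlgHom.toLinearMap_apply, map_mul, basicIncl_gen]
      simp [fiberContr, gradedDer_gen_mul]
      rfl
    · intro i x
      simp
    · intro i
      simp [fiberContr]
  exact LinearMap.congr_fun h x

theorem fiberContr_new_gen_mul (x : g.CE) :
    g.fiberContr (GCAlg.gen g.extDeg none * g.basicIncl x) = g.basicIncl x := by
  have h := g.fiberContr_basicIncl x
  rw [fiberContr] at h ⊢
  rw [gradedDer_gen_mul, h]
  simp

/-- The decomposition `α = α_bas + e' p_*α` of forms on a central extension is unique. -/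
theorem basic_decomp_unique {x y x' y' : g.CE}
    (h : g.basicIncl x + GCAlg.gen g.extDeg none * g.basicIncl y =
      g.basicIncl x' + GCAlg.gen g.extDeg none * g.basicIncl y') : x = x' ∧ y = y' := by
  constructor
  -- Setting the new generator to zero reads off the basic part. Contracting with its dual vector
  -- first reads off the other coefficient.
  · have := congrArg g.basicPart h
    simpa only [map_add, map_mul, basicPart_new_gen, zero_mul, add_zero, basicPart_basicIncl]
      using this
  · have := congrArg (fun z => g.basicPart (g.fiberContr z)) h
    simpa only [map_add, fiberContr_basicIncl, fiberContr_new_gen_mul, zero_add,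
      basicPart_basicIncl] using this

variable {h : SuperLInf}

/-- If an algebra map pulls the generators back to `ρ(eⁱ) - e' ρ(s eⁱ)`, then it pulls every
element `x` back to `ρ(x) - e' ρ(s x)`. -/
theorem oxidation_apply (ρ : GCAlg h.cycDeg →ₐ[ℝ] g.CE)
    (hρ : ∀ j, ρ (GCAlg.gen h.cycDeg j) ∈ g.homog (h.cycDeg j)) (f : h.CE →ₐ[ℝ] GCAlg g.extDeg)
    (hf : ∀ i, f (h.gen i) = g.basicIncl (ρ (GCAlg.gen h.cycDeg (.base i))) -
      GCAlg.gen g.extDeg none * g.basicIncl (ρ (GCAlg.gen h.cycDeg (.shift i)))) (x : h.CE) :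
    f x = g.basicIncl (ρ (h.cycIncl x)) -
      GCAlg.gen g.extDeg none * g.basicIncl (ρ (h.shift (h.cycIncl x))) := by
  have key : f.toLinearMap = g.basicIncl.toLinearMap ∘ₗ ρ.toLinearMap ∘ₗ h.cycIncl.toLinearMap -
      LinearMap.mulLeft ℝ (GCAlg.gen g.extDeg none) ∘ₗ g.basicIncl.toLinearMap ∘ₗ ρ.toLinearMap ∘ₗ
        h.shift ∘ₗ h.cycIncl.toLinearMap := by
    apply linearMap_ext
    intro l
    simp only [LinearMap.sub_apply, LinearMap.comp_apply, AlgHom.toLinearMap_apply,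
      LinearMap.mulLeft_apply]
    induction l with
    | nil => simp [shift]
    | cons i l ih =>
      have hX := g.basicIncl_mem (hρ (.base i))
      have hXs := g.basicIncl_mem (hρ (.shift i))
      have hs : h.shift (GCAlg.gen h.cycDeg (.base i) * h.cycIncl (l.map (GCAlg.gen h.deg)).prod) =
          GCAlg.gen h.cycDeg (.shift i) * h.cycIncl (l.map (GCAlg.gen h.deg)).prod +
          koszul (1, 0) (h.cycDeg (.base i)) • (GCAlg.gen h.cycDeg (.base i) *
            h.shift (h.cycIncl (l.map (GCAlg.gen h.deg)).prod)) := by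
        rw [shift, gradedDer_gen_mul, koszul_neg_one]
        rfl
      rw [List.map_cons, List.prod_cons, map_mul, ih, map_mul, cycIncl_gen, hs, hf]
      simp only [map_add, map_mul, map_smul, mul_sub, sub_mul, mul_add]
      -- The sign from moving `e'` to the front is the Leibniz sign of `s`, and the term with two
      -- factors `e'` vanishes by `e2`. These facts make the oxidation formula multiplicative.
      have e1 := homog_mul_gen hX (none : Option g.Gen)
      rw [koszul_comm] at e1
      change _ = koszul (1, 0) (h.cycDeg (.base i)) • _ at e1
      have e2 := new_gen_mul_mul_new_gen hXs
      rw [← mul_assoc (GCAlg.gen g.extDeg none * _), e2, zero_mul, ← mul_assoc _ _ (g.basicIncl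
        (ρ (h.shift _))), e1, smul_mul_assoc, mul_smul_comm]
      simp only [mul_assoc]
      abel
  exact LinearMap.congr_fun key x

variable {c : g.CE} {hc : c ∈ g.homog (2, 0)} {hdc : g.d c = 0}

/-- The two components reproduce the differential of the cyclification: `ω₂ ↦ c` accounts for `c *
y`, and the sign from moving `d` past `e'` for the minus sign in `d s eⁱ = -s(d eⁱ)`. -/
theorem centralExt_d_sub (x y : g.CE) :
    (g.centralExt c hc hdc).d (g.basicIncl x - GCAlg.gen g.extDeg none * g.basicIncl y) =
      g.basicIncl (g.d x - c * y) + GCAlg.gen g.extDeg none * g.basicIncl (g.d y) := by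
  have h1 : ∀ z, (g.centralExt c hc hdc).d (g.basicIncl z) = g.basicIncl (g.d z) :=
    fun z => ext_d_basicIncl g c hc z
  have h2 : (g.centralExt c hc hdc).d (GCAlg.gen g.extDeg none) = g.basicIncl c :=
    (g.centralExt c hc hdc).d_gen none
  rw [map_sub, h1, (g.centralExt c hc hdc).d_mul (gen_mem (deg := g.extDeg) none), h1, h2,
    show koszul (1, 0) (g.extDeg none) = -1 from koszul_one_one]
  simp only [map_sub, map_mul, neg_one_smul]
  abel

/-- The images of the generators of a cyclification under a reduction. -/
def reductionGen (c : g.CE) (b s : h.Gen → g.CE) : CycGen h.Gen → g.CE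
  | .omega => c
  | .base i => b i
  | .shift i => s i

/-- Existence of reductions. -/
theorem exists_reduction (f : Hom (g.centralExt c hc hdc) h) (b s : h.Gen → g.CE)
    (hb : ∀ i, b i ∈ g.homog (h.deg i)) (hs : ∀ i, s i ∈ g.homog (h.deg i + (-1, 0)))
    (hf : ∀ i, f.pull (h.gen i) =
      g.basicIncl (b i) - GCAlg.gen g.extDeg none * g.basicIncl (s i)) :
    ∃ r : Hom g h.cyc, IsReduction f r ∧ (∀ i, r.pull (h.cyc.gen (.base i)) = b i) ∧
      ∀ i, r.pull (h.cyc.gen (.shift i)) = s i := by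
  have hmem : ∀ j, reductionGen c b s j ∈ g.homog (h.cycDeg j) := by
    rintro (_ | i | i)
    · exact hc
    · exact hb i
    · exact hs i
  set ρ : GCAlg h.cycDeg →ₐ[ℝ] g.CE := homogLift (reductionGen c b s) hmem with hρ
  have hgen : ∀ j, ρ (GCAlg.gen h.cycDeg j) = reductionGen c b s j := fun j => homogLift_gen _ _ j
  have hox := oxidation_apply ρ (fun j => by rw [hgen]; exact hmem j) f.pull
    (fun i => by rw [hgen, hgen]; exact hf i)
  have hd : ∀ i, ρ (h.cycIncl (h.dgen i)) = g.d (b i) - c * s i ∧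
      -ρ (h.shift (h.cycIncl (h.dgen i))) = g.d (s i) := by
    intro i
    -- Comparing the basic and fiber parts of `f(d eⁱ) = d f(eⁱ)` gives the two equations required
    -- of a map to the cyclification.
    apply basic_decomp_unique
    have e := f.pull_d (h.gen i)
    rw [d_gen, hox, hf, centralExt_d_sub] at e
    rw [← e, map_neg, mul_neg, sub_eq_add_neg]
  refine ⟨Hom.ofGens (reductionGen c b s) hmem ?_, ⟨hgen .omega, fun i => ?_⟩,
    fun i => hgen (.base i), fun i => hgen (.shift i)⟩
  · rintro (_ | i | i)
    · exact (map_zero ρ).trans hdc.symm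
    · change ρ (h.cycIncl (h.dgen i) + GCAlg.gen h.cycDeg .omega * GCAlg.gen h.cycDeg (.shift i)) =
        g.d (b i)
      rw [map_add, map_mul, hgen, hgen, (hd i).1]
      exact sub_add_cancel _ _
    · change ρ (-h.shift (h.cycIncl (h.dgen i))) = g.d (s i)
      rw [map_neg, (hd i).2]
  · rw [hf]
    change _ = g.basicIncl (ρ (GCAlg.gen h.cycDeg (.base i))) -
      GCAlg.gen g.extDeg none * g.basicIncl (ρ (GCAlg.gen h.cycDeg (.shift i)))
    rw [hgen, hgen]
    rfl

/-- Existence of oxidations. -/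
theorem exists_oxidation (r : Hom g h.cyc) (hr : r.pull (h.cyc.gen .omega) = c) :
    ∃ f : Hom (g.centralExt c hc hdc) h, IsReduction f r := by
  set φ : h.Gen → GCAlg g.extDeg := fun i => g.basicIncl (r.pull (h.cyc.gen (.base i))) -
    GCAlg.gen g.extDeg none * g.basicIncl (r.pull (h.cyc.gen (.shift i))) with hφ
  have hmem : ∀ i, φ i ∈ GCAlg.homog g.extDeg (h.deg i) := by
    intro i
    refine sub_mem (g.basicIncl_mem (r.pull_mem _ _ (gen_mem (deg := h.cycDeg) (.base i)))) ?_
    have := GCAlg.mul_mem (gen_mem (deg := g.extDeg) none)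
      (g.basicIncl_mem (r.pull_mem _ _ (gen_mem (deg := h.cycDeg) (.shift i))))
    have e : g.extDeg none + h.cycDeg (.shift i) = h.deg i := by
      change ((1, 0) : BiDeg) + (h.deg i + (-1, 0)) = h.deg i
      rw [add_left_comm]
      simp
    exact e ▸ this
  have hgen : ∀ i, homogLift φ hmem (h.gen i) = φ i := fun i => homogLift_gen _ _ i
  have hox := oxidation_apply r.pull
    (fun j => r.pull_mem _ _ (gen_mem (deg := h.cycDeg) j)) (homogLift φ hmem) hgen
  refine ⟨Hom.ofGens φ hmem fun i => ?_, hr, hgen⟩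
  rw [hox, hφ]
  dsimp only
  rw [centralExt_d_sub, ← r.pull_d, ← r.pull_d, d_gen, d_gen]
  change _ = g.basicIncl (r.pull (h.cycIncl (h.dgen i) + GCAlg.gen h.cycDeg .omega *
    GCAlg.gen h.cycDeg (.shift i)) - _) + _ * g.basicIncl (r.pull (-h.shift (h.cycIncl (h.dgen i))))
  rw [map_add r.pull, map_mul r.pull, map_neg r.pull, map_neg]
  change r.pull (GCAlg.gen h.cycDeg .omega) = c at hr
  rw [hr, add_sub_cancel_right, mul_neg, sub_eq_add_neg]

end

/-! ### Isomorphisms -/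

theorem Hom.isIso_of_inverse {g h : SuperLInf} (f : Hom g h) (ρ : g.CE →ₐ[ℝ] h.CE)
    (h1 : ∀ i, ρ (f.pull (h.gen i)) = h.gen i) (h2 : ∀ i, f.pull (ρ (g.gen i)) = g.gen i) :
    f.IsIso := by
  have e1 : ρ.comp f.pull = AlgHom.id ℝ _ := algHom_ext h1
  have e2 : f.pull.comp ρ = AlgHom.id ℝ _ := algHom_ext h2
  exact Function.bijective_iff_has_inverse.mpr
    ⟨ρ, fun x => DFunLike.congr_fun e1 x, fun x => DFunLike.congr_fun e2 x⟩

end SuperLInf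

/-- Values on generators of the inverse of the T-duality isomorphism. -/
def tInvGen : CycGen KUGen → (twistedKU 1).cyc.CE
  | .omega => -(twistedKU 1).cyc.gen (.shift .h3)
  | .base .h3 => (twistedKU 1).cyc.gen (.base .h3)
  | .shift .h3 => -(twistedKU 1).cyc.gen .omega
  | .base (.f k) => (twistedKU 1).cyc.gen (.shift (.f k))
  | .shift (.f k) => (twistedKU 1).cyc.gen (.base (.f (k - 1)))

theorem tInvGen_mem (j : CycGen KUGen) :
    tInvGen j ∈ (twistedKU 1).cyc.homog ((twistedKU 0).cyc.deg j) := by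
  have hg := fun j => gen_mem (deg := (twistedKU 1).cyc.deg) j
  rcases j with _ | (_ | k) | (_ | k)
  · exact neg_mem (hg (.shift .h3))
  · exact hg (.base .h3)
  · have := hg (.shift (.f k))
    have e : (twistedKU 1).cyc.deg (.shift (.f k)) = (twistedKU 0).cyc.deg (.base (.f k)) := by
      change ((2 * k + 1, 0) : BiDeg) + (-1, 0) = (2 * k + 0, 0)
      ext <;> simp
    rw [e] at this
    exact this
  · exact neg_mem (hg .omega)
  · have := hg (.base (.f (k - 1)))
    have e : (twistedKU 1).cyc.deg (.base (.f (k - 1))) =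
        (twistedKU 0).cyc.deg (.shift (.f k)) := by
      change ((2 * (k - 1) + 1, 0) : BiDeg) = (2 * k + 0, 0) + (-1, 0)
      ext <;> simp
      ring
    rw [e] at this
    exact this

theorem tDuality_pull_gen (j : CycGen KUGen) :
    tDuality.pull ((twistedKU 1).cyc.gen j) = tGen j :=
  homogLift_gen tGen tGen_mem j

theorem tDuality_isIso : tDuality.IsIso := by
  have hi : ∀ j, homogLift tInvGen tInvGen_mem ((twistedKU 0).cyc.gen j) = tInvGen j :=
    fun j => homogLift_gen _ _ j
  refine tDuality.isIso_of_inverse (homogLift tInvGen tInvGen_mem) ?_ ?_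
  · rintro (_ | (_ | k) | (_ | k)) <;> rw [tDuality_pull_gen] <;> simp only [tGen, map_neg, hi] <;>
      simp [tInvGen]
  · rintro (_ | (_ | k) | (_ | k)) <;> rw [hi] <;> simp only [tInvGen, map_neg, tDuality_pull_gen] <;>
      simp [tGen]

/-! ### Super-Minkowski algebras as central extensions -/

section

variable {ι : Type} [Fintype ι] {K' : Fin 9 → Matrix ι ι ℝ} {K : Fin 10 → Matrix ι ι ℝ}
  {c : Matrix ι ι ℝ} {hK : ∀ a : Fin 9, K a.castSucc = K' a} {hc : K (Fin.last 9) = c}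

theorem extIdent_pull_psi (α : ι) : (extIdent K' K c hK hc).pull ((superMink K).gen (.inl α)) =
    GCAlg.gen (superMink K').extDeg (some (.inl α)) := Hom.ofGens_pull_gen _ _ _ _

theorem extIdent_pull_castSucc (a : Fin 9) :
    (extIdent K' K c hK hc).pull ((superMink K).gen (.inr a.castSucc)) =
      GCAlg.gen (superMink K').extDeg (some (.inr a)) :=
  (Hom.ofGens_pull_gen _ _ _ _).trans (Fin.lastCases_castSucc a)

theorem extIdent_pull_last :
    (extIdent K' K c hK hc).pull ((superMink K).gen (.inr (Fin.last 9))) =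
      GCAlg.gen (superMink K').extDeg none :=
  (Hom.ofGens_pull_gen _ _ _ _).trans Fin.lastCases_last

/-- Values on generators of the inverse of the identification of a super-Minkowski algebra with a
central extension. -/
def extIdentInvGen : Option (ι ⊕ Fin 9) → GCAlg (minkDeg ι (Fin 10))
  | none => GCAlg.gen _ (.inr (Fin.last 9))
  | some (.inl α) => GCAlg.gen _ (.inl α)
  | some (.inr a) => GCAlg.gen _ (.inr a.castSucc)

theorem extIdentInvGen_mem (o : Option (ι ⊕ Fin 9)) : extIdentInvGen o ∈
    GCAlg.homog (minkDeg ι (Fin 10)) ((superMink K').extDeg o) := by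
  rcases o with _ | α | a
  · exact gen_mem (deg := minkDeg ι (Fin 10)) (.inr (Fin.last 9))
  · exact gen_mem (deg := minkDeg ι (Fin 10)) (.inl α)
  · exact gen_mem (deg := minkDeg ι (Fin 10)) (.inr a.castSucc)

theorem extIdent_isIso : (extIdent K' K c hK hc).IsIso := by
  have hi : ∀ j, homogLift extIdentInvGen (extIdentInvGen_mem (K' := K'))
      (GCAlg.gen (superMink K').extDeg j) = extIdentInvGen j := fun j => homogLift_gen _ _ j
  refine (extIdent K' K c hK hc).isIso_of_inverse
    (homogLift extIdentInvGen (extIdentInvGen_mem (K' := K'))) ?_ ?_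
  · rintro (α | a)
    · rw [extIdent_pull_psi, hi]; rfl
    · refine Fin.lastCases ?_ (fun a => ?_) a
      · rw [extIdent_pull_last, hi]; rfl
      · rw [extIdent_pull_castSucc, hi]; rfl
  · rintro (_ | α | a) <;> rw [hi]
    · exact extIdent_pull_last
    · exact extIdent_pull_psi α
    · exact extIdent_pull_castSucc a

end

namespace Majorana11

variable {ι : Type} [Fintype ι] [DecidableEq ι] (S : Majorana11 ι)

local notation "𝒜" => GCAlg (minkDeg ι (Fin 10))

/-! ### The type IIB flux densities as powers of the vielbein matrix -/

/-- In an increasing list the index 9 can only be last, so replacing `Γ_9` by `Γ_9 Γ_10` merely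
appends a `Γ_10`. -/
theorem prod_map_gammaB {l : List (Fin 10)} (hl : l.Pairwise (· < ·)) :
    (l.map S.gammaB).prod =
      (l.map S.gammaA).prod * (if (9 : Fin 10) ∈ l then S.Γ 10 else 1) := by
  induction l with
  | nil => simp
  | cons b l ih =>
    rw [List.pairwise_cons] at hl
    rw [List.map_cons, List.map_cons, List.prod_cons, List.prod_cons]
    by_cases hb : b = 9
    · subst hb
      have hnil : l = [] := by
        rw [List.eq_nil_iff_forall_not_mem]
        intro c hc
        exact absurd (hl.1 c hc) (not_lt.mpr (Fin.le_last c))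
      subst hnil
      simp only [List.map_nil, List.prod_nil, mul_one, List.mem_singleton, if_true, gammaB]
      rfl
    · have h9 : (9 : Fin 10) ∈ b :: l ↔ (9 : Fin 10) ∈ l := by
        rw [List.mem_cons, or_iff_right (Ne.symm hb)]
      rw [ih hl.2, mul_assoc]
      simp only [h9, gammaB, if_neg hb]
      rfl

-- After sorting, the extra `Γ_10` stands at the end and is split off. The sign then undoes the
-- sorting on the remaining factors, which genuinely anticommute; the `Γᴮ_a` themselves do not.
open Classical in
theorem gammaBs_eq {p : ℕ} {a : Fin p → Fin 10} (ha : Function.Injective a) :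
    S.gammaBs a = (List.ofFn fun i => S.gammaA (a i)).prod *
      (if ∃ i, a i = 9 then S.Γ 10 else 1) := by
  have hs : StrictMono (a ∘ Tuple.sort a) :=
    (Tuple.monotone_sort a).strictMono_of_injective (ha.comp (Tuple.sort a).injective)
  have h := S.prod_map_gammaB (l := List.ofFn (a ∘ Tuple.sort a))
    (List.pairwise_ofFn.mpr fun i j hij => hs hij)
  rw [List.map_ofFn, List.map_ofFn] at h
  have h9 : (9 : Fin 10) ∈ List.ofFn (a ∘ Tuple.sort a) ↔ ∃ i, a i = 9 := by
    rw [List.mem_ofFn]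
    exact (Tuple.sort a).exists_congr_left.trans (by simp)
  rw [gammaBs, if_pos ha, ← sign_smul_prod_ofFn S.gammaA (fun _ _ h => S.gammaA_anticomm h)
    (Tuple.sort a) a ha, smul_mul_assoc]
  simp only [h9] at h
  exact congrArg _ h

/-- The form generators with `e^9` set to zero. -/
def eBasic (a : Fin 10) : 𝒜 := if a = 9 then 0 else e a

theorem prod_map_eBasic (l : List (Fin 10)) :
    (l.map (eBasic (ι := ι))).prod = if (9 : Fin 10) ∈ l then 0 else (l.map e).prod := by
  induction l with
  | nil => simp
  | cons b l ih =>
    rw [List.map_cons, List.prod_cons, ih]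
    by_cases hb : b = 9
    · simp [hb, eBasic]
    · by_cases hl : (9 : Fin 10) ∈ l <;> simp [hb, hl, eBasic, Ne.symm hb]

/-- The matrix `∑ Γᴮ_{a₁ ⋯ a_p} e^{a₁} ⋯ e^{a_p}`. -/
def vielBPow (p : ℕ) : Matrix ι ι 𝒜 := slash S.gammaA eBasic ^ p +
  (slash S.gammaA e ^ p - slash S.gammaA eBasic ^ p) * realMat 𝒜 (S.Γ 10)

/-- Tuples avoiding 9 are collected by the power of the basic vielbein matrix. The remaining ones
form the difference of the two powers, and exactly these carry the trailing `Γ_10`. -/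
theorem form_gammaBs (p : ℕ) (Y : Matrix ι ι ℝ) :
    S.form p (fun a => S.gammaBs a * Y) = (p.factorial : ℝ)⁻¹ •
      bil (psi (Fin 10)) (realMat 𝒜 S.C * S.vielBPow p * realMat 𝒜 Y) := by
  classical
  rw [S.form_congr p fun a ha => congrArg (· * Y) (S.gammaBs_eq ha), form_eq_sum, vielBPow,
    slash_pow, slash_pow, ← Finset.sum_sub_distrib, Finset.sum_mul, ← Finset.sum_add_distrib,
    Finset.mul_sum, Finset.sum_mul]
  congr 2
  refine Finset.sum_congr rfl fun a _ => ?_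
  have h := prod_map_eBasic (ι := ι) (List.ofFn a)
  rw [List.map_ofFn, List.map_ofFn] at h
  have h' : (List.ofFn fun i => eBasic (ι := ι) (a i)).prod =
      if ∃ i, a i = 9 then 0 else (List.ofFn fun i => e (a i)).prod :=
    h.trans (if_congr List.mem_ofFn rfl rfl)
  rw [h', ← scalar_mul_realMat]
  by_cases h9 : ∃ i, a i = 9
  · simp only [if_pos h9, map_zero, zero_mul, zero_add, sub_zero, map_mul, ← mul_assoc]
    rw [← scalar_mul_realMat]
  · simp only [if_neg h9, sub_self, zero_mul, add_zero, map_mul, ← mul_assoc, mul_one]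
    rw [← scalar_mul_realMat]

theorem slash_eBasic_pow_eq_zero {p : ℕ} (hp : 10 < p) (G : Fin 10 → Matrix ι ι ℝ) :
    slash G (eBasic : Fin 10 → 𝒜) ^ p = 0 := by
  rw [slash_pow]
  refine Finset.sum_eq_zero fun a _ => ?_
  have h0 : (List.ofFn fun i => eBasic (ι := ι) (a i)).prod = 0 := by
    apply prod_ofFn_eq_zero
    · intro a b
      by_cases ha : a = 9 <;> by_cases hb : b = 9 <;> simp [eBasic, ha, hb, e_anticomm a b]
    · intro a
      by_cases ha : a = 9 <;> simp [eBasic, ha, e_sq]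
    · intro ha
      have := Fintype.card_le_of_injective a ha
      simp only [Fintype.card_fin] at this
      omega
  rw [h0, map_zero, zero_mul]

/-- The expression
`(1/(2n+1)!) (ψ̄ Γᴮ_{a₁ ⋯ a_{2n+1}} Γ_9 Γ_10^n ψ) e^{a₁} ⋯ e^{a_{2n+1}}`. -/
def fluxB (n : ℕ) : 𝒜 := ((2 * n + 1).factorial : ℝ)⁻¹ • bil (psi (Fin 10))
  (realMat 𝒜 S.C * S.vielBPow (2 * n + 1) * realMat 𝒜 (S.Γ 9 * S.Γ 10 ^ n))

theorem form_eq_fluxB {n p : ℕ} {Y : Matrix ι ι ℝ} (hp : p = 2 * n + 1)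
    (hY : Y = S.Γ 9 * S.Γ 10 ^ n) : S.form p (fun a => S.gammaBs a * Y) = S.fluxB n := by
  subst hp hY
  exact S.form_gammaBs _ _

theorem fluxB_of_lt {n : ℕ} (hn : 4 < n) : S.fluxB n = 0 := by
  rw [fluxB, vielBPow, slash_pow_eq_zero (by omega), slash_eBasic_pow_eq_zero (by omega)]
  simp

theorem FB_succ (n : ℕ) : S.FB (n + 1) = S.fluxB n := by
  have h1 := S.gamma_ten_pow_two_add
  rcases Nat.lt_or_ge n 5 with hn | hn
  · interval_cases n
    · exact (by simp [FB] : S.FB (((0 : ℕ) : ℤ) + 1) = _).trans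
        (S.form_eq_fluxB (Y := S.Γ 9) (n := 0) (p := 1) (by norm_num) (by simp))
    · exact (by simp [FB] : S.FB (((1 : ℕ) : ℤ) + 1) = _).trans
        (S.form_eq_fluxB (Y := S.Γ 9 * S.Γ 10) (n := 1) (p := 3) (by norm_num) (by simp))
    · exact (by simp [FB] : S.FB (((2 : ℕ) : ℤ) + 1) = _).trans
        (S.form_eq_fluxB (Y := S.Γ 9) (n := 2) (p := 5) (by norm_num) (by simp [h1 0]))
    · exact (by simp [FB] : S.FB (((3 : ℕ) : ℤ) + 1) = _).trans
        (S.form_eq_fluxB (Y := S.Γ 9 * S.Γ 10) (n := 3) (p := 7) (by norm_num) (by simp [h1 1]))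
    · exact (by simp [FB] : S.FB (((4 : ℕ) : ℤ) + 1) = _).trans
        (S.form_eq_fluxB (Y := S.Γ 9) (n := 4) (p := 9) (by norm_num) (by simp [h1 0, h1 2]))
  · have h : ∀ k : ℤ, k ≤ 5 → (n : ℤ) + 1 ≠ k := fun k hk => by omega
    rw [S.fluxB_of_lt (by omega), FB]
    simp only [if_neg (h 1 (by norm_num)), if_neg (h 2 (by norm_num)), if_neg (h 3 (by norm_num)),
      if_neg (h 4 (by norm_num)), if_neg (h 5 (by norm_num))]

theorem FB_of_nonpos {k : ℤ} (hk : k ≤ 0) : S.FB k = 0 := by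
  have h : ∀ j : ℤ, 1 ≤ j → k ≠ j := fun j hj => by omega
  simp only [FB, if_neg (h 1 (by norm_num)), if_neg (h 2 (by norm_num)), if_neg (h 3 (by norm_num)),
    if_neg (h 4 (by norm_num)), if_neg (h 5 (by norm_num))]

theorem prod_e_mem (l : List (Fin 10)) :
    (l.map (e (ι := ι))).prod ∈ GCAlg.homog (minkDeg ι (Fin 10)) (l.length, 0) := by
  induction l with
  | nil => exact GCAlg.one_mem
  | cons a l ih =>
    have h := GCAlg.mul_mem (e_mem (ι := ι) a) ih
    rw [List.map_cons, List.prod_cons, List.length_cons, Nat.cast_succ]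
    rwa [Prod.mk_add_mk, add_zero, add_comm] at h

theorem form_mem (p : ℕ) (G : (Fin p → Fin 10) → Matrix ι ι ℝ) :
    S.form p G ∈ GCAlg.homog (minkDeg ι (Fin 10)) (p + 2, 0) := by
  refine Submodule.smul_mem _ _ (sum_mem fun a _ => ?_)
  have h := prod_e_mem (ι := ι) (List.ofFn a)
  rw [List.map_ofFn, List.length_ofFn] at h
  have h2 := GCAlg.mul_mem (quad_mem (κ := Fin 10) (S.C * G a)) h
  rwa [Prod.mk_add_mk, add_zero, add_comm] at h2

theorem FB_mem (k : ℤ) : S.FB k ∈ S.IIB.homog (2 * k + 1, 0) := by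
  rcases le_or_gt k 0 with hk | hk
  · rw [S.FB_of_nonpos hk]; exact zero_mem _
  · obtain ⟨n, rfl⟩ : ∃ n : ℕ, k = n + 1 := ⟨(k - 1).toNat, by omega⟩
    rw [FB_succ, ← S.form_eq_fluxB rfl rfl]
    have h := S.form_mem (2 * n + 1) fun a => S.gammaBs a * (S.Γ 9 * S.Γ 10 ^ n)
    rwa [show ((2 * n + 1 : ℕ) : ℤ) + 2 = 2 * ((n : ℤ) + 1) + 1 by push_cast; ring] at h

theorem H3B_mem : S.H3B ∈ S.IIB.homog (3, 0) := sum_mem fun a _ => S.pair_mul_e_mem _ a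

local notation "ℬ" => GCAlg (minkDeg ι (Fin 9))

/-! ### Dimensional reduction of the flux densities -/

/-- The matrix-valued one-form `e^a Γ_a` in nine dimensions. -/
def viel9 : Matrix ι ι ℬ := slash S.gamma9 fun a => GCAlg.gen (minkDeg ι (Fin 9)) (.inr a)

/-- The basic part of `H₃`. -/
def basicH : ℬ := ∑ a : Fin 9, S.pair (Fin 9) (S.gamma9 a * S.Γ 10) *
  GCAlg.gen (minkDeg ι (Fin 9)) (.inr a)

/-- The basic part of the type IIA flux densities. -/
def basicA (n : ℕ) : ℬ := ((2 * n).factorial : ℝ)⁻¹ •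
  bil (psi (Fin 9)) (realMat ℬ (S.C * S.Γ 10 ^ (n + 1)) * S.viel9 ^ (2 * n))

/-- The fiber integral of the type IIA flux densities. -/
def fiberA (n : ℕ) : ℬ := ((2 * n + 1).factorial : ℝ)⁻¹ •
  bil (psi (Fin 9)) (realMat ℬ (S.C * (S.Γ 10 ^ n * S.Γ 9)) * S.viel9 ^ (2 * n + 1))

theorem vec_mem (a : Fin 9) : GCAlg.gen (minkDeg ι (Fin 9)) (.inr a) ∈
    GCAlg.homog (minkDeg ι (Fin 9)) (1, 0) := gen_mem (deg := minkDeg ι (Fin 9)) (.inr a)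

theorem basicH_mem : S.basicH ∈ GCAlg.homog (minkDeg ι (Fin 9)) (3, 0) := by
  refine sum_mem fun a _ => ?_
  have h := GCAlg.mul_mem (quad_mem (κ := Fin 9) (S.C * (S.gamma9 a * S.Γ 10))) (vec_mem a)
  rwa [show ((2, 0) : BiDeg) + (1, 0) = (3, 0) by decide] at h

theorem basicA_mem (n : ℕ) :
    S.basicA n ∈ GCAlg.homog (minkDeg ι (Fin 9)) (2 * ((n : ℤ) + 1), 0) := by
  have h := bil_mem _ (realMat_mul_mem (S.C * S.Γ 10 ^ (n + 1))
    (slash_pow_mem S.gamma9 (vec_mem (ι := ι)) (2 * n)))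
  rw [show (((2 * n : ℕ) : ℤ) + 2) = 2 * ((n : ℤ) + 1) by push_cast; ring] at h
  exact Submodule.smul_mem _ _ h

theorem fiberA_mem (n : ℕ) :
    S.fiberA n ∈ GCAlg.homog (minkDeg ι (Fin 9)) (2 * ((n : ℤ) + 1) + 1, 0) := by
  have h := bil_mem _ (realMat_mul_mem (S.C * (S.Γ 10 ^ n * S.Γ 9))
    (slash_pow_mem S.gamma9 (vec_mem (ι := ι)) (2 * n + 1)))
  rw [show (((2 * n + 1 : ℕ) : ℤ) + 2) = 2 * ((n : ℤ) + 1) + 1 by push_cast; ring] at h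
  exact Submodule.smul_mem _ _ h

/-- The algebra of forms on a central extension of the nine-dimensional algebra. -/
abbrev ExtForms (S : Majorana11 ι) : Type := GCAlg S.dim9.extDeg

/-- The odd generators of a central extension of the nine-dimensional algebra. -/
def psiExt (α : ι) : S.ExtForms := GCAlg.gen S.dim9.extDeg (some (.inl α))

/-- The new generator. -/
def eExt : S.ExtForms := GCAlg.gen S.dim9.extDeg none

/-- The matrix-valued one-form `e^a Γ_a` pulled back to a central extension. -/
def vielExt : Matrix ι ι S.ExtForms :=
  slash S.gamma9 fun a => GCAlg.gen S.dim9.extDeg (some (.inr a))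

theorem basicIncl_bil (M : Matrix ι ι ℬ) :
    S.dim9.basicIncl (bil (psi (Fin 9)) M) = bil S.psiExt (S.dim9.basicIncl.mapMatrix M) := by
  rw [map_bil]
  congr 2
  funext α
  exact basicIncl_gen S.dim9 (.inl α)

theorem mapMatrix_viel9 : S.dim9.basicIncl.mapMatrix S.viel9 = S.vielExt := by
  rw [viel9, mapMatrix_slash, vielExt]
  congr 1
  funext a
  exact basicIncl_gen S.dim9 (.inr a)

theorem basicIncl_basicA (n : ℕ) : S.dim9.basicIncl (S.basicA n) = ((2 * n).factorial : ℝ)⁻¹ •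
    bil S.psiExt (realMat _ (S.C * S.Γ 10 ^ (n + 1)) * S.vielExt ^ (2 * n)) := by
  rw [basicA, map_smul, basicIncl_bil, map_mul, map_pow, mapMatrix_viel9, mapMatrix_realMat]

theorem basicIncl_fiberA (n : ℕ) :
    S.dim9.basicIncl (S.fiberA n) = ((2 * n + 1).factorial : ℝ)⁻¹ •
      bil S.psiExt (realMat _ (S.C * (S.Γ 10 ^ n * S.Γ 9)) * S.vielExt ^ (2 * n + 1)) := by
  rw [fiberA, map_smul, basicIncl_bil, map_mul, map_pow, mapMatrix_viel9, mapMatrix_realMat]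

theorem basicIncl_pair (M : Matrix ι ι ℝ) :
    S.dim9.basicIncl (S.pair (Fin 9) M) = bil S.psiExt (realMat _ (S.C * M)) := by
  rw [pair_eq_bil, basicIncl_bil, mapMatrix_realMat]

theorem eExt_comm (α β : ι) : S.eExt * (S.psiExt α * S.psiExt β) =
    S.psiExt α * S.psiExt β * S.eExt := by
  have h : S.psiExt α * S.psiExt β ∈ GCAlg.homog S.dim9.extDeg (2, 0) := by
    have h := S.dim9.basicIncl_mem (psi_mul_psi_mem (κ := Fin 9) α β)
    rw [map_mul] at h
    have e : ∀ α, S.dim9.basicIncl (psi (Fin 9) α) = S.psiExt α :=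
      fun α => basicIncl_gen S.dim9 (.inl α)
    rwa [e, e] at h
  exact (GCAlg.mul_comm_of_mem_two h _).symm

theorem bil_eExt_mul (M : Matrix ι ι S.ExtForms) :
    bil S.psiExt (Matrix.scalar ι S.eExt * M) = S.eExt * bil S.psiExt M :=
  bil_scalar_mul _ _ _ S.eExt_comm

/-- The part of the vielbein matrix along the new generator. -/
def fiberExt : Matrix ι ι S.ExtForms := Matrix.scalar ι S.eExt * realMat _ (S.Γ 9)

theorem gamma9_anticomm (a : Fin 9) : S.gamma9 a * S.Γ 9 = -(S.Γ 9 * S.gamma9 a) :=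
  S.gamma_anticomm fun h => (Fin.castSucc_lt_last a).ne (Fin.castSucc_injective _ h)

theorem gamma9_anticomm_ten (a : Fin 9) : S.gamma9 a * S.Γ 10 = -(S.Γ 10 * S.gamma9 a) :=
  S.gammaA_mul_gamma_ten a.castSucc

theorem vielExt_mul_realMat {X : Matrix ι ι ℝ}
    (hX : ∀ a, S.gamma9 a * X = -(X * S.gamma9 a)) :
    S.vielExt * realMat _ X = -(realMat _ X * S.vielExt) := by
  rw [vielExt, slash, Finset.sum_mul, Finset.mul_sum, ← Finset.sum_neg_distrib]
  refine Finset.sum_congr rfl fun a _ => ?_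
  rw [mul_assoc, ← map_mul, hX, map_neg, mul_neg, ← mul_assoc, ← scalar_mul_realMat, mul_assoc,
    ← map_mul]

theorem vielExt_mul_eExt :
    S.vielExt * Matrix.scalar ι S.eExt = -(Matrix.scalar ι S.eExt * S.vielExt) := by
  rw [vielExt, slash, Finset.sum_mul, Finset.mul_sum, ← Finset.sum_neg_distrib]
  refine Finset.sum_congr rfl fun a _ => ?_
  have h : GCAlg.gen S.dim9.extDeg (some (.inr a)) * S.eExt =
      -(S.eExt * GCAlg.gen S.dim9.extDeg (some (.inr a))) := by
    rw [eExt, gen_mul_gen, show koszul (S.dim9.extDeg (some (.inr a))) (S.dim9.extDeg none) = -1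
      from koszul_one_one, neg_one_smul]
  rw [mul_assoc, ← scalar_mul_realMat, ← mul_assoc, ← map_mul, h, map_neg, map_mul, neg_mul,
    mul_assoc]

/-- Two signs cancel: one from the one-forms and one from `Γ_9` against the other Clifford
generators. -/
theorem vielExt_fiberExt_comm : S.vielExt * S.fiberExt = S.fiberExt * S.vielExt := by
  rw [fiberExt, ← mul_assoc, vielExt_mul_eExt, neg_mul, mul_assoc,
    S.vielExt_mul_realMat S.gamma9_anticomm, mul_neg, neg_neg, mul_assoc]

theorem fiberExt_sq : S.fiberExt * S.fiberExt = 0 := by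
  rw [fiberExt, ← mul_assoc, mul_assoc (Matrix.scalar ι S.eExt), ← scalar_mul_realMat, ← mul_assoc,
    ← map_mul, show S.eExt * S.eExt = 0 from new_gen_sq, map_zero, zero_mul, zero_mul]

theorem vielExt_add_fiberExt_pow (n : ℕ) : (S.vielExt + S.fiberExt) ^ (n + 1) =
    S.vielExt ^ (n + 1) + (n + 1) • (S.fiberExt * S.vielExt ^ n) :=
  add_pow_of_mul_self_eq_zero S.vielExt_fiberExt_comm S.fiberExt_sq n

theorem map_bil_psi {f : 𝒜 →ₐ[ℝ] S.ExtForms}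
    (hψ : ∀ α, f (psi (Fin 10) α) = S.psiExt α) (M : Matrix ι ι 𝒜) :
    f (bil (psi (Fin 10)) M) = bil S.psiExt (f.mapMatrix M) := by
  rw [map_bil]
  congr 2
  funext α
  exact hψ α

theorem map_pair {f : 𝒜 →ₐ[ℝ] S.ExtForms}
    (hψ : ∀ α, f (psi (Fin 10) α) = S.psiExt α) (M : Matrix ι ι ℝ) :
    f (S.pair (Fin 10) M) = S.dim9.basicIncl (S.pair (Fin 9) M) := by
  rw [pair_eq_bil, S.map_bil_psi hψ, mapMatrix_realMat, basicIncl_pair]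

theorem map_slash_e {f : 𝒜 →ₐ[ℝ] S.ExtForms}
    (he : ∀ a : Fin 9, f (e a.castSucc) = GCAlg.gen S.dim9.extDeg (some (.inr a)))
    (he9 : f (e (Fin.last 9)) = S.eExt) :
    f.mapMatrix (slash S.gammaA e) = S.vielExt + S.fiberExt := by
  rw [mapMatrix_slash, slash, Fin.sum_univ_castSucc, he9]
  simp only [he]
  rfl

theorem map_slash_eBasic {f : 𝒜 →ₐ[ℝ] S.ExtForms}
    (he : ∀ a : Fin 9, f (e a.castSucc) = GCAlg.gen S.dim9.extDeg (some (.inr a))) :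
    f.mapMatrix (slash S.gammaA eBasic) = S.vielExt := by
  have h9 : eBasic (ι := ι) (Fin.last 9) = 0 := if_pos rfl
  have h : ∀ a : Fin 9, eBasic (ι := ι) a.castSucc = e a.castSucc :=
    fun a => if_neg (Fin.castSucc_lt_last a).ne
  rw [mapMatrix_slash, slash, Fin.sum_univ_castSucc, h9]
  simp only [h, he, map_zero, zero_mul, add_zero]
  rfl

theorem map_fluxA_zero {f : 𝒜 →ₐ[ℝ] S.ExtForms} (hψ : ∀ α, f (psi (Fin 10) α) = S.psiExt α) :
    f (S.fluxA 0) = S.dim9.basicIncl (S.basicA 0) := by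
  rw [basicIncl_basicA, fluxA, map_smul, S.map_bil_psi hψ, map_mul, mapMatrix_realMat, mul_zero,
    pow_zero, pow_zero, map_one]

/-- The linear binomial term carries the factor `2n+2`, which turns `1/(2n+2)!` into the
normalization of `fiberA`. The power `Γ_10^(n+2)` reduces to `Γ_10^n`. -/
theorem map_fluxA_succ {f : 𝒜 →ₐ[ℝ] S.ExtForms} (hψ : ∀ α, f (psi (Fin 10) α) = S.psiExt α)
    (he : ∀ a : Fin 9, f (e a.castSucc) = GCAlg.gen S.dim9.extDeg (some (.inr a)))
    (he9 : f (e (Fin.last 9)) = S.eExt) (n : ℕ) :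
    f (S.fluxA (n + 1)) = S.dim9.basicIncl (S.basicA (n + 1)) +
      S.eExt * S.dim9.basicIncl (S.fiberA n) := by
  rw [basicIncl_basicA, basicIncl_fiberA, fluxA, map_smul, S.map_bil_psi hψ, map_mul,
    mapMatrix_realMat, map_pow, S.map_slash_e he he9, show 2 * (n + 1) = 2 * n + 1 + 1 by ring,
    vielExt_add_fiberExt_pow, mul_add, map_add, smul_add]
  congr 1
  rw [mul_smul_comm, fiberExt, map_nsmul, mul_assoc (Matrix.scalar ι S.eExt), ← mul_assoc,
    ← scalar_mul_realMat, mul_assoc, bil_eExt_mul, mul_smul_comm _ S.eExt, ← mul_assoc (realMat _ _),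
    ← map_mul, gamma_ten_pow_two_add, mul_assoc S.C, ← Nat.cast_smul_eq_nsmul ℝ, smul_smul,
    Nat.factorial_succ (2 * n + 1)]
  congr 1
  have := (2 * n + 1).factorial_ne_zero
  push_cast
  field_simp

/-- This is T-duality of the RR fluxes in components: up to sign, the basic and fiber parts are the
fiber part of the next IIA flux and the basic part of the current one. -/
theorem map_fluxB {f : 𝒜 →ₐ[ℝ] S.ExtForms} (hψ : ∀ α, f (psi (Fin 10) α) = S.psiExt α)
    (he : ∀ a : Fin 9, f (e a.castSucc) = GCAlg.gen S.dim9.extDeg (some (.inr a)))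
    (he9 : f (e (Fin.last 9)) = S.eExt) (n : ℕ) :
    f (S.fluxB n) = -S.dim9.basicIncl (S.fiberA n) - S.eExt * S.dim9.basicIncl (S.basicA n) := by
  have hU9 := S.vielExt_mul_realMat S.gamma9_anticomm
  have hU10 := S.vielExt_mul_realMat S.gamma9_anticomm_ten
  have hgg : realMat S.ExtForms (S.Γ 10) * realMat _ (S.Γ 10) = 1 := by
    rw [← map_mul, gamma_ten_sq, map_one]
  have hkk : realMat S.ExtForms (S.Γ 9) * realMat _ (S.Γ 9) = 1 := by
    rw [← map_mul, gamma_sq]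
    simp [eta]
  have hgk : realMat S.ExtForms (S.Γ 10) * realMat _ (S.Γ 9) =
      -(realMat _ (S.Γ 9) * realMat _ (S.Γ 10)) := by
    rw [← map_mul, S.gamma_anticomm (by decide), map_neg, map_mul]
  -- Passing the odd power costs `n + 1` signs and reordering `Γ_9 Γ_10^n` costs `n`, so a single
  -- sign remains.
  have hodd : S.vielExt ^ (2 * n + 1) * realMat _ (S.Γ 9 * S.Γ 10 ^ n) =
      -(realMat _ (S.Γ 10 ^ n * S.Γ 9) * S.vielExt ^ (2 * n + 1)) := by
    have h9 := odd_pow_anticomm hU9 n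
    have h10 := odd_pow_anticomm hU10 n
    simp only [map_mul, map_pow]
    generalize S.vielExt ^ (2 * n + 1) = u at *
    generalize realMat S.ExtForms (S.Γ 10) = g at *
    generalize realMat S.ExtForms (S.Γ 9) = k at *
    rcases Nat.even_or_odd' n with ⟨j, rfl | rfl⟩
    · rw [pow_mul, pow_two, hgg, one_pow, mul_one, one_mul, h9]
    · rw [pow_succ, pow_mul, pow_two, hgg, one_pow, one_mul, ← mul_assoc, h9, neg_mul, mul_assoc,
        h10, mul_neg, hgk, neg_mul, mul_assoc]
  -- The even power commutes with both generators, and `Γ_9 Γ_10 Γ_9 = -Γ_10` supplies the sign.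
  have heven : S.fiberExt * S.vielExt ^ (2 * n) * realMat _ (S.Γ 10) *
      realMat _ (S.Γ 9 * S.Γ 10 ^ n) =
      -(Matrix.scalar ι S.eExt * (realMat _ (S.Γ 10 ^ (n + 1)) * S.vielExt ^ (2 * n))) := by
    have h9 := even_pow_comm hU9 n
    have h10 := ((show Commute _ _ from even_pow_comm hU10 n).pow_right (n + 1)).eq
    simp only [fiberExt, map_mul, map_pow]
    generalize S.vielExt ^ (2 * n) = u at *
    generalize realMat S.ExtForms (S.Γ 10) = g at *
    generalize realMat S.ExtForms (S.Γ 9) = k at *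
    rw [mul_assoc _ k u, ← h9, mul_assoc, mul_assoc, ← mul_assoc g k, hgk, ← h10,
      neg_mul, mul_neg, mul_neg, neg_inj]
    congr 1
    rw [mul_assoc u k, mul_assoc k g, ← pow_succ', ← mul_assoc k k, hkk, one_mul]
  rw [basicIncl_basicA, basicIncl_fiberA, fluxB, map_smul, S.map_bil_psi hψ, map_mul f.mapMatrix,
    map_mul f.mapMatrix,
    mapMatrix_realMat, mapMatrix_realMat, vielBPow, map_add f.mapMatrix,
    map_mul f.mapMatrix, map_sub f.mapMatrix, map_pow f.mapMatrix, map_pow f.mapMatrix,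
    S.map_slash_e he he9, S.map_slash_eBasic he, mapMatrix_realMat, vielExt_add_fiberExt_pow,
    add_sub_cancel_left, mul_add, add_mul, map_add, smul_add, sub_eq_add_neg]
  congr 1
  · rw [mul_assoc, hodd, mul_neg, map_neg, smul_neg, ← mul_assoc, ← map_mul]
  · rw [smul_mul_assoc, mul_smul_comm, smul_mul_assoc, map_nsmul, mul_assoc, heven, mul_neg, map_neg,
      ← mul_assoc, ← scalar_mul_realMat, mul_assoc, bil_eExt_mul, ← mul_assoc (realMat _ S.C),
      ← map_mul, mul_smul_comm _ S.eExt, smul_neg, smul_neg, ← Nat.cast_smul_eq_nsmul ℝ, smul_smul,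
      Nat.factorial_succ]
    congr 2
    have := (2 * n).factorial_ne_zero
    push_cast
    field_simp

theorem pair_mul_eExt (M : Matrix ι ι ℝ) : S.dim9.basicIncl (S.pair (Fin 9) M) * S.eExt =
    S.eExt * S.dim9.basicIncl (S.pair (Fin 9) M) :=
  GCAlg.mul_comm_of_mem_two (S.dim9.basicIncl_mem (quad_mem _)) _

/-- Forms that are linear in the vielbein decompose into a basic part and a part along the new
generator. -/
theorem map_sum_pair_mul_e {f : 𝒜 →ₐ[ℝ] S.ExtForms}
    (hψ : ∀ α, f (psi (Fin 10) α) = S.psiExt α)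
    (he : ∀ a : Fin 9, f (e a.castSucc) = GCAlg.gen S.dim9.extDeg (some (.inr a)))
    (he9 : f (e (Fin.last 9)) = S.eExt) (G : Fin 10 → Matrix ι ι ℝ)
    (hG : ∀ a : Fin 9, G a.castSucc = S.gamma9 a * S.Γ 10) :
    f (∑ a, S.pair (Fin 10) (G a) * e a) = S.dim9.basicIncl S.basicH +
      S.eExt * S.dim9.basicIncl (S.pair (Fin 9) (G (Fin.last 9))) := by
  have hb : ∀ a : Fin 9, S.dim9.basicIncl (GCAlg.gen (minkDeg ι (Fin 9)) (.inr a)) =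
      GCAlg.gen S.dim9.extDeg (some (.inr a)) := fun a => basicIncl_gen S.dim9 (.inr a)
  simp only [map_sum, map_mul, S.map_pair hψ, basicH, hb]
  rw [Fin.sum_univ_castSucc, he9, pair_mul_eExt]
  simp only [he, hG]

/-- The nine-dimensional components of the basic part of the type IIA fluxes. -/
def baseGen : KUGen → S.dim9.CE
  | .h3 => S.basicH
  | .f k => if k ≤ 0 then 0 else S.basicA (k - 1).toNat

/-- The nine-dimensional components of the fiber part of the type IIA fluxes. -/
def shiftGen : KUGen → S.dim9.CE
  | .h3 => -S.c1B
  -- The flux `F_2` contains no vielbein and has no fiber part, so the shift in `k` is by two. The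
  -- minus sign is that of the reduction convention.
  | .f k => if k ≤ 1 then 0 else -S.fiberA (k - 2).toNat

theorem baseGen_mem (i : KUGen) : S.baseGen i ∈ S.dim9.homog ((twistedKU 0).deg i) := by
  rcases i with _ | k
  · exact S.basicH_mem
  · change (if k ≤ 0 then 0 else _) ∈ S.dim9.homog (2 * k + 0, 0)
    split_ifs with hk
    · exact zero_mem _
    · have h := S.basicA_mem (k - 1).toNat
      rwa [show 2 * (((k - 1).toNat : ℤ) + 1) = 2 * k + 0 by omega] at h

theorem shiftGen_mem (i : KUGen) :
    S.shiftGen i ∈ S.dim9.homog ((twistedKU 0).deg i + (-1, 0)) := by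
  rcases i with _ | k
  · have e : (twistedKU 0).deg .h3 + (-1, 0) = (2, 0) := by
      change ((3, 0) : BiDeg) + (-1, 0) = (2, 0)
      simp
    rw [e]
    exact neg_mem (quad_mem _)
  · have e : (twistedKU 0).deg (.f k) + (-1, 0) = (2 * k - 1, 0) := by
      change ((2 * k + 0, 0) : BiDeg) + (-1, 0) = (2 * k - 1, 0)
      simp [sub_eq_add_neg]
    rw [e]
    change (if k ≤ 1 then 0 else _) ∈ _
    split_ifs with hk
    · exact zero_mem _
    · have h := S.fiberA_mem (k - 2).toNat
      rw [show 2 * (((k - 2).toNat : ℤ) + 1) + 1 = 2 * k - 1 by omega] at h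
      exact neg_mem h

/-! ### Decomposition of the fluxes along the two central extensions -/

theorem extA_pull_psi (α : ι) : S.extA.pull (psi (Fin 10) α) = S.psiExt α := extIdent_pull_psi α

theorem extA_pull_castSucc (a : Fin 9) :
    S.extA.pull (e a.castSucc) = GCAlg.gen S.dim9.extDeg (some (.inr a)) :=
  extIdent_pull_castSucc a

theorem extA_pull_last : S.extA.pull (e (Fin.last 9)) = S.eExt := extIdent_pull_last

theorem extB_pull_psi (α : ι) : S.extB.pull (psi (Fin 10) α) = S.psiExt α := extIdent_pull_psi α

theorem extB_pull_castSucc (a : Fin 9) :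
    S.extB.pull (e a.castSucc) = GCAlg.gen S.dim9.extDeg (some (.inr a)) :=
  extIdent_pull_castSucc a

theorem extB_pull_last : S.extB.pull (e (Fin.last 9)) = S.eExt := extIdent_pull_last

theorem extA_pull_H3A :
    S.extA.pull S.H3A = S.dim9.basicIncl S.basicH + S.eExt * S.dim9.basicIncl S.c1B :=
  S.map_sum_pair_mul_e S.extA_pull_psi S.extA_pull_castSucc S.extA_pull_last
    (fun a => S.gammaA a * S.Γ 10) fun _ => rfl

/-- Since `Γᴮ_9 Γ_10 = Γ_9 Γ_10 Γ_10 = Γ_9`, the fiber part is `c1A`, whereas that of `H3A` is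
`c1B`. The two three-forms share their basic part and exchange the cocycles, as `tDuality` demands.
-/
theorem extB_pull_H3B :
    S.extB.pull S.H3B = S.dim9.basicIncl S.basicH + S.eExt * S.dim9.basicIncl S.c1A := by
  have h := S.map_sum_pair_mul_e S.extB_pull_psi S.extB_pull_castSucc S.extB_pull_last
    (fun a => S.gammaB a * S.Γ 10) fun a => by
      rw [gammaB, if_neg (show a.castSucc ≠ (9 : Fin 10) from (Fin.castSucc_lt_last a).ne)]; rfl
  have h9 : S.gammaB (Fin.last 9) * S.Γ 10 = S.Γ 9 := by
    rw [gammaB, if_pos (show Fin.last 9 = (9 : Fin 10) from rfl), mul_assoc, gamma_ten_sq, mul_one]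
  rw [h9] at h
  exact h

theorem extA_pull_FA (k : ℤ) : S.extA.pull (S.FA k) = S.dim9.basicIncl (S.baseGen (.f k)) -
    S.eExt * S.dim9.basicIncl (S.shiftGen (.f k)) := by
  rcases le_or_gt k 0 with hk | hk
  · rw [S.FA_of_nonpos hk, baseGen, shiftGen, if_pos hk, if_pos (by omega)]
    simp
  · obtain ⟨n, rfl⟩ : ∃ n : ℕ, k = n + 1 := ⟨(k - 1).toNat, by omega⟩
    rw [FA_succ, baseGen, shiftGen, if_neg (by omega), show ((n : ℤ) + 1 - 1).toNat = n by omega]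
    cases n with
    | zero =>
      rw [if_pos (by simp), map_zero, mul_zero, sub_zero]
      exact S.map_fluxA_zero S.extA_pull_psi
    | succ n =>
      rw [if_neg (by omega), show (((n + 1 : ℕ) : ℤ) + 1 - 2).toNat = n by omega, map_neg, mul_neg,
        sub_neg_eq_add]
      exact S.map_fluxA_succ S.extA_pull_psi S.extA_pull_castSucc S.extA_pull_last n

theorem extB_pull_FB (k : ℤ) : S.extB.pull (S.FB k) = S.dim9.basicIncl (S.shiftGen (.f (k + 1))) -
    S.eExt * S.dim9.basicIncl (S.baseGen (.f k)) := by
  rcases le_or_gt k 0 with hk | hk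
  · rw [S.FB_of_nonpos hk, baseGen, shiftGen, if_pos hk, if_pos (by omega)]
    simp
  · obtain ⟨n, rfl⟩ : ∃ n : ℕ, k = n + 1 := ⟨(k - 1).toNat, by omega⟩
    rw [FB_succ, baseGen, shiftGen, if_neg (by omega), if_neg (by omega),
      show ((n : ℤ) + 1 - 1).toNat = n by omega, show ((n : ℤ) + 1 + 1 - 2).toNat = n by omega,
      map_neg]
    exact S.map_fluxB S.extB_pull_psi S.extB_pull_castSucc S.extB_pull_last n

theorem exists_IIA_hom : ∃ f : Hom S.IIA (twistedKU 0), HasComponents f S.H3A S.FA :=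
  exists_hasComponents S.H3A_mem (fun k => by rw [add_zero]; exact S.FA_mem k) S.d_H3A S.d_FA

/-- The reduction of the type IIA fluxes to nine dimensions. -/
theorem exists_IIA_reduction {fA : Hom S.IIA (twistedKU 0)} (hA : HasComponents fA S.H3A S.FA) :
    ∃ r : Hom S.dim9 (twistedKU 0).cyc, IsReduction (S.extA.comp fA) r ∧
      (∀ i, r.pull ((twistedKU 0).cyc.gen (.base i)) = S.baseGen i) ∧
      ∀ i, r.pull ((twistedKU 0).cyc.gen (.shift i)) = S.shiftGen i := by
  refine exists_reduction (S.extA.comp fA) S.baseGen S.shiftGen S.baseGen_mem S.shiftGen_mem ?_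
  rintro (_ | k)
  · change S.extA.pull (fA.pull _) = _
    rw [hA.1, extA_pull_H3A, shiftGen, map_neg, mul_neg, sub_neg_eq_add]
    rfl
  · change S.extA.pull (fA.pull _) = _
    rw [hA.2]
    exact S.extA_pull_FA k

/-- The T-dual of the reduction of the type IIA fluxes oxidizes to the type IIB fluxes. -/
theorem oxidation_hasComponents {r : Hom S.dim9 (twistedKU 0).cyc}
    (hω : r.pull ((twistedKU 0).cyc.gen .omega) = S.c1A)
    (hb : ∀ i, r.pull ((twistedKU 0).cyc.gen (.base i)) = S.baseGen i)
    (hs : ∀ i, r.pull ((twistedKU 0).cyc.gen (.shift i)) = S.shiftGen i) :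
    ∃ f : Hom (S.dim9.centralExt S.c1B (quad_mem _) (gradedDer_quad _ _)) (twistedKU 1),
      IsReduction f (r.comp tDuality) ∧
      HasComponents f (S.extB.pull S.H3B) fun k => S.extB.pull (S.FB k) := by
  have hT : ∀ j, (r.comp tDuality).pull ((twistedKU 1).cyc.gen j) = r.pull (tGen j) :=
    fun j => congrArg r.pull (tDuality_pull_gen j)
  -- The map `T` pulls `ω₂` back to `-s h₃`, whose image is `c1B`, because `s h₃` is sent to `-c1B`.
  -- Thus the oxidation is along the IIB extension.
  obtain ⟨f, hf⟩ := exists_oxidation (hc := quad_mem _) (hdc := gradedDer_quad _ _) (c := S.c1B)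
    (r.comp tDuality) (by
      rw [hT, tGen, map_neg, hs, shiftGen, neg_neg])
  refine ⟨f, hf, ?_, fun k => ?_⟩
  · rw [hf.2, hT, hT, tGen, tGen, hb, map_neg, hω, map_neg, mul_neg, sub_neg_eq_add]
    exact S.extB_pull_H3B.symm
  · rw [hf.2, hT, hT, tGen, tGen, hb, hs]
    exact (S.extB_pull_FB k).symm

theorem extA_isIso : S.extA.IsIso := extIdent_isIso

theorem extB_isIso : S.extB.IsIso := extIdent_isIso

end Majorana11

end SuperL

end

/-! ### The IIB homomorphism from T-duality -/

theorem mainTheorem6 {ι : Type} [Fintype ι] [DecidableEq ι] (S : Majorana11 ι) :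
    -- the invariants have the right bidegrees and satisfy the Bianchi identities
    S.H3B ∈ S.IIB.homog (3, 0) ∧
    (∀ k : ℤ, S.FB k ∈ S.IIB.homog (2 * k + 1, 0)) ∧
    S.IIB.d S.H3B = 0 ∧
    (∀ k : ℤ, S.IIB.d (S.FB k) = S.H3B * S.FB (k - 1)) ∧
    -- such systems of elements are equivalently homomorphisms to `𝔩 (Σ¹ KU // BU(1))`
    (∀ (H : S.IIB.CE) (F : ℤ → S.IIB.CE),
      (H ∈ S.IIB.homog (3, 0) ∧ (∀ k : ℤ, F k ∈ S.IIB.homog (2 * k + 1, 0)) ∧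
        S.IIB.d H = 0 ∧ ∀ k : ℤ, S.IIB.d (F k) = H * F (k - 1)) ↔
      ∃! f : Hom S.IIB (twistedKU 1), HasComponents f H F) ∧
    -- in particular, the invariants are the components of a homomorphism
    ∃ fB : Hom S.IIB (twistedKU 1),
      HasComponents fB S.H3B S.FB ∧
      -- over `𝔩 B²U(1)`
      (∃ hB : Hom S.IIB lineB2U1, hB.pull (lineB2U1.gen ()) = S.H3B ∧ fB.comp (kuFib 1) = hB) ∧
      -- which is obtained from the type IIA cocycles by reduction to 9 dimensions, the T-duality
      -- isomorphism of coefficients, and re-oxidation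
      S.extA.IsIso ∧ S.extB.IsIso ∧ tDuality.IsIso ∧
      ∃ fA : Hom S.IIA (twistedKU 0), HasComponents fA S.H3A S.FA ∧
        ∃ r : Hom S.dim9 (twistedKU 0).cyc,
          IsReduction (S.extA.comp fA) r ∧ IsReduction (S.extB.comp fB) (r.comp tDuality) := by
  obtain ⟨fA, hA⟩ := S.exists_IIA_hom
  obtain ⟨r, hr, hb, hs⟩ := S.exists_IIA_reduction hA
  obtain ⟨f, hf, hfB⟩ := S.oxidation_hasComponents hr.1 hb hs
  -- The oxidation is a homomorphism, so its components satisfy the Bianchi identities. Injectivity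
  -- of `S.extB.pull` carries them back to the IIB algebra.
  obtain ⟨-, -, hdH, hdF⟩ := hfB.bianchi
  have dH : S.IIB.d S.H3B = 0 := S.extB_isIso.1 (by rw [S.extB.pull_d, hdH, map_zero])
  have dF : ∀ k, S.IIB.d (S.FB k) = S.H3B * S.FB (k - 1) := fun k =>
    S.extB_isIso.1 (by rw [S.extB.pull_d, hdF, map_mul])
  obtain ⟨fB, hB⟩ := exists_hasComponents (m := 1) S.H3B_mem S.FB_mem dH dF
  -- Components determine a homomorphism, so the IIB map seen on the extension is the oxidation
  -- already constructed.
  have hcomp : S.extB.comp fB = f :=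
    HasComponents.unique ⟨congrArg S.extB.pull hB.1, fun k => congrArg S.extB.pull (hB.2 k)⟩ hfB
  refine ⟨S.H3B_mem, S.FB_mem, dH, dF, fun H F => ⟨fun h => ?_, fun ⟨_, h, _⟩ => h.bianchi⟩, fB, hB,
    ?_, S.extA_isIso, S.extB_isIso, tDuality_isIso, fA, hA, r, hr, hcomp ▸ hf⟩
  · obtain ⟨f, hf⟩ := exists_hasComponents (m := 1) h.1 h.2.1 h.2.2.1 h.2.2.2
    exact ⟨f, hf, fun f' hf' => hf'.unique hf⟩
  · have h : (fB.comp (kuFib 1)).pull (lineB2U1.gen ()) = S.H3B :=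
      (congrArg fB.pull (Hom.ofGens_pull_gen _ _ _ _)).trans hB.1
    exact ⟨fB.comp (kuFib 1), h, rfl⟩
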